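/- Let $d\ge 1$, $H\in(0,1)$, and let $X=\{X_t=(X^1_t,\dots,X^d_t),\,t\ge 0\}$ be a measurable $d$-dimensional process whose components are independent copies of one real centered Gaussian process. Assume that $X$ is strongly locally nondeterministic with index $H$: there is $\kappa_H>0$ such that for all $m\ge 1$ and all times $s_1,\dots,s_m,t\in(0,\infty)$, $$\mathrm{Var}\big(X^1_t\,\big|\,X^1_{s_1},\dots,X^1_{s_m}\big)\ \ge\ \kappa_H\,\min\{|t-s_1|^{2H},\dots,|t-s_m|^{2H},t^{2H}\}.$$ For $\alpha=(\alpha_1,\dots,\alpha_d)\in[0,\infty)^d$ put $|\alpha|=\sum_{\ell}\alpha_\ell$, and for $\varepsilon>0$, $T\ge 0$, $x\in\mathbb R^d$ let $$D^{(\alpha)}_{\pm}p_\varepsilon(x)=\frac1{(2\pi)^d}\int_{\mathbb R^d}\Big(\prod_{\ell=1}^d|y_\ell|^{\alpha_\ell}e^{\pm\iota\frac{\pi\alpha_\ell}{2}\mathrm{sgn}(y_\ell)}\Big)e^{\iota y\cdot x}e^{-\frac{\varepsilon}{2}|y|^2}\,dy,\qquad L^{(\alpha)}_{\pm,\varepsilon}(T,x)=\int_0^T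 D^{(\alpha)}_{\pm}p_\varepsilon(X_t+x)\,dt,$$ where $\iota=\sqrt{-1}$. If $L^{(\alpha)}_{\pm,\varepsilon}(T,x)$ converges in $L^p$ as $\varepsilon\downarrow 0$, the limit is denoted $L^{(\alpha)}_{\pm}(T,x)$; it is the right-handed ($+$) or left-handed ($-$) $\alpha$-th derivative of the local time of $X$. Let $\alpha\in[0,\infty)^d$ satisfy $H(2|\alpha|+d)<1$. Then for all $T\ge0$ and $x\in\mathbb R^d$, $L^{(\alpha)}_{+}(T,x)$ and $L^{(\alpha)}_{-}(T,x)$ exist in $L^p$ for every $p\in[1,\infty)$ (with the same limit for all $p$). Moreover, for each choice of sign: 1. For every $x\in\mathbb R^d$, the process $T\mapsto L^{(\alpha)}_{\pm}(T,x)$, $T\in[0,\infty)$, has a continuous modification which is locally $\theta_1$-Hölder continuous for all $\theta_1\in(0,\,1-H(|\alpha|+d))$. 2. For every $T\ge 0$, the random field $x\mapsto L^{(\alpha)}_{\pm}(T,x)$, $x\in\mathbb R^d$, has a continuous modification which is locally $\theta_2$-Hölder continuous for all $\theta_2\in\big(0,\,1\wedge\tfrac12(\tfrac1H-2|\alpha|-d)\big)$.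 3. For all $T\ge 0$, $x\in\mathbb R^d$ and $p\in[1,\infty)$: if $\beta\in[0,\infty)^d$ with $H(2|\beta|+d)<1$ and $\beta_\ell\to\alpha_\ell$ for all $\ell=1,\dots,d$, then $L^{(\beta)}_{\pm}(T,x)\to L^{(\alpha)}_{\pm}(T,x)$ in $L^p$. -/

import Mathlib

open MeasureTheory ProbabilityTheory Set Filter Topology
open scoped NNReal ENNReal

namespace FracLocalTime

/-- Strong local nondeterminism with index `H` of a real process `Y` indexed by `[0, ∞)`: for some
`κ > 0`, the conditional variance of `Y t` given `Y (s 1), …, Y (s m)` is almost surely at least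
`κ * min {|t - s 1| ^ (2 * H), …, |t - s m| ^ (2 * H), t ^ (2 * H)}`, for all positive times. -/
def SLND {Ω : Type*} [MeasurableSpace Ω] (P : Measure Ω) (H : ℝ) (Y : ℝ≥0 → Ω → ℝ) : Prop :=
  ∃ κ : ℝ, 0 < κ ∧ ∀ m : ℕ, 1 ≤ m → ∀ (s : Fin m → ℝ≥0) (t : ℝ≥0), (∀ i, 0 < s i) → 0 < t →
    ∀ᵐ ω ∂P,
      κ * min (⨅ i : Fin m, |(t : ℝ) - (s i : ℝ)| ^ (2 * H)) ((t : ℝ) ^ (2 * H)) ≤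
        condVar (MeasurableSpace.comap (fun ω i ↦ Y (s i) ω) MeasurableSpace.pi) (Y t) P ω

/-- `X` is a `d`-dimensional (measurable) centered Gaussian process on `[0, ∞)` whose components are
independent copies of one real centered Gaussian process with the strong local nondeterminism
property of index `H`. -/
structure IsSLNDGaussian {Ω : Type*} [MeasurableSpace Ω] (P : Measure Ω) (H : ℝ) {d : ℕ}
    (X : ℝ≥0 → Ω → EuclideanSpace ℝ (Fin d)) : Prop where
  /-- `X` is a measurable process, so that its time integrals make sense. -/
  measurable : Measurable (fun q : ℝ≥0 × Ω ↦ X q.1 q.2)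
  gaussian : ∀ l, IsGaussianProcess (fun t ω ↦ X t ω l) P
  centered : ∀ l t, ∫ ω, X t ω l ∂P = 0
  /-- The components are independent, as random elements of the path space. -/
  indep : iIndepFun (fun (l : Fin d) ω (t : ℝ≥0) ↦ X t ω l) P
  /-- The components have the same law, as random elements of the path space. -/
  identDistrib : ∀ l k : Fin d,
    IdentDistrib (fun ω (t : ℝ≥0) ↦ X t ω l) (fun ω (t : ℝ≥0) ↦ X t ω k) P P
  slnd : ∀ l, SLND P H (fun t ω ↦ X t ω l)

/-- The fractional derivative of order `α` of the heat kernel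
`(2 * π * ε) ^ (-d / 2) * exp (-‖x‖ ^ 2 / (2 * ε))` at `x`, in Fourier form. It is the right-handed
one for `s = 1` and the left-handed one for `s = -1`. -/
noncomputable def heatKernelDeriv {d : ℕ} (s : ℝ) (α : Fin d → ℝ) (ε : ℝ)
    (x : EuclideanSpace ℝ (Fin d)) : ℂ :=
  (1 / (2 * Real.pi) ^ d : ℝ) *
    ∫ y : EuclideanSpace ℝ (Fin d),
      (∏ l, ((|y l| ^ α l : ℝ) : ℂ) *
          Complex.exp (((s * (Real.pi * α l / 2 * Real.sign (y l)) : ℝ) : ℂ) * Complex.I)) *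
        Complex.exp (((inner ℝ y x : ℝ) : ℂ) * Complex.I) *
        ((Real.exp (-(ε / 2) * ‖y‖ ^ 2) : ℝ) : ℂ)

/-- The heat kernel approximation `∫₀ᵀ D^α p_ε (X_t + x) dt` of the derivative of order `α` of the
local time of `X`. -/
noncomputable def approxDeriv {Ω : Type*} {d : ℕ} (X : ℝ≥0 → Ω → EuclideanSpace ℝ (Fin d))
    (s : ℝ) (α : Fin d → ℝ) (ε : ℝ) (T : ℝ≥0) (x : EuclideanSpace ℝ (Fin d)) (ω : Ω) : ℂ :=
  ∫ t in (0 : ℝ)..(T : ℝ), heatKernelDeriv s α ε (X t.toNNReal ω + x)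

/-- `Z` is the derivative of order `α` (right-handed for `s = 1`, left-handed for `s = -1`) of the
local time of `X` at `(T, x)` in `L^p`: the heat kernel approximations lie in `L^p` and converge to
`Z` in `L^p` as `ε ↓ 0`. -/
def IsLocalTimeDeriv {Ω : Type*} [MeasurableSpace Ω] (P : Measure Ω) {d : ℕ}
    (X : ℝ≥0 → Ω → EuclideanSpace ℝ (Fin d)) (p : ℝ≥0∞) (s : ℝ) (α : Fin d → ℝ) (T : ℝ≥0)
    (x : EuclideanSpace ℝ (Fin d)) (Z : Ω → ℂ) : Prop :=
  (∀ ε : ℝ, 0 < ε → MemLp (approxDeriv X s α ε T x) p P) ∧ MemLp Z p P ∧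
    Tendsto (fun ε : ℝ ↦ eLpNorm (approxDeriv X s α ε T x - Z) p P) (𝓝[>] 0) (𝓝 0)

/-- The orders `α ∈ [0, ∞)^d` with `H * (2 * |α| + d) < 1`, where `|α|` is the sum of the entries. -/
def admissible (H : ℝ) (d : ℕ) : Set (Fin d → ℝ) :=
  {α | (∀ l, 0 ≤ α l) ∧ H * (2 * (∑ l, α l) + d) < 1}

/-- Local Hölder continuity of exponent `θ`. -/
def LocallyHolder {E F : Type*} [PseudoEMetricSpace E] [PseudoEMetricSpace F] (θ : ℝ≥0)
    (f : E → F) : Prop :=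
  ∀ a, ∃ C : ℝ≥0, ∃ u ∈ 𝓝 a, HolderOnWith C θ f u

end FracLocalTime

/-! ### Integrals along chains of times and Gaussian integrals of Gram forms. -/

namespace FracLocalTime

/-! In Fourier form the heat kernel approximation is the integral over $(0,T]\times\mathbb R^d$ of
$G(y)e^{\iota y\cdot X_t}$, with a deterministic kernel satisfying $|G(y)|\le|y|^{|\alpha|}$ for
every $\varepsilon$ (`approxDeriv_eq_occupation`). Expanding an even moment and taking expectations
replaces the phases by $e^{-Q/2}$, where $Q$ is the variance of $\sum_j y_j\cdot X_{t_j}$, a Gram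
form in $L^2$ (`enorm_integral_prod_occupation_le`). It remains to bound the integral of
$\prod_j(1+|y_j|^b)e^{-Q/2}$ over times and frequencies.

Order the times, with gaps $u_j=t_j-t_{j-1}$. Half of $Q$ is integrated by Gram–Schmidt:
nondeterminism relative to the earlier times gives $\prod_j u_j^{-Hd}$ up to constants
(`lintegral_exp_gram_le`). The other half absorbs the weights: $t_j$ is at distance at least
$\min(u_j,u_{j+1})\ge u_ju_{j+1}/h$ from all other times, so the weight at $j$ costs
$(u_ju_{j+1}/h)^{-Hb}$. Every gap then carries at worst $u^{-H(2b+d)}$, integrable when $H(2b+d)<1$,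
and the $n$-th moment over a window of length $h$ is $O(h^{n(1-H(b+d))})$
(`exists_lintegral_weight_exp_gram_le`, `exists_eLpNorm_occupation_le`).

All claims follow by inserting suitable kernels. The difference of two values of $\varepsilon$ is
small against a slightly larger $b$, which gives existence. A single kernel on a short window gives
the exponent in time. A shift in $x$ costs $b=|\alpha|+\theta$, whence the exponent in space.
Kolmogorov's theorem (`exists_locallyHolder_modification`) turns the moment bounds into
modifications. Continuity in the order is dominated convergence inside the moment bound, which does
not see $\varepsilon$. -/

/-- By translation invariance the integral over the later times does not depend on the time from
which they start, so the first time can be split off. -/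
lemma lintegral_chain_eq (φ : ℝ → ℝ≥0∞) (hφ : Measurable φ) (n : ℕ) (a : ℝ) :
    ∫⁻ t : Fin n → ℝ, ∏ j : Fin n, φ (t j - (Fin.cons a t : Fin (n + 1) → ℝ) j.castSucc) =
      (∫⁻ u, φ u) ^ n := by
  induction n generalizing a with
  | zero => simp [Measure.volume_pi_eq_dirac (0 : Fin 0 → ℝ)]
  | succ n ih =>
    have hmeas : ∀ b : ℝ, ∀ j : Fin n, Measurable fun t : Fin n → ℝ ↦
        φ (t j - (Fin.cons b t : Fin (n + 1) → ℝ) j.castSucc) := by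
      intro b j
      refine hφ.comp ((measurable_pi_apply j).sub ?_)
      refine Fin.cases ?_ (fun k ↦ ?_) j.castSucc
      · simp
      · simp only [Fin.cons_succ]
        fun_prop
    have e := (volume_preserving_piFinSuccAbove (fun _ : Fin (n + 1) ↦ ℝ) 0).symm
    rw [← e.lintegral_comp_emb (MeasurableEquiv.measurableEmbedding _)]
    have : ∀ p : ℝ × (Fin n → ℝ), (∏ j : Fin (n + 1),
        φ ((MeasurableEquiv.piFinSuccAbove (fun _ ↦ ℝ) 0).symm p j -
        (Fin.cons a ((MeasurableEquiv.piFinSuccAbove (fun _ ↦ ℝ) 0).symm p) :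
          Fin (n + 1 + 1) → ℝ) j.castSucc)) = φ (p.1 - a) * ∏ j : Fin n,
            φ (p.2 j - (Fin.cons p.1 p.2 : Fin (n + 1) → ℝ) j.castSucc) := by
      intro p
      rw [Fin.prod_univ_succ]
      simp [MeasurableEquiv.piFinSuccAbove_symm_apply, Fin.insertNthEquiv]
    simp_rw [this]
    rw [Measure.volume_eq_prod, lintegral_prod _ ?_]
    · rw [lintegral_congr fun x : ℝ ↦ (lintegral_const_mul (φ (x - a))
        (Finset.measurable_fun_prod _ fun j _ ↦ hmeas x j)).trans (by rw [ih])]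
      rw [lintegral_mul_const _ (by fun_prop), lintegral_sub_right_eq_self φ a, pow_succ']
    · refine Measurable.aemeasurable ((hφ.comp (by fun_prop)).mul
        (Finset.measurable_fun_prod _ fun j _ ↦ hφ.comp ?_))
      refine Measurable.sub (by fun_prop) ?_
      refine Fin.cases ?_ (fun k ↦ ?_) j.castSucc <;> simp <;> fun_prop

lemma lintegral_exp_neg_mul_sq_norm {ι : Type*} [Fintype ι] {b : ℝ} (hb : 0 < b) :
    ∫⁻ y : EuclideanSpace ℝ ι, ENNReal.ofReal (Real.exp (-b * ‖y‖ ^ 2)) =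
      ENNReal.ofReal ((Real.pi / b) ^ (Fintype.card ι / 2 : ℝ)) := by
  have h := GaussianFourier.integral_rexp_neg_mul_sq_norm (V := EuclideanSpace ℝ ι) hb
  rw [finrank_euclideanSpace] at h
  rw [← h, ofReal_integral_eq_lintegral_ofReal]
  · by_contra hn
    rw [integral_undef hn] at h
    have : 0 < (Real.pi / b) ^ (Fintype.card ι / 2 : ℝ) := by positivity
    exact this.ne h
  · exact ae_of_all _ fun _ ↦ (Real.exp_pos _).le

/-- Orthogonal projection onto the span, with coefficients: these become the shift of the
integration variables in the Gram integral. -/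
lemma exists_sub_sum_orthogonal {V : Type*} [NormedAddCommGroup V] [InnerProductSpace ℝ V]
    {κ : Type*} [Fintype κ] (v : κ → V) (x : V) :
    ∃ c : κ → ℝ, ∀ a : κ → ℝ, inner ℝ (∑ i, a i • v i) (x - ∑ i, c i • v i) = 0 := by
  let K := Submodule.span ℝ (range v)
  have : FiniteDimensional ℝ K := FiniteDimensional.span_of_finite ℝ (finite_range v)
  obtain ⟨c, hc⟩ := Submodule.mem_span_range_iff_exists_fun ℝ |>.1 (K.starProjection_apply_mem x)
  refine ⟨c, fun a ↦ ?_⟩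
  rw [hc]
  exact (K.sub_starProjection_mem_orthogonal x) _
    (Submodule.sum_mem _ fun i _ ↦ Submodule.smul_mem _ _ (Submodule.subset_span ⟨i, rfl⟩))

lemma lintegral_prod_mul_translate {E G : Type*} [MeasureSpace E] [MeasureSpace G]
    [SFinite (volume : Measure G)] [AddGroup G] [MeasurableAdd₂ G]
    [(volume : Measure G).IsAddRightInvariant] {A : E → ℝ≥0∞} {F : G → ℝ≥0∞} {g : E → G}
    (hA : Measurable A) (hF : Measurable F) (hg : Measurable g) :
    ∫⁻ p : E × G, A p.1 * F (p.2 + g p.1) = (∫⁻ x, A x) * ∫⁻ y, F y := by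
  rw [Measure.volume_eq_prod, lintegral_prod _ (by fun_prop), ← lintegral_mul_const _ hA]
  refine lintegral_congr fun x ↦ ?_
  dsimp only
  rw [lintegral_const_mul _ (by fun_prop), lintegral_add_right_eq_self]

lemma measurable_exp_gram {ι V κ : Type*} [Fintype ι] [Fintype κ] [NormedAddCommGroup V]
    [InnerProductSpace ℝ V] (v : κ → ι → V) :
    Measurable fun y : κ → EuclideanSpace ℝ ι ↦
      ENNReal.ofReal (Real.exp (-(1 / 4) * ∑ l, ‖∑ j, y j l • v j l‖ ^ 2)) := by
  have : Continuous fun y : κ → EuclideanSpace ℝ ι ↦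
      Real.exp (-(1 / 4) * ∑ l, ‖∑ j, y j l • v j l‖ ^ 2) := by fun_prop
  exact this.measurable.ennreal_ofReal

/-- If each vector has distance at least `r j` from the span of its predecessors, then the Gaussian
integral of the Gram form is at most the one for orthogonal vectors of lengths `r j`. -/
lemma lintegral_exp_gram_le {ι V : Type*} [Fintype ι] [NormedAddCommGroup V]
    [InnerProductSpace ℝ V] (n : ℕ) (v : Fin n → ι → V) (r : Fin n → ℝ) (hr : ∀ j, 0 < r j)
    (h : ∀ j l (c : Fin n → ℝ), (∀ i, j ≤ i → c i = 0) →
      r j ≤ ‖v j l - ∑ i, c i • v i l‖ ^ 2) :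
    ∫⁻ y : Fin n → EuclideanSpace ℝ ι,
        ENNReal.ofReal (Real.exp (-(1 / 4) * ∑ l, ‖∑ j, y j l • v j l‖ ^ 2)) ≤
      ∏ j, ENNReal.ofReal ((Real.pi / (1 / 4 * r j)) ^ (Fintype.card ι / 2 : ℝ)) := by
  induction n with
  | zero => simp [Measure.volume_pi_eq_dirac (0 : Fin 0 → EuclideanSpace ℝ ι)]
  | succ n ih =>
    choose c hc using fun l ↦ exists_sub_sum_orthogonal (fun j : Fin n ↦ v j.castSucc l)
      (v (Fin.last n) l)
    have e := (volume_preserving_piFinSuccAbove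
      (fun _ : Fin (n + 1) ↦ EuclideanSpace ℝ ι) (Fin.last n)).symm
    rw [← e.lintegral_comp_emb (MeasurableEquiv.measurableEmbedding _)]
    -- Gram–Schmidt for the last vector, in each coordinate `l`: its projection on the predecessors
    -- is moved into their coefficients as a shift, the cross term vanishes by orthogonality, and
    -- the remainder has squared length at least `r (Fin.last n)`.
    have key : ∀ p : EuclideanSpace ℝ ι × (Fin n → EuclideanSpace ℝ ι),
        ENNReal.ofReal (Real.exp (-(1 / 4) * ∑ l, ‖∑ j,
          (MeasurableEquiv.piFinSuccAbove (fun _ ↦ EuclideanSpace ℝ ι) (Fin.last n)).symm p j l •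
            v j l‖ ^ 2)) ≤
        ENNReal.ofReal (Real.exp (-(1 / 4 * r (Fin.last n)) * ‖p.1‖ ^ 2)) *
        ENNReal.ofReal (Real.exp (-(1 / 4) * ∑ l, ‖∑ j,
          (p.2 + fun j ↦ WithLp.toLp 2 fun l ↦ p.1 l * c l j) j l • v j.castSucc l‖ ^ 2)) := by
      intro p
      rw [← ENNReal.ofReal_mul (Real.exp_pos _).le, ← Real.exp_add]
      refine ENNReal.ofReal_le_ofReal (Real.exp_le_exp.2 ?_)
      rw [EuclideanSpace.real_norm_sq_eq, neg_mul_eq_neg_mul, mul_assoc (-(1 / 4)), ← mul_add,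
        Finset.mul_sum (a := r (Fin.last n)), ← Finset.sum_add_distrib]
      refine mul_le_mul_of_nonpos_left (Finset.sum_le_sum fun l _ ↦ ?_) (by norm_num)
      have hsplit : ∑ j, (MeasurableEquiv.piFinSuccAbove (fun _ ↦ EuclideanSpace ℝ ι)
            (Fin.last n)).symm p j l • v j l =
          ∑ j, (p.2 + fun j ↦ WithLp.toLp 2 fun l ↦ p.1 l * c l j) j l • v j.castSucc l +
          p.1 l • (v (Fin.last n) l - ∑ j, c l j • v j.castSucc l) := by
        rw [Fin.sum_univ_castSucc]
        simp [MeasurableEquiv.piFinSuccAbove_symm_apply, Fin.insertNthEquiv, add_smul,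
          Finset.sum_add_distrib, smul_sub, Finset.smul_sum, smul_smul]
      have hdist := h (Fin.last n) l (Fin.snoc (c l) 0) (fun i hi ↦ by
        rw [Fin.last_le_iff.1 hi]; simp)
      rw [Fin.sum_univ_castSucc] at hdist
      simp only [Fin.snoc_castSucc, Fin.snoc_last, zero_smul, add_zero] at hdist
      rw [hsplit, norm_add_sq_real, inner_smul_right, hc, norm_smul, mul_pow, Real.norm_eq_abs,
        sq_abs]
      nlinarith [sq_nonneg (p.1 l)]
    refine (lintegral_mono key).trans ?_
    have hg : Measurable fun x : EuclideanSpace ℝ ι ↦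
        fun j : Fin n ↦ (WithLp.toLp 2 fun l ↦ x l * c l j : EuclideanSpace ℝ ι) :=
      Continuous.measurable (by fun_prop)
    have hm₁ : Measurable fun x : EuclideanSpace ℝ ι ↦
        ENNReal.ofReal (Real.exp (-(1 / 4 * r (Fin.last n)) * ‖x‖ ^ 2)) := by fun_prop
    refine (lintegral_prod_mul_translate hm₁
      (measurable_exp_gram fun (j : Fin n) l ↦ v j.castSucc l) hg).trans_le ?_
    rw [Fin.prod_univ_castSucc, mul_comm, lintegral_exp_neg_mul_sq_norm
      (mul_pos (by norm_num) (hr _))]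
    gcongr
    refine ih (fun j ↦ v j.castSucc) (fun j ↦ r j.castSucc) (fun j ↦ hr _) ?_
    intro j l a ha
    have := h j.castSucc l (Fin.snoc a 0) (fun i hi ↦ by
      induction i using Fin.lastCases with
      | last => simp
      | cast i => simpa using ha i (by simpa using hi))
    rw [Fin.sum_univ_castSucc] at this
    simpa using this

end FracLocalTime

/-! ### Local nondeterminism and the frequency integral at fixed times. -/

namespace FracLocalTime

/-- The Gram form `∑ l, ‖∑ j, y j l • V l (t j)‖ ^ 2`. -/
noncomputable def gram {d : ℕ} {V : Type*} [NormedAddCommGroup V] [InnerProductSpace ℝ V]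
    (v : Fin d → ℝ → V) {n : ℕ} (t : Fin n → ℝ) (y : Fin n → EuclideanSpace ℝ (Fin d)) : ℝ :=
  ∑ l, ‖∑ j, y j l • v l (t j)‖ ^ 2

/-- Strong local nondeterminism of finitely many curves in a Hilbert space. -/
def LocND {d : ℕ} {V : Type*} [NormedAddCommGroup V] [InnerProductSpace ℝ V]
    (v : Fin d → ℝ → V) (κ H : ℝ) : Prop :=
  ∀ (l : Fin d) (n : ℕ) (s c : Fin n → ℝ) (t ρ : ℝ), 0 < ρ → ρ ≤ t → (∀ i, 0 < s i) →
    (∀ i, c i ≠ 0 → ρ ≤ |t - s i|) →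
    κ * ρ ^ (2 * H) ≤ ‖v l t - ∑ i, c i • v l (s i)‖ ^ 2

lemma exists_rpow_le_exp {c b : ℝ} (hc : 0 < c) (hb : 0 ≤ b) :
    ∃ M : ℝ, 1 ≤ M ∧ ∀ z : ℝ, 0 ≤ z → z ^ b * Real.exp (-c * z ^ 2) ≤ M := by
  obtain ⟨k, hk⟩ := exists_nat_ge (b / 2)
  refine ⟨1 + k.factorial / c ^ k, by simp; positivity, fun z hz ↦ ?_⟩
  have h1 : z ^ b ≤ 1 + (z ^ 2) ^ k := by
    have : z ^ b = (z ^ 2) ^ (b / 2) := by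
      rw [← Real.rpow_natCast z 2, ← Real.rpow_mul hz]; congr 1; push_cast; ring
    rw [this]
    rcases le_total (z ^ 2) 1 with h | h
    · exact (Real.rpow_le_one (by positivity) h (by positivity)).trans (by simp; positivity)
    · calc (z ^ 2) ^ (b / 2) ≤ (z ^ 2) ^ (k : ℝ) := Real.rpow_le_rpow_of_exponent_le h hk
        _ ≤ _ := by rw [Real.rpow_natCast]; simp
  have h2 := Real.pow_div_factorial_le_exp (c * z ^ 2) (by positivity) k
  have h3 : (z ^ 2) ^ k ≤ k.factorial / c ^ k * Real.exp (c * z ^ 2) := by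
    rw [mul_pow, div_le_iff₀ (by positivity)] at h2
    rw [div_mul_eq_mul_div, le_div_iff₀ (by positivity)]
    linarith
  have h4 : 1 ≤ Real.exp (c * z ^ 2) := Real.one_le_exp (by positivity)
  rw [neg_mul, Real.exp_neg, mul_inv_le_iff₀ (Real.exp_pos _)]
  linarith

/-- The scaling $z=\rho^Hx$ reduces the power of $x$ to `exists_rpow_le_exp`; the summand $1$ is
absorbed because $\rho^{Hb}\le R^{Hb}$. -/
lemma exists_one_add_rpow_mul_exp_le {c b H R : ℝ} (hc : 0 < c) (hb : 0 ≤ b) (hH : 0 ≤ H)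
    (hR : 0 < R) :
    ∃ M : ℝ, 0 < M ∧ ∀ ρ x : ℝ, 0 < ρ → ρ ≤ R → 0 ≤ x →
      (1 + x ^ b) * Real.exp (-c * (ρ ^ (2 * H) * x ^ 2)) ≤ M * ρ ^ (-(H * b)) := by
  obtain ⟨M, hM1, hM⟩ := exists_rpow_le_exp hc hb
  refine ⟨R ^ (H * b) + M, by positivity, fun ρ x hρ hρR hx ↦ ?_⟩
  have hz := hM (ρ ^ H * x) (by positivity)
  have e1 : (ρ ^ H * x) ^ 2 = ρ ^ (2 * H) * x ^ 2 := by
    rw [mul_pow, ← Real.rpow_natCast (ρ ^ H) 2, ← Real.rpow_mul hρ.le]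
    congr 2; push_cast; ring
  have e2 : (ρ ^ H * x) ^ b = ρ ^ (H * b) * x ^ b := by
    rw [Real.mul_rpow (by positivity) hx, ← Real.rpow_mul hρ.le]
  rw [e1, e2] at hz
  have h1 : Real.exp (-c * (ρ ^ (2 * H) * x ^ 2)) ≤ 1 := by
    rw [Real.exp_le_one_iff, neg_mul]; simp; positivity
  have h2 : ρ ^ (H * b) ≤ R ^ (H * b) := Real.rpow_le_rpow hρ.le hρR (by positivity)
  rw [Real.rpow_neg hρ.le, ← div_eq_mul_inv, le_div_iff₀ (by positivity)]
  have : 0 < ρ ^ (H * b) := by positivity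
  nlinarith [mul_le_mul h1 h2 this.le zero_le_one]

/-- In each coordinate, factoring out `y j l` leaves the vector at time `t j` minus a combination of
those at all other times, earlier and later, and nondeterminism applies to that difference. -/
lemma mul_norm_sq_le_gram {d : ℕ} {V : Type*} [NormedAddCommGroup V] [InnerProductSpace ℝ V]
    {v : Fin d → ℝ → V} {κ H : ℝ} (hv : LocND v κ H) {n : ℕ} {t : Fin n → ℝ}
    (ht : ∀ j, 0 < t j) (y : Fin n → EuclideanSpace ℝ (Fin d)) (j : Fin n) {ρ : ℝ} (hρ : 0 < ρ)
    (hρt : ρ ≤ t j) (hd : ∀ i, i ≠ j → ρ ≤ |t j - t i|) :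
    κ * (ρ ^ (2 * H) * ‖y j‖ ^ 2) ≤ gram v t y := by
  rw [EuclideanSpace.real_norm_sq_eq, gram, ← mul_assoc, Finset.mul_sum]
  refine Finset.sum_le_sum fun l _ ↦ ?_
  by_cases h0 : y j l = 0
  · simp [h0]
  have h := hv l n t (fun i ↦ if i = j then 0 else -(y i l / y j l)) (t j) ρ hρ hρt ht
    fun i hi ↦ hd i fun h ↦ hi (by simp [h])
  have e : ∑ i, y i l • v l (t i) = y j l • (v l (t j) -
      ∑ i, (if i = j then 0 else -(y i l / y j l)) • v l (t i)) := by
    rw [← Finset.add_sum_erase _ _ (Finset.mem_univ j), ← Finset.add_sum_erase _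
      (fun i ↦ (if i = j then (0 : ℝ) else -(y i l / y j l)) • v l (t i)) (Finset.mem_univ j)]
    simp only [if_true, zero_smul, zero_add]
    rw [smul_sub, sub_eq_add_neg, ← smul_neg, ← Finset.sum_neg_distrib, Finset.smul_sum]
    congr 1
    refine Finset.sum_congr rfl fun i hi ↦ ?_
    rw [if_neg (Finset.ne_of_mem_erase hi), neg_smul, neg_neg, smul_smul, mul_div_cancel₀ _ h0]
  rw [e, norm_smul, mul_pow, Real.norm_eq_abs, sq_abs]
  nlinarith [sq_nonneg (y j l)]

/-- Averaging the `n` lower bounds of `mul_norm_sq_le_gram` gives each frequency an equal share of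
the exponent, which explains the constant `κ / (4 * n)`. -/
lemma prod_weight_mul_exp_gram_le {d : ℕ} {V : Type*} [NormedAddCommGroup V]
    [InnerProductSpace ℝ V] {v : Fin d → ℝ → V} {κ H b M R : ℝ} (hv : LocND v κ H) {n : ℕ}
    (hn : 0 < n)
    (hM : ∀ ρ x : ℝ, 0 < ρ → ρ ≤ R → 0 ≤ x →
      (1 + x ^ b) * Real.exp (-(κ / (4 * n)) * (ρ ^ (2 * H) * x ^ 2)) ≤ M * ρ ^ (-(H * b)))
    {t ρ : Fin n → ℝ} (hρ : ∀ j, 0 < ρ j) (hρR : ∀ j, ρ j ≤ R) (hρt : ∀ j, ρ j ≤ t j)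
    (hd : ∀ j i, i ≠ j → ρ j ≤ |t j - t i|) (y : Fin n → EuclideanSpace ℝ (Fin d)) :
    (∏ j, (1 + ‖y j‖ ^ b)) * Real.exp (-(1 / 4) * gram v t y) ≤
      ∏ j, M * ρ j ^ (-(H * b)) := by
  have ht j : 0 < t j := (hρ j).trans_le (hρt j)
  have havg : ∑ j, κ / (4 * n) * (ρ j ^ (2 * H) * ‖y j‖ ^ 2) ≤ 1 / 4 * gram v t y := by
    have : ∑ j : Fin n, κ / (4 * n) * (ρ j ^ (2 * H) * ‖y j‖ ^ 2) ≤
        ∑ j : Fin n, 1 / (4 * n) * gram v t y := by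
      refine Finset.sum_le_sum fun j _ ↦ ?_
      have := mul_norm_sq_le_gram hv ht y j (hρ j) (hρt j) (hd j)
      rw [div_eq_mul_one_div, mul_comm κ, mul_assoc]
      gcongr
    refine this.trans_eq ?_
    have : (n : ℝ) ≠ 0 := by positivity
    simp only [Finset.sum_const, Finset.card_univ, Fintype.card_fin, nsmul_eq_mul]
    field_simp
  calc (∏ j, (1 + ‖y j‖ ^ b)) * Real.exp (-(1 / 4) * gram v t y)
      ≤ (∏ j, (1 + ‖y j‖ ^ b)) *
          Real.exp (∑ j, -(κ / (4 * n)) * (ρ j ^ (2 * H) * ‖y j‖ ^ 2)) := by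
        gcongr
        simp only [neg_mul, Finset.sum_neg_distrib]
        linarith
    _ = ∏ j, (1 + ‖y j‖ ^ b) * Real.exp (-(κ / (4 * n)) * (ρ j ^ (2 * H) * ‖y j‖ ^ 2)) := by
        rw [Real.exp_sum, Finset.prod_mul_distrib]
    _ ≤ _ := Finset.prod_le_prod (fun j _ ↦ by positivity)
        fun j _ ↦ hM _ _ (hρ j) (hρR j) (norm_nonneg _)

/-- The weight `1 + ‖y‖ ^ b`. -/
noncomputable def weight {d : ℕ} (b : ℝ) (y : EuclideanSpace ℝ (Fin d)) : ℝ≥0∞ :=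
  ENNReal.ofReal (1 + ‖y‖ ^ b)

lemma measurable_weight {d : ℕ} (b : ℝ) : Measurable (weight (d := d) b) := by
  unfold weight; fun_prop

/-- The exponent is split as $\frac12=\frac14+\frac14$. One quarter absorbs the weights and sees the
distance `ρ j` to all other times; the other is integrated by Gram–Schmidt and sees only the
distance `u j` to the earlier ones. -/
lemma lintegral_weight_exp_gram_le {d : ℕ} {V : Type*} [NormedAddCommGroup V]
    [InnerProductSpace ℝ V] {v : Fin d → ℝ → V} {κ H b M R : ℝ} (hκ : 0 < κ) (hM0 : 0 < M)
    (hv : LocND v κ H) {n : ℕ} (hn : 0 < n)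
    (hM : ∀ ρ x : ℝ, 0 < ρ → ρ ≤ R → 0 ≤ x →
      (1 + x ^ b) * Real.exp (-(κ / (4 * n)) * (ρ ^ (2 * H) * x ^ 2)) ≤ M * ρ ^ (-(H * b)))
    {t ρ u : Fin n → ℝ} (hρ : ∀ j, 0 < ρ j) (hρR : ∀ j, ρ j ≤ R) (hρu : ∀ j, ρ j ≤ u j)
    (hut : ∀ j, u j ≤ t j) (hd : ∀ j i, i ≠ j → ρ j ≤ |t j - t i|)
    (hu : ∀ j i, i < j → u j ≤ |t j - t i|) :
    ∫⁻ y : Fin n → EuclideanSpace ℝ (Fin d),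
        (∏ j, weight b (y j)) * ENNReal.ofReal (Real.exp (-(1 / 2) * gram v t y)) ≤
      ∏ j, ENNReal.ofReal (M * (4 * Real.pi / κ) ^ (d / 2 : ℝ) * ρ j ^ (-(H * b)) *
        u j ^ (-(H * d))) := by
  have hu0 j : 0 < u j := (hρ j).trans_le (hρu j)
  have ht j : 0 < t j := (hu0 j).trans_le (hut j)
  have h1 : ∀ y : Fin n → EuclideanSpace ℝ (Fin d),
      (∏ j, weight b (y j)) * ENNReal.ofReal (Real.exp (-(1 / 2) * gram v t y)) ≤
      (∏ j, ENNReal.ofReal (M * ρ j ^ (-(H * b)))) *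
        ENNReal.ofReal (Real.exp (-(1 / 4) * ∑ l, ‖∑ j, y j l • v l (t j)‖ ^ 2)) := by
    intro y
    rw [← ENNReal.ofReal_prod_of_nonneg fun j _ ↦ by have := hρ j; positivity,
      ← ENNReal.ofReal_mul' (Real.exp_pos _).le]
    simp only [weight]
    rw [← ENNReal.ofReal_prod_of_nonneg fun j _ ↦ by positivity,
      ← ENNReal.ofReal_mul' (Real.exp_pos _).le]
    refine ENNReal.ofReal_le_ofReal ?_
    have := prod_weight_mul_exp_gram_le hv hn hM hρ hρR (fun j ↦ (hρu j).trans (hut j)) hd y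
    rw [show -(1 / 2) * gram v t y = -(1 / 4) * gram v t y + -(1 / 4) * gram v t y by ring,
      Real.exp_add, ← mul_assoc]
    exact mul_le_mul_of_nonneg_right this (Real.exp_pos _).le
  refine (lintegral_mono h1).trans ?_
  rw [lintegral_const_mul _ (measurable_exp_gram fun j l ↦ v l (t j))]
  have h2 := lintegral_exp_gram_le n (fun j l ↦ v l (t j)) (fun j ↦ κ * u j ^ (2 * H))
    (fun j ↦ by have := hu0 j; positivity) (fun j l c hc ↦ hv l n t c (t j) (u j) (hu0 j) (hut j)
      ht fun i hi ↦ hu j i (not_le.1 fun h ↦ hi (hc i h)))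
  refine (mul_le_mul_right h2 _).trans_eq ?_
  rw [← Finset.prod_mul_distrib]
  refine Finset.prod_congr rfl fun j _ ↦ ?_
  have hj := hu0 j
  have hj' := hρ j
  rw [← ENNReal.ofReal_mul (by positivity), Fintype.card_fin]
  congr 1
  have : Real.pi / (1 / 4 * (κ * u j ^ (2 * H))) = 4 * Real.pi / κ * u j ^ (-(2 * H)) := by
    rw [Real.rpow_neg hj.le]; field_simp
  rw [this, Real.mul_rpow (by positivity) (by positivity), ← Real.rpow_mul hj.le]
  rw [show -(2 * H) * (d / 2 : ℝ) = -(H * d) by ring]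
  ring

end FracLocalTime

/-! ### Ordered times: the gap kernel and symmetrization. -/

namespace FracLocalTime

/-- The one-step kernel bounding the contribution of a gap `u` between consecutive times. -/
noncomputable def gapKernel (A h γ : ℝ) : ℝ → ℝ≥0∞ :=
  (Icc 0 h).indicator fun u ↦ ENNReal.ofReal A * ENNReal.ofReal u ^ (-γ)

lemma measurable_gapKernel (A h γ : ℝ) : Measurable (gapKernel A h γ) :=
  Measurable.indicator (by fun_prop) measurableSet_Icc

lemma lintegral_gapKernel {A h γ : ℝ} (hA : 0 ≤ A) (hh : 0 ≤ h) (hγ : γ < 1) :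
    ∫⁻ u, gapKernel A h γ u = ENNReal.ofReal (A * (h ^ (1 - γ) / (1 - γ))) := by
  unfold gapKernel
  rw [lintegral_indicator measurableSet_Icc, lintegral_const_mul _ (by fun_prop),
    ENNReal.ofReal_mul hA, restrict_Ioc_eq_restrict_Icc.symm]
  congr 1
  have h1 : ∫⁻ u in Ioc 0 h, ENNReal.ofReal u ^ (-γ) =
      ∫⁻ u in Ioc 0 h, ENNReal.ofReal (u ^ (-γ)) := by
    refine setLIntegral_congr_fun measurableSet_Ioc fun u hu ↦ ?_
    exact ENNReal.ofReal_rpow_of_pos hu.1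
  have h2 : IntervalIntegrable (fun x : ℝ ↦ x ^ (-γ)) volume 0 h :=
    intervalIntegral.intervalIntegrable_rpow' (by linarith)
  rw [h1, ← ofReal_integral_eq_lintegral_ofReal]
  · rw [← intervalIntegral.integral_of_le hh, integral_rpow (Or.inl (by linarith)),
      show -γ + 1 = 1 - γ by ring, Real.zero_rpow (by linarith), sub_zero]
  · rwa [intervalIntegrable_iff_integrableOn_Ioc_of_le hh] at h2
  · exact (ae_restrict_mem measurableSet_Ioc).mono fun u hu ↦ Real.rpow_nonneg hu.1.le _

/-- The minimum of the two gaps around `t j` is bounded below by their product divided by `h`. The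
bound thus factorizes over gaps, each inner gap being counted twice, which produces the exponent
$2b$. -/
lemma lintegral_weight_exp_gram_le_of_strictMono {d : ℕ} {V : Type*} [NormedAddCommGroup V]
    [InnerProductSpace ℝ V] {v : Fin d → ℝ → V} {κ H b M R : ℝ} (hκ : 0 < κ) (hM0 : 0 < M)
    (hH : 0 < H) (hb : 0 < b) (hv : LocND v κ H) {m : ℕ}
    (hM : ∀ ρ x : ℝ, 0 < ρ → ρ ≤ R → 0 ≤ x →
      (1 + x ^ b) * Real.exp (-(κ / (4 * (m + 1 : ℕ))) * (ρ ^ (2 * H) * x ^ 2)) ≤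
        M * ρ ^ (-(H * b)))
    {a h : ℝ} (ha : 0 ≤ a) (hh : 0 < h) (hhR : h ≤ R) {t : Fin (m + 1) → ℝ}
    (hmono : StrictMono (Fin.cons a t : Fin (m + 2) → ℝ)) (hth : ∀ j, t j ≤ a + h) :
    ∫⁻ y : Fin (m + 1) → EuclideanSpace ℝ (Fin d),
        (∏ j, weight b (y j)) * ENNReal.ofReal (Real.exp (-(1 / 2) * gram v t y)) ≤
      ∏ j : Fin (m + 1), ENNReal.ofReal (M * (4 * Real.pi / κ) ^ (d / 2 : ℝ) * h ^ (H * b) *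
        (t j - (Fin.cons a t : Fin (m + 2) → ℝ) j.castSucc) ^ (-(H * (2 * b + d)))) := by
  set τ : Fin (m + 2) → ℝ := Fin.cons a t with hτ
  have htτ j : t j = τ j.succ := by simp [hτ]
  have hτ0 : τ 0 = a := by simp [hτ]
  have hτa j : a ≤ τ j := hτ0 ▸ hmono.monotone (Fin.zero_le j)
  set u : Fin (m + 1) → ℝ := fun j ↦ t j - τ j.castSucc with hu
  have hu0 j : 0 < u j := by
    simp only [hu, htτ, sub_pos]; exact hmono j.castSucc_lt_succ
  have huh j : u j ≤ h := by
    have := hth j; have := hτa j.castSucc; simp only [hu]; linarith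
  -- The gap following `t j`; the last time has none, and `h` stands in for it.
  set w : Fin (m + 1) → ℝ := Fin.snoc (fun k : Fin m ↦ u k.succ) h with hw
  have hw0 j : 0 < w j := by
    induction j using Fin.lastCases with
    | last => simpa [hw]
    | cast k => simpa [hw] using hu0 k.succ
  have hwh j : w j ≤ h := by
    induction j using Fin.lastCases with
    | last => simp [hw]
    | cast k => simpa [hw] using huh k.succ
  have hlow j i (hij : i < j) : u j ≤ t j - t i := by
    have : τ i.succ ≤ τ j.castSucc := hmono.monotone (by
      rw [Fin.le_def]; simpa using hij)
    simp only [hu]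
    rw [htτ i]; linarith
  have hup j i (hij : j < i) : w j ≤ t i - t j := by
    induction j using Fin.lastCases with
    | last => exact absurd hij (not_lt.2 (Fin.le_last i))
    | cast k =>
      have h1 : τ k.succ.succ ≤ τ i.succ := hmono.monotone (by
        rw [Fin.le_def]; simpa [Fin.lt_def] using hij)
      have h2 : τ k.castSucc.succ = τ k.succ.castSucc := by rw [Fin.succ_castSucc]
      simp only [hw, Fin.snoc_castSucc, hu]
      rw [htτ i, htτ k.castSucc, htτ k.succ, h2]; linarith
  set ρ : Fin (m + 1) → ℝ := fun j ↦ u j * w j / h with hρ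
  have hρ0 j : 0 < ρ j := by have := hu0 j; have := hw0 j; simp only [hρ]; positivity
  have hρu j : ρ j ≤ u j := by
    simp only [hρ]; rw [div_le_iff₀ hh]; exact mul_le_mul_of_nonneg_left (hwh j) (hu0 j).le
  have hρw j : ρ j ≤ w j := by
    simp only [hρ]; rw [div_le_iff₀ hh, mul_comm]
    exact mul_le_mul_of_nonneg_left (huh j) (hw0 j).le
  refine (lintegral_weight_exp_gram_le hκ hM0 hv m.succ_pos hM hρ0
    (fun j ↦ (hρu j).trans ((huh j).trans hhR)) hρu ?_ ?_ ?_).trans ?_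
  · intro j
    have := hτa j.castSucc
    simp only [hu]; linarith
  · intro j i hij
    rcases lt_or_gt_of_ne hij with h' | h'
    · exact (hρu j).trans ((hlow j i h').trans (le_abs_self _))
    · rw [abs_sub_comm]
      exact (hρw j).trans ((hup j i h').trans (le_abs_self _))
  · intro j i hij
    exact (hlow j i hij).trans (le_abs_self _)
  · rw [← ENNReal.ofReal_prod_of_nonneg fun j _ ↦ by
        have := hu0 j; have := hρ0 j; positivity,
      ← ENNReal.ofReal_prod_of_nonneg fun j _ ↦ by
        have := hu0 j; change 0 ≤ _ * _ * _ * u j ^ _; positivity]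
    refine ENNReal.ofReal_le_ofReal ?_
    -- `w` is `u` shifted by one place, with `h` in place of the first gap, and that gap is at most
    -- `h`.
    have hw_prod : ∏ j, w j ^ (-(H * b)) ≤ ∏ j, u j ^ (-(H * b)) := by
      rw [Fin.prod_univ_castSucc, Fin.prod_univ_succ (fun j ↦ u j ^ (-(H * b))), mul_comm]
      simp only [hw, Fin.snoc_castSucc, Fin.snoc_last]
      refine mul_le_mul_of_nonneg_right ?_ (Finset.prod_nonneg fun j _ ↦ by
        have := hu0 j.succ; positivity)
      exact Real.rpow_le_rpow_of_nonpos (hu0 0) (huh 0) (by simp; positivity)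
    calc ∏ j, M * (4 * Real.pi / κ) ^ (d / 2 : ℝ) * ρ j ^ (-(H * b)) * u j ^ (-(H * d))
        = (∏ j, M * (4 * Real.pi / κ) ^ (d / 2 : ℝ) * h ^ (H * b) *
            (u j ^ (-(H * b)) * u j ^ (-(H * d)))) * ∏ j, w j ^ (-(H * b)) := by
          rw [← Finset.prod_mul_distrib]
          refine Finset.prod_congr rfl fun j _ ↦ ?_
          have h1 := hu0 j
          have h2 := hw0 j
          simp only [hρ]
          rw [Real.div_rpow (by positivity) hh.le, Real.mul_rpow h1.le h2.le,
            Real.rpow_neg hh.le, div_inv_eq_mul]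
          ring
      _ ≤ (∏ j, M * (4 * Real.pi / κ) ^ (d / 2 : ℝ) * h ^ (H * b) *
            (u j ^ (-(H * b)) * u j ^ (-(H * d)))) * ∏ j, u j ^ (-(H * b)) := by
          refine mul_le_mul_of_nonneg_left hw_prod (Finset.prod_nonneg fun j _ ↦ ?_)
          have := hu0 j
          positivity
      _ = _ := by
          rw [← Finset.prod_mul_distrib]
          refine Finset.prod_congr rfl fun j _ ↦ ?_
          have h1 := hu0 j
          rw [show -(H * (2 * b + d)) = -(H * b) + -(H * d) + -(H * b) by ring,
            Real.rpow_add h1, Real.rpow_add h1]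
          ring

lemma lintegral_weight_exp_gram_le_prod_gapKernel {d : ℕ} {V : Type*} [NormedAddCommGroup V]
    [InnerProductSpace ℝ V] {v : Fin d → ℝ → V} {κ H b M R : ℝ} (hκ : 0 < κ) (hM0 : 0 < M)
    (hH : 0 < H) (hb : 0 < b) (hv : LocND v κ H) {m : ℕ}
    (hM : ∀ ρ x : ℝ, 0 < ρ → ρ ≤ R → 0 ≤ x →
      (1 + x ^ b) * Real.exp (-(κ / (4 * (m + 1 : ℕ))) * (ρ ^ (2 * H) * x ^ 2)) ≤
        M * ρ ^ (-(H * b)))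
    {a h : ℝ} (ha : 0 ≤ a) (hh : 0 < h) (hhR : h ≤ R) {t : Fin (m + 1) → ℝ}
    (hmono : Monotone t) (hta : ∀ j, a ≤ t j) (hth : ∀ j, t j ≤ a + h) :
    ∫⁻ y : Fin (m + 1) → EuclideanSpace ℝ (Fin d),
        (∏ j, weight b (y j)) * ENNReal.ofReal (Real.exp (-(1 / 2) * gram v t y)) ≤
      ∏ j : Fin (m + 1), gapKernel (M * (4 * Real.pi / κ) ^ (d / 2 : ℝ) * h ^ (H * b)) h
        (H * (2 * b + d)) (t j - (Fin.cons a t : Fin (m + 2) → ℝ) j.castSucc) := by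
  set u : Fin (m + 1) → ℝ := fun j ↦ t j - (Fin.cons a t : Fin (m + 2) → ℝ) j.castSucc with hu
  have hτa : ∀ j : Fin (m + 2), a ≤ (Fin.cons a t : Fin (m + 2) → ℝ) j := fun j ↦ by
    induction j using Fin.cases with
    | zero => simp
    | succ j => simpa using hta j
  have hu0 j : 0 ≤ u j := by
    induction j using Fin.cases with
    | zero => simpa [hu] using hta 0
    | succ j =>
      simp only [hu, sub_nonneg, ← Fin.succ_castSucc, Fin.cons_succ]
      exact hmono j.castSucc_lt_succ.le
  have huh j : u j ≤ h := by
    have := hth j; have := hτa j.castSucc; simp only [hu]; linarith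
  have hγ : 0 < H * (2 * b + d) := by positivity
  have hA : 0 < M * (4 * Real.pi / κ) ^ (d / 2 : ℝ) * h ^ (H * b) := by positivity
  have hval j : gapKernel (M * (4 * Real.pi / κ) ^ (d / 2 : ℝ) * h ^ (H * b)) h
        (H * (2 * b + d)) (u j) = ENNReal.ofReal (M * (4 * Real.pi / κ) ^ (d / 2 : ℝ) *
          h ^ (H * b)) * ENNReal.ofReal (u j) ^ (-(H * (2 * b + d))) :=
    indicator_of_mem (show u j ∈ Icc 0 h from ⟨hu0 j, huh j⟩) _
  -- At coinciding times one factor of the bound is infinite and the others are nonzero, so there is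
  -- nothing to prove and no null set has to be discarded.
  by_cases hz : ∃ j, u j = 0
  · obtain ⟨j, hj⟩ := hz
    change _ ≤ ∏ j, gapKernel _ _ _ (u j)
    rw [← Finset.mul_prod_erase _ _ (Finset.mem_univ j)]
    have h1 : gapKernel (M * (4 * Real.pi / κ) ^ (d / 2 : ℝ) * h ^ (H * b)) h
        (H * (2 * b + d)) (u j) = ∞ := by
      rw [hval, hj, ENNReal.ofReal_zero, ENNReal.zero_rpow_of_neg (by linarith)]
      exact ENNReal.mul_top (by simpa using hA)
    rw [h1, ENNReal.top_mul]
    · exact le_top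
    · refine Finset.prod_ne_zero_iff.2 fun i _ ↦ ?_
      rw [hval]
      refine mul_ne_zero (by simpa using hA) ?_
      rw [Ne, ENNReal.rpow_eq_zero_iff]
      simp [hγ.le]
  · push Not at hz
    have hupos j : 0 < u j := lt_of_le_of_ne (hu0 j) (hz j).symm
    refine (lintegral_weight_exp_gram_le_of_strictMono hκ hM0 hH hb hv hM ha hh hhR ?_
      hth).trans_eq ?_
    · rw [Fin.strictMono_iff_lt_succ]
      intro j
      have := hupos j
      simp only [hu] at this
      simpa using this
    · refine Finset.prod_congr rfl fun j _ ↦ ?_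
      change ENNReal.ofReal (_ * u j ^ _) = gapKernel _ _ _ (u j)
      rw [hval, ENNReal.ofReal_mul hA.le, ENNReal.ofReal_rpow_of_pos (hupos j)]

/-- Sorting shows that the images of the ordered chamber under permutations cover the space, and all
contribute the same integral; overlaps on ties do no harm to an upper bound. -/
lemma lintegral_pi_le_factorial_mul {Z : Type*} [MeasurableSpace Z] (μ : Measure Z) [SigmaFinite μ]
    {n : ℕ} (f : Z → ℝ) (W : (Fin n → Z) → ℝ≥0∞)
    (hW : ∀ (σ : Equiv.Perm (Fin n)) z, W (z ∘ σ) = W z) :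
    ∫⁻ z, W z ∂Measure.pi (fun _ ↦ μ) ≤
      n.factorial * ∫⁻ z in {z | Monotone fun j ↦ f (z j)}, W z ∂Measure.pi (fun _ ↦ μ) := by
  set S : Set (Fin n → Z) := {z | Monotone fun j ↦ f (z j)}
  have hcov : (univ : Set (Fin n → Z)) = ⋃ σ : Equiv.Perm (Fin n), (fun z ↦ z ∘ σ) ⁻¹' S := by
    refine (eq_univ_of_forall fun z ↦ mem_iUnion.2 ?_).symm
    exact ⟨Tuple.sort fun j ↦ f (z j), Tuple.monotone_sort fun j ↦ f (z j)⟩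
  rw [← setLIntegral_univ, hcov]
  refine (lintegral_iUnion_le _ _).trans ?_
  rw [tsum_fintype]
  have hterm : ∀ σ : Equiv.Perm (Fin n),
      ∫⁻ z in (fun z ↦ z ∘ σ) ⁻¹' S, W z ∂Measure.pi (fun _ ↦ μ) =
        ∫⁻ z in S, W z ∂Measure.pi (fun _ ↦ μ) := by
    intro σ
    have hmp := measurePreserving_piCongrLeft (fun _ : Fin n ↦ μ) σ.symm
    have he : ⇑(MeasurableEquiv.piCongrLeft (fun _ : Fin n ↦ Z) σ.symm) = fun z ↦ z ∘ σ := by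
      ext z j
      have := MeasurableEquiv.piCongrLeft_apply_apply σ.symm (β := fun _ : Fin n ↦ Z) z (σ j)
      simpa using this
    refine Eq.trans ?_
      (hmp.setLIntegral_comp_preimage_emb (MeasurableEquiv.measurableEmbedding _) W S)
    simp only [he, hW]
  rw [Finset.sum_congr rfl fun σ _ ↦ hterm σ]
  simp [Fintype.card_perm]

end FracLocalTime

/-! ### The weighted moment integral over a time window. -/

namespace FracLocalTime

/-- Lebesgue measure on `(a, a + h] × ℝ^d`. -/
noncomputable def stripMeasure (d : ℕ) (a h : ℝ) : Measure (ℝ × EuclideanSpace ℝ (Fin d)) :=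
  (volume.restrict (Ioc a (a + h))).prod volume

instance (d : ℕ) (a h : ℝ) : SigmaFinite (stripMeasure d a h) := by
  unfold stripMeasure; infer_instance

lemma stripMeasure_zero (d : ℕ) (a : ℝ) : stripMeasure d a 0 = 0 := by
  simp [stripMeasure]

lemma gram_comp_perm {d : ℕ} {V : Type*} [NormedAddCommGroup V] [InnerProductSpace ℝ V]
    (v : Fin d → ℝ → V) {n : ℕ} (t : Fin n → ℝ) (y : Fin n → EuclideanSpace ℝ (Fin d))
    (σ : Equiv.Perm (Fin n)) : gram v (t ∘ σ) (y ∘ σ) = gram v t y := by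
  unfold gram
  refine Finset.sum_congr rfl fun l _ ↦ ?_
  rw [← Equiv.sum_comp σ fun j ↦ y j l • v l (t j)]
  rfl

/-- After symmetrization the time integral is a chain of gap kernels. Each contributes $h^{Hb}$ from
the choice of `ρ` and $h^{1-H(2b+d)}$ from its singularity. The constant depends neither on the
position nor on the length of the window. -/
theorem exists_lintegral_weight_exp_gram_le {d : ℕ} {V : Type*} [NormedAddCommGroup V]
    [InnerProductSpace ℝ V] {v : Fin d → ℝ → V} {κ H b R : ℝ} (hκ : 0 < κ) (hH : 0 < H)
    (hb : 0 < b) (hR : 0 < R) (hγ : H * (2 * b + d) < 1) (hv : LocND v κ H) (m : ℕ)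
    (hmeas : Measurable fun p : (Fin (m + 1) → ℝ) × (Fin (m + 1) → EuclideanSpace ℝ (Fin d)) ↦
      gram v p.1 p.2) :
    ∃ C : ℝ, 0 < C ∧ ∀ a h : ℝ, 0 ≤ a → 0 ≤ h → h ≤ R →
      ∫⁻ z, (∏ j, weight b (z j).2) *
          ENNReal.ofReal (Real.exp (-(1 / 2) * gram v (fun j ↦ (z j).1) fun j ↦ (z j).2))
        ∂Measure.pi (fun _ : Fin (m + 1) ↦ stripMeasure d a h) ≤
      ENNReal.ofReal (C * h ^ (1 - H * (b + d))) ^ (m + 1) := by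
  obtain ⟨M, hM0, hM⟩ := exists_one_add_rpow_mul_exp_le (c := κ / (4 * (m + 1 : ℕ))) (b := b)
    (H := H) (R := R) (by positivity) hb.le hH.le hR
  set A₀ := M * (4 * Real.pi / κ) ^ (d / 2 : ℝ) with hA₀
  have hA₀0 : 0 < A₀ := by positivity
  set γ := H * (2 * b + d) with hγdef
  have h1γ : 0 < 1 - γ := by linarith
  refine ⟨(m + 1).factorial * (A₀ / (1 - γ)), by positivity, fun a h ha hh hhR ↦ ?_⟩
  rcases hh.eq_or_lt with rfl | hh
  · have : Measure.pi (fun _ : Fin (m + 1) ↦ stripMeasure d a 0) = 0 := by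
      rw [← Measure.measure_univ_eq_zero, Measure.pi_univ]
      simp [stripMeasure_zero]
    rw [this]; simp
  set W : (Fin (m + 1) → ℝ) × (Fin (m + 1) → EuclideanSpace ℝ (Fin d)) → ℝ≥0∞ := fun p ↦
    (∏ j, weight b (p.2 j)) * ENNReal.ofReal (Real.exp (-(1 / 2) * gram v p.1 p.2)) with hW
  have hWm : Measurable W := by
    refine Measurable.mul ?_ ?_
    · exact Finset.measurable_fun_prod _ fun j _ ↦ (measurable_weight b).comp (by fun_prop)
    · exact ((hmeas.const_mul _).exp).ennreal_ofReal
  set S : Set (Fin (m + 1) → ℝ) := {t | Monotone t}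
  have hS : MeasurableSet S := isClosed_monotone.measurableSet
  set e := MeasurableEquiv.arrowProdEquivProdArrow ℝ (EuclideanSpace ℝ (Fin d)) (Fin (m + 1))
  have hmp := measurePreserving_arrowProdEquivProdArrow ℝ (EuclideanSpace ℝ (Fin d))
    (Fin (m + 1)) (fun _ ↦ volume.restrict (Ioc a (a + h))) (fun _ ↦ volume)
  have hsym := lintegral_pi_le_factorial_mul (stripMeasure d a h) (n := m + 1) Prod.fst
    (fun z ↦ W (e z)) (fun σ z ↦ by
      change (∏ j, weight b (z (σ j)).2) * ENNReal.ofReal (Real.exp (-(1 / 2) *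
        gram v ((fun j ↦ (z j).1) ∘ σ) ((fun j ↦ (z j).2) ∘ σ))) = _
      rw [gram_comp_perm, Equiv.prod_comp σ fun j ↦ weight b (z j).2]
      rfl)
  refine hsym.trans ?_
  have hset : ∫⁻ z in {z | Monotone fun j ↦ (z j).1}, W (e z)
      ∂Measure.pi (fun _ : Fin (m + 1) ↦ stripMeasure d a h) =
      ∫⁻ p in S ×ˢ univ, W p
        ∂(Measure.pi fun _ : Fin (m + 1) ↦ volume.restrict (Ioc a (a + h))).prod
          (Measure.pi fun _ ↦ volume) := by
    have := hmp.setLIntegral_comp_preimage_emb (MeasurableEquiv.measurableEmbedding _) W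
      (S ×ˢ univ)
    refine Eq.trans ?_ this
    congr 2
    ext z
    simp [S, MeasurableEquiv.arrowProdEquivProdArrow, Equiv.arrowProdEquivProdArrow]
  have hinner : ∫⁻ p in S ×ˢ univ, W p
        ∂(Measure.pi fun _ : Fin (m + 1) ↦ volume.restrict (Ioc a (a + h))).prod
          (Measure.pi fun _ ↦ volume) ≤ ENNReal.ofReal (A₀ / (1 - γ) * h ^ (1 - H * (b + d)))
            ^ (m + 1) := by
    rw [← Measure.prod_restrict, Measure.restrict_univ, lintegral_prod _ hWm.aemeasurable,
      ← Measure.restrict_pi_pi, Measure.restrict_restrict hS]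
    calc _ ≤ ∫⁻ t in S ∩ univ.pi (fun _ ↦ Ioc a (a + h)), ∏ j : Fin (m + 1),
          gapKernel (A₀ * h ^ (H * b)) h γ (t j - (Fin.cons a t : Fin (m + 2) → ℝ) j.castSucc)
            ∂Measure.pi fun _ ↦ volume := by
          refine setLIntegral_mono_ae' (hS.inter (MeasurableSet.univ_pi fun _ ↦
            measurableSet_Ioc)) (ae_of_all _ fun t ht ↦ ?_)
          exact lintegral_weight_exp_gram_le_prod_gapKernel hκ hM0 hH hb hv hM ha hh hhR ht.1
            (fun j ↦ (ht.2 j (mem_univ _)).1.le) (fun j ↦ (ht.2 j (mem_univ _)).2)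
      _ ≤ ∫⁻ t : Fin (m + 1) → ℝ, ∏ j : Fin (m + 1),
          gapKernel (A₀ * h ^ (H * b)) h γ
            (t j - (Fin.cons a t : Fin (m + 2) → ℝ) j.castSucc) := setLIntegral_le_lintegral _ _
      _ = _ := by
          rw [lintegral_chain_eq _ (measurable_gapKernel _ _ _),
            lintegral_gapKernel (by positivity) hh.le hγ]
          congr 2
          rw [show 1 - H * (b + d) = H * b + (1 - γ) by rw [hγdef]; ring, Real.rpow_add hh]
          ring
  rw [hset]
  refine (mul_le_mul_right hinner _).trans ?_
  rw [mul_assoc _ _ (h ^ _), ENNReal.ofReal_mul (p := ((m + 1).factorial : ℝ)) (by positivity),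
    mul_pow, ENNReal.ofReal_natCast]
  gcongr
  -- The factorial from symmetrization is enlarged to its own `m + 1`-st power so that it fits
  -- inside the power.
  exact_mod_cast Nat.le_self_pow (by omega) _

end FracLocalTime

/-! ### From the Gaussian process to curves in $L^2$. -/

namespace FracLocalTime

/-- Subtracting an `m`-measurable variable leaves the conditional variance unchanged, and a
conditional variance is at most the conditional second moment. -/
lemma integral_condVar_le {Ω : Type*} {m m₀ : MeasurableSpace Ω} {P : Measure[m₀] Ω}
    [IsProbabilityMeasure P] (hm : m ≤ m₀) {Y Z : Ω → ℝ} (hY : MemLp Y 2 P) (hZ : MemLp Z 2 P)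
    (hZm : StronglyMeasurable[m] Z) :
    ∫ ω, condVar m Y P ω ∂P ≤ ∫ ω, (Y ω - Z ω) ^ 2 ∂P := by
  have h1 : condVar m (Y - Z) P =ᵐ[P] condVar m Y P := by
    refine condExp_congr_ae ?_
    have h := condExp_sub (hY.integrable one_le_two) (hZ.integrable one_le_two) m
    rw [condExp_of_stronglyMeasurable hm hZm (hZ.integrable one_le_two)] at h
    filter_upwards [h] with ω hω
    simp [hω]
  have h2 := condVar_ae_le_condExp_sq hm (hY.sub hZ)
  rw [← integral_congr_ae h1]
  refine (integral_mono_ae integrable_condVar integrable_condExp h2).trans_eq ?_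
  rw [integral_condExp hm]
  rfl

/-- Turns the conditional variance bound into a lower bound for $L^2$ distances to linear
combinations, the only form used later. -/
lemma SLND.exists_le_integral_sq {Ω : Type*} [MeasurableSpace Ω] {P : Measure Ω}
    [IsProbabilityMeasure P] {H : ℝ} (hH : 0 < H) {Y : ℝ≥0 → Ω → ℝ} (hY : SLND P H Y)
    (hm : ∀ t, Measurable (Y t)) (h2 : ∀ t, MemLp (Y t) 2 P) :
    ∃ κ : ℝ, 0 < κ ∧ ∀ (n : ℕ) (s c : Fin n → ℝ) (t ρ : ℝ), 0 < ρ → ρ ≤ t → (∀ i, 0 < s i) →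
      (∀ i, c i ≠ 0 → ρ ≤ |t - s i|) →
      κ * ρ ^ (2 * H) ≤ ∫ ω, (Y t.toNNReal ω - ∑ i, c i * Y (s i).toNNReal ω) ^ 2 ∂P := by
  obtain ⟨κ, hκ, h⟩ := hY
  refine ⟨κ, hκ, fun n s c t ρ hρ hρt hs hd ↦ ?_⟩
  have ht : 0 < t := hρ.trans_le hρt
  -- The dummy time `2 * t` is at distance `t ≥ ρ` from `t`. It makes the list of times nonempty
  -- when `n = 0` and replaces the times with zero coefficient, which may lie arbitrarily close to
  -- `t`.
  let s' : Fin (n + 1) → ℝ≥0 := Fin.cons (2 * t).toNNReal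
    (fun i ↦ if c i = 0 then (2 * t).toNNReal else (s i).toNNReal)
  have hs' : ∀ i, 0 < s' i := by
    intro i
    refine Fin.cases ?_ (fun i ↦ ?_) i
    · simpa [s'] using ht
    · simp only [s', Fin.cons_succ]
      split_ifs
      · simpa using ht
      · simpa using hs i
  have hs'd : ∀ i, ρ ≤ |t - (s' i : ℝ)| := by
    have h2t : ρ ≤ |t - ((2 * t).toNNReal : ℝ)| := by
      rw [Real.coe_toNNReal _ (by linarith), abs_sub_comm, show 2 * t - t = t by ring,
        abs_of_pos ht]
      exact hρt
    intro i
    refine Fin.cases ?_ (fun i ↦ ?_) i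
    · exact h2t
    · simp only [s', Fin.cons_succ]
      split_ifs with hc
      · exact h2t
      · rw [Real.coe_toNNReal _ (hs i).le]; exact hd i hc
  have hae := h (n + 1) (by omega) s' t.toNNReal hs' (by simpa using ht)
  have hle := Measurable.comap_le (measurable_pi_lambda (fun ω i ↦ Y (s' i) ω) fun i ↦ hm (s' i))
  set m : MeasurableSpace Ω := MeasurableSpace.comap (fun ω i ↦ Y (s' i) ω) MeasurableSpace.pi
  have hmY : ∀ i, Measurable[m] (Y (s' i)) := fun i ↦
    (measurable_pi_apply (X := fun _ ↦ ℝ) i).comp (comap_measurable fun ω i ↦ Y (s' i) ω)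
  have hZeq : ∀ ω, ∑ i, c i * Y (s i).toNNReal ω = ∑ i : Fin n, c i * Y (s' i.succ) ω := by
    intro ω
    refine Finset.sum_congr rfl fun i _ ↦ ?_
    by_cases hc : c i = 0
    · simp [hc]
    · simp [s', hc]
  simp_rw [hZeq]
  have hZm : Measurable[m] fun ω ↦ ∑ i : Fin n, c i * Y (s' i.succ) ω :=
    Finset.measurable_fun_sum _ fun i _ ↦ (hmY i.succ).const_mul _
  have hZ2 : MemLp (fun ω ↦ ∑ i : Fin n, c i * Y (s' i.succ) ω) 2 P :=
    memLp_finsetSum _ fun i _ ↦ (h2 _).const_mul _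
  refine le_trans ?_ (integral_condVar_le hle (h2 t.toNNReal) hZ2 hZm.stronglyMeasurable)
  have hlow : ∀ᵐ ω ∂P, κ * ρ ^ (2 * H) ≤ condVar m (Y t.toNNReal) P ω := by
    filter_upwards [hae] with ω hω
    refine le_trans ?_ hω
    gcongr
    rw [Real.coe_toNNReal _ ht.le]
    refine le_min (le_ciInf fun i ↦ ?_) ?_
    · exact Real.rpow_le_rpow hρ.le (hs'd i) (by positivity)
    · exact Real.rpow_le_rpow hρ.le hρt (by positivity)
  calc κ * ρ ^ (2 * H) = ∫ _, κ * ρ ^ (2 * H) ∂P := by simp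
    _ ≤ _ := integral_mono_ae (integrable_const _) integrable_condVar hlow

lemma coeFn_sum_smul {Ω : Type*} [MeasurableSpace Ω] {P : Measure Ω} {ι : Type*} (s : Finset ι)
    (c : ι → ℝ) (f : ι → Lp ℝ 2 P) :
    ⇑(∑ i ∈ s, c i • f i) =ᵐ[P] fun ω ↦ ∑ i ∈ s, c i * f i ω := by
  classical
  induction s using Finset.induction_on with
  | empty =>
    simp only [Finset.sum_empty]
    exact Lp.coeFn_zero _ _ _
  | insert i s hi ih =>
    simp only [Finset.sum_insert hi]
    filter_upwards [Lp.coeFn_add (c i • f i) (∑ i ∈ s, c i • f i), Lp.coeFn_smul (c i) (f i), ih]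
      with ω h1 h2 h3
    rw [h1, Pi.add_apply, h2, h3]
    rfl

lemma norm_sq_eq_integral_of_ae_eq {Ω : Type*} [MeasurableSpace Ω] {P : Measure Ω}
    {w : Lp ℝ 2 P} {g : Ω → ℝ} (h : w =ᵐ[P] g) : ‖w‖ ^ 2 = ∫ ω, g ω ^ 2 ∂P := by
  rw [← real_inner_self_eq_norm_sq, L2.inner_def]
  refine integral_congr_ae ?_
  filter_upwards [h] with ω hω
  simp [hω, sq]

namespace IsSLNDGaussian

variable {Ω : Type*} [MeasurableSpace Ω] {P : Measure Ω} {H : ℝ} {d : ℕ}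
  {X : ℝ≥0 → Ω → EuclideanSpace ℝ (Fin d)}

lemma memLp_two (hX : IsSLNDGaussian P H X) (l : Fin d) (t : ℝ≥0) :
    MemLp (fun ω ↦ X t ω l) 2 P :=
  ((hX.gaussian l).hasGaussianLaw_eval t).memLp_two

lemma measurable_eval (hX : IsSLNDGaussian P H X) (t : ℝ≥0) : Measurable (X t) :=
  hX.measurable.comp measurable_prodMk_left

lemma measurable_coord (hX : IsSLNDGaussian P H X) (l : Fin d) (t : ℝ≥0) :
    Measurable fun ω ↦ X t ω l :=
  (EuclideanSpace.proj (𝕜 := ℝ) l).continuous.measurable.comp (hX.measurable_eval t)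

/-- The components of the process as curves in `L²`. -/
noncomputable def curve (hX : IsSLNDGaussian P H X) (l : Fin d) (t : ℝ) : Lp ℝ 2 P :=
  (hX.memLp_two l t.toNNReal).toLp _

lemma coeFn_sum_curve (hX : IsSLNDGaussian P H X) (l : Fin d) {n : ℕ} (c t : Fin n → ℝ) :
    ⇑(∑ j, c j • hX.curve l (t j)) =ᵐ[P] fun ω ↦ ∑ j, c j * X (t j).toNNReal ω l := by
  have h : ∀ᵐ ω ∂P, ∀ j, hX.curve l (t j) ω = X (t j).toNNReal ω l :=
    ae_all_iff.2 fun j ↦ (hX.memLp_two l (t j).toNNReal).coeFn_toLp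
  filter_upwards [coeFn_sum_smul Finset.univ c fun j ↦ hX.curve l (t j), h] with ω h1 h2
  rw [h1]
  simp only [h2]

lemma gram_curve (hX : IsSLNDGaussian P H X) {n : ℕ} (t : Fin n → ℝ)
    (y : Fin n → EuclideanSpace ℝ (Fin d)) :
    gram hX.curve t y = ∑ l, ∫ ω, (∑ j, y j l * X (t j).toNNReal ω l) ^ 2 ∂P :=
  Finset.sum_congr rfl fun l _ ↦ norm_sq_eq_integral_of_ae_eq (hX.coeFn_sum_curve l _ t)

lemma exists_locND [IsProbabilityMeasure P] (hX : IsSLNDGaussian P H X) (hH : 0 < H) :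
    ∃ κ : ℝ, 0 < κ ∧ LocND hX.curve κ H := by
  choose κ hκ h using fun l ↦ (hX.slnd l).exists_le_integral_sq hH (hX.measurable_coord l)
    (hX.memLp_two l)
  have hmin : ∃ κ₀ : ℝ, 0 < κ₀ ∧ ∀ l, κ₀ ≤ κ l := by
    rcases isEmpty_or_nonempty (Fin d) with hd | hd
    · exact ⟨1, one_pos, fun l ↦ hd.elim l⟩
    · obtain ⟨l, hl⟩ := Finite.exists_min κ
      exact ⟨κ l, hκ l, hl⟩
  obtain ⟨κ₀, hκ₀, hle⟩ := hmin
  refine ⟨κ₀, hκ₀, fun l n s c t ρ hρ hρt hs hd ↦ ?_⟩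
  have h1 := h l n s c t ρ hρ hρt hs hd
  have h2 : ⇑(hX.curve l t - ∑ i, c i • hX.curve l (s i)) =ᵐ[P]
      fun ω ↦ X t.toNNReal ω l - ∑ i, c i * X (s i).toNNReal ω l := by
    filter_upwards [Lp.coeFn_sub (hX.curve l t) (∑ i, c i • hX.curve l (s i)),
      hX.coeFn_sum_curve l c s, (hX.memLp_two l t.toNNReal).coeFn_toLp] with ω e1 e2 e3
    rw [e1, Pi.sub_apply, e2]
    exact congrArg (· - _) e3
  rw [norm_sq_eq_integral_of_ae_eq h2]
  refine le_trans ?_ h1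
  have := hle l
  gcongr

lemma measurable_coord_comp (hX : IsSLNDGaussian P H X) (l : Fin d) {Z : Type*}
    [MeasurableSpace Z] {f : Z → ℝ} (hf : Measurable f) :
    Measurable fun p : Z × Ω ↦ X (f p.1).toNNReal p.2 l :=
  (EuclideanSpace.proj (𝕜 := ℝ) l).continuous.measurable.comp
    (hX.measurable.comp ((measurable_real_toNNReal.comp (hf.comp measurable_fst)).prodMk
      measurable_snd))

/-- No continuity of the process is assumed, so measurability is obtained by integrating out `ω`
from the jointly measurable process. -/
lemma measurable_gram_curve [IsProbabilityMeasure P] (hX : IsSLNDGaussian P H X) (n : ℕ) :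
    Measurable fun p : (Fin n → ℝ) × (Fin n → EuclideanSpace ℝ (Fin d)) ↦
      gram hX.curve p.1 p.2 := by
  simp_rw [hX.gram_curve]
  refine Finset.measurable_fun_sum _ fun l _ ↦ ?_
  refine (StronglyMeasurable.integral_prod_right' (f := fun q :
    ((Fin n → ℝ) × (Fin n → EuclideanSpace ℝ (Fin d))) × Ω ↦
      (∑ j, q.1.2 j l * X (q.1.1 j).toNNReal q.2 l) ^ 2) (Measurable.stronglyMeasurable ?_)).measurable
  refine (Finset.measurable_fun_sum _ fun j _ ↦ Measurable.mul ?_ ?_).pow_const 2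
  · exact (EuclideanSpace.proj (𝕜 := ℝ) l).continuous.measurable.comp
      (f := fun q : ((Fin n → ℝ) × (Fin n → EuclideanSpace ℝ (Fin d))) × Ω ↦ q.1.2 j) (by fun_prop)
  · exact hX.measurable_coord_comp l
      (f := fun p : (Fin n → ℝ) × (Fin n → EuclideanSpace ℝ (Fin d)) ↦ p.1 j) (by fun_prop)

lemma hasGaussianLaw_sum (hX : IsSLNDGaussian P H X) (l : Fin d) {n : ℕ} (c : Fin n → ℝ)
    (t : Fin n → ℝ≥0) : HasGaussianLaw (fun ω ↦ ∑ j, c j * X (t j) ω l) P := by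
  classical
  -- The times may repeat, so the sum is read as a linear functional of the values on the set of
  -- distinct times.
  let L : (Finset.univ.image t → ℝ) →L[ℝ] ℝ :=
    ∑ j, c j • ContinuousLinearMap.proj ⟨t j, Finset.mem_image_of_mem _ (Finset.mem_univ j)⟩
  have h := ((hX.gaussian l).hasGaussianLaw (Finset.univ.image t)).map_fun L
  refine h.congr (ae_of_all _ fun ω ↦ ?_)
  simp [L]

lemma integral_exp_sum (hX : IsSLNDGaussian P H X) (l : Fin d) {n : ℕ} (c : Fin n → ℝ)
    (t : Fin n → ℝ≥0) :
    ∫ ω, Complex.exp (((∑ j, c j * X (t j) ω l : ℝ) : ℂ) * Complex.I) ∂P =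
      Real.exp (-(1 / 2) * ∫ ω, (∑ j, c j * X (t j) ω l) ^ 2 ∂P) := by
  have hg := hX.hasGaussianLaw_sum l c t
  have h0 : ∫ ω, ∑ j, c j * X (t j) ω l ∂P = 0 := by
    rw [integral_finsetSum _ fun j _ ↦
      (((hX.gaussian l).hasGaussianLaw_eval (t j)).integrable).const_mul _]
    simp [integral_const_mul, hX.centered]
  have h := hg.charFun_map_eq 1
  rw [charFun_apply_real, integral_map hg.aemeasurable (by fun_prop)] at h
  have hvar : variance (fun ω ↦ ∑ j, c j * X (t j) ω l) P =
      ∫ ω, (∑ j, c j * X (t j) ω l) ^ 2 ∂P :=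
    variance_of_integral_eq_zero hg.aemeasurable h0
  simp only [Complex.ofReal_one, one_mul, RCLike.inner_apply, conj_trivial, mul_one, h0,
    hvar] at h
  rw [h, Complex.ofReal_exp]
  congr 1
  push_cast
  ring

/-- The characteristic function of the finite-dimensional distributions. -/
lemma integral_exp_sum_inner (hX : IsSLNDGaussian P H X) {n : ℕ} (t : Fin n → ℝ)
    (y : Fin n → EuclideanSpace ℝ (Fin d)) :
    ∫ ω, Complex.exp (((∑ j, inner ℝ (y j) (X (t j).toNNReal ω) : ℝ) : ℂ) * Complex.I) ∂P =
      Real.exp (-(1 / 2) * gram hX.curve t y) := by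
  have e : ∀ ω, Complex.exp (((∑ j, inner ℝ (y j) (X (t j).toNNReal ω) : ℝ) : ℂ) * Complex.I) =
      ∏ l, Complex.exp (((∑ j, y j l * X (t j).toNNReal ω l : ℝ) : ℂ) * Complex.I) := by
    intro ω
    rw [← Complex.exp_sum, ← Finset.sum_mul, ← Complex.ofReal_sum, Finset.sum_comm]
    simp [PiLp.inner_apply, mul_comm]
  simp_rw [e]
  have hmeas : ∀ l : Fin d, Measurable fun w : ℝ≥0 → ℝ ↦
      Complex.exp (((∑ j, y j l * w (t j).toNNReal : ℝ) : ℂ) * Complex.I) := fun l ↦ by fun_prop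
  have hind := hX.indep.comp _ hmeas
  have := hind.integral_fun_prod_eq_prod_integral (fun l ↦ by
    refine ((hmeas l).comp ?_).aestronglyMeasurable
    exact measurable_pi_lambda _ fun t ↦ hX.measurable_coord l t)
  simp only [Function.comp_def] at this
  rw [this, hX.gram_curve, Finset.mul_sum, Real.exp_sum, Complex.ofReal_prod]
  exact Finset.prod_congr rfl fun l _ ↦ hX.integral_exp_sum l (fun j ↦ y j l) _

end IsSLNDGaussian

end FracLocalTime

/-! ### Moments of occupation integrals. -/

namespace FracLocalTime

/-- The integral over `(a, a + h]` of the Fourier transform of `G` along the path. -/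
noncomputable def occupation {Ω : Type*} {d : ℕ} (X : ℝ≥0 → Ω → EuclideanSpace ℝ (Fin d))
    (G : EuclideanSpace ℝ (Fin d) → ℂ) (a h : ℝ) (ω : Ω) : ℂ :=
  ∫ z, G z.2 * Complex.exp (((inner ℝ z.2 (X z.1.toNNReal ω) : ℝ) : ℂ) * Complex.I)
    ∂stripMeasure d a h

lemma norm_mul_phase (c : ℂ) (r : ℝ) : ‖c * Complex.exp ((r : ℂ) * Complex.I)‖ = ‖c‖ := by
  rw [norm_mul, Complex.norm_exp_ofReal_mul_I, mul_one]

lemma norm_occupation_le {Ω : Type*} {d : ℕ} (X : ℝ≥0 → Ω → EuclideanSpace ℝ (Fin d))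
    (G : EuclideanSpace ℝ (Fin d) → ℂ) (a h : ℝ) (ω : Ω) :
    ‖occupation X G a h ω‖ ≤ ∫ z, ‖G z.2‖ ∂stripMeasure d a h := by
  refine (norm_integral_le_integral_norm _).trans_eq ?_
  simp_rw [norm_mul_phase]

/-- The reflection $y\mapsto-y$ restores the phase, so even powers of the modulus are again products
of occupation integrals. -/
lemma conj_occupation {Ω : Type*} {d : ℕ} (X : ℝ≥0 → Ω → EuclideanSpace ℝ (Fin d))
    (G : EuclideanSpace ℝ (Fin d) → ℂ) (a h : ℝ) (ω : Ω) :
    (starRingEnd ℂ) (occupation X G a h ω) =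
      occupation X (fun y ↦ (starRingEnd ℂ) (G (-y))) a h ω := by
  have hmp : MeasurePreserving
      (MeasurableEquiv.prodCongr (MeasurableEquiv.refl ℝ)
        (MeasurableEquiv.neg (EuclideanSpace ℝ (Fin d))))
      (stripMeasure d a h) (stripMeasure d a h) :=
    (MeasurePreserving.id (volume.restrict (Ioc a (a + h)))).prod
      (Measure.measurePreserving_neg (volume : Measure (EuclideanSpace ℝ (Fin d))))
  unfold occupation
  rw [← integral_conj, ← hmp.integral_comp (MeasurableEquiv.measurableEmbedding _)]
  refine integral_congr_ae (ae_of_all _ fun z ↦ ?_)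
  change (starRingEnd ℂ) (G (-z.2) *
    Complex.exp (((inner ℝ (-z.2) (X z.1.toNNReal ω) : ℝ) : ℂ) * Complex.I)) = _
  rw [map_mul, ← Complex.exp_conj, map_mul, Complex.conj_I, Complex.conj_ofReal,
    inner_neg_left]
  push_cast
  rw [neg_mul_neg]

variable {Ω : Type*} [MeasurableSpace Ω] {P : Measure Ω} {H : ℝ} {d : ℕ}
  {X : ℝ≥0 → Ω → EuclideanSpace ℝ (Fin d)}

lemma measurable_phase (hX : IsSLNDGaussian P H X) :
    Measurable fun p : Ω × (ℝ × EuclideanSpace ℝ (Fin d)) ↦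
      Complex.exp (((inner ℝ p.2.2 (X p.2.1.toNNReal p.1) : ℝ) : ℂ) * Complex.I) := by
  have h : Measurable fun p : Ω × (ℝ × EuclideanSpace ℝ (Fin d)) ↦ X p.2.1.toNNReal p.1 :=
    hX.measurable.comp ((measurable_real_toNNReal.comp (by fun_prop)).prodMk measurable_fst)
  have h2 : Measurable fun p : Ω × (ℝ × EuclideanSpace ℝ (Fin d)) ↦
      (inner ℝ p.2.2 (X p.2.1.toNNReal p.1) : ℝ) :=
    Measurable.inner (by fun_prop) h
  fun_prop

lemma integrable_comp_snd_stripMeasure {G : EuclideanSpace ℝ (Fin d) → ℂ} (hG : Integrable G)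
    (a h : ℝ) : Integrable (fun z ↦ G z.2) (stripMeasure d a h) :=
  hG.comp_snd (volume.restrict (Ioc a (a + h)))

lemma measurable_occupation (hX : IsSLNDGaussian P H X) {G : EuclideanSpace ℝ (Fin d) → ℂ}
    (hG : Measurable G) (a h : ℝ) : Measurable (occupation X G a h) := by
  refine (StronglyMeasurable.integral_prod_right' (f := fun p : Ω × (ℝ × _) ↦ G p.2.2 *
    Complex.exp (((inner ℝ p.2.2 (X p.2.1.toNNReal p.1) : ℝ) : ℂ) * Complex.I)) ?_).measurable
  exact ((hG.comp (by fun_prop)).mul (measurable_phase hX)).stronglyMeasurable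

/-- The `n`-th moment functional of a radial-type weight. -/
noncomputable def momentBound (hX : IsSLNDGaussian P H X) {n : ℕ}
    (w : Fin n → EuclideanSpace ℝ (Fin d) → ℝ≥0∞) (a h : ℝ) : ℝ≥0∞ :=
  ∫⁻ z, (∏ j, w j (z j).2) *
      ENNReal.ofReal (Real.exp (-(1 / 2) * gram hX.curve (fun j ↦ (z j).1) fun j ↦ (z j).2))
    ∂Measure.pi fun _ : Fin n ↦ stripMeasure d a h

/-- Fubini and the characteristic function of $\sum_j y_j\cdot X_{t_j}$. Integrability of the
kernels only justifies Fubini and does not enter the bound, so the estimate can stay uniform as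
$\varepsilon\downarrow0$. -/
lemma enorm_integral_prod_occupation_le [IsProbabilityMeasure P] (hX : IsSLNDGaussian P H X)
    {n : ℕ} {G : Fin n → EuclideanSpace ℝ (Fin d) → ℂ} (hGm : ∀ j, Measurable (G j))
    (hG : ∀ j, Integrable (G j)) (a h : ℝ) :
    ‖∫ ω, ∏ j, occupation X (G j) a h ω ∂P‖ₑ ≤ momentBound hX (fun j y ↦ ‖G j y‖ₑ) a h := by
  set μ := Measure.pi fun _ : Fin n ↦ stripMeasure d a h
  let F : Ω → (Fin n → ℝ × EuclideanSpace ℝ (Fin d)) → ℂ := fun ω z ↦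
    ∏ j, (G j (z j).2 *
      Complex.exp (((inner ℝ (z j).2 (X (z j).1.toNNReal ω) : ℝ) : ℂ) * Complex.I))
  have h1 : ∀ ω, ∏ j, occupation X (G j) a h ω = ∫ z, F ω z ∂μ := fun ω ↦
    (integral_fintype_prod_eq_prod (𝕜 := ℂ) (fun j (z : ℝ × EuclideanSpace ℝ (Fin d)) ↦ G j z.2 *
      Complex.exp (((inner ℝ z.2 (X z.1.toNNReal ω) : ℝ) : ℂ) * Complex.I))).symm
  have hFm : Measurable (Function.uncurry F) := by
    refine Finset.measurable_fun_prod _ fun j _ ↦ ?_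
    exact ((hGm j).comp (by fun_prop)).mul ((measurable_phase hX).comp
      (g := fun p : Ω × (ℝ × EuclideanSpace ℝ (Fin d)) ↦
        Complex.exp (((inner ℝ p.2.2 (X p.2.1.toNNReal p.1) : ℝ) : ℂ) * Complex.I))
      (f := fun q : Ω × (Fin n → ℝ × EuclideanSpace ℝ (Fin d)) ↦ (q.1, q.2 j)) (by fun_prop))
  have hFi : Integrable (Function.uncurry F) (P.prod μ) := by
    have hb : Integrable (fun z : Fin n → ℝ × EuclideanSpace ℝ (Fin d) ↦ ∏ j, G j (z j).2) μ :=
      Integrable.fintype_prod (f := fun j (z : ℝ × EuclideanSpace ℝ (Fin d)) ↦ G j z.2)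
        fun j ↦ integrable_comp_snd_stripMeasure (hG j) a h
    refine (hb.comp_snd P).mono hFm.aestronglyMeasurable (ae_of_all _ fun q ↦ ?_)
    simp only [Function.uncurry, F, norm_prod, norm_mul_phase, le_refl]
  have h2 : ∀ z : Fin n → ℝ × EuclideanSpace ℝ (Fin d), ∫ ω, F ω z ∂P = (∏ j, G j (z j).2) *
      Real.exp (-(1 / 2) * gram hX.curve (fun j ↦ (z j).1) fun j ↦ (z j).2) := by
    intro z
    rw [← hX.integral_exp_sum_inner, ← integral_const_mul]
    refine integral_congr_ae (ae_of_all _ fun ω ↦ ?_)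
    simp only [F]
    rw [Finset.prod_mul_distrib, ← Complex.exp_sum, ← Finset.sum_mul, ← Complex.ofReal_sum]
  simp_rw [h1]
  rw [integral_integral_swap hFi]
  refine (enorm_integral_le_lintegral_enorm _).trans_eq (lintegral_congr fun z ↦ ?_)
  rw [h2, ← ofReal_norm, norm_mul, norm_prod, Complex.norm_real,
    Real.norm_of_nonneg (Real.exp_pos _).le, ENNReal.ofReal_mul (by positivity),
    ENNReal.ofReal_prod_of_nonneg fun j _ ↦ norm_nonneg _]
  simp only [ofReal_norm]

lemma momentBound_mono (hX : IsSLNDGaussian P H X) {n : ℕ}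
    {w w' : Fin n → EuclideanSpace ℝ (Fin d) → ℝ≥0∞} (h : ∀ j y, w j y ≤ w' j y) (a r : ℝ) :
    momentBound hX w a r ≤ momentBound hX w' a r :=
  lintegral_mono fun _ ↦ mul_le_mul_left (Finset.prod_le_prod' fun j _ ↦ h j _) _

theorem lintegral_occupation_pow_le [IsProbabilityMeasure P] (hX : IsSLNDGaussian P H X)
    {G : EuclideanSpace ℝ (Fin d) → ℂ} (hGm : Measurable G) (hG : Integrable G)
    {w : EuclideanSpace ℝ (Fin d) → ℝ≥0∞} (hw : ∀ y, ‖G y‖ₑ ≤ w y) (hw' : ∀ y, ‖G (-y)‖ₑ ≤ w y)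
    (m : ℕ) (a h : ℝ) :
    ∫⁻ ω, ‖occupation X G a h ω‖ₑ ^ (m + m) ∂P ≤
      momentBound hX (fun _ : Fin (m + m) ↦ w) a h := by
  let G' : EuclideanSpace ℝ (Fin d) → ℂ := fun y ↦ (starRingEnd ℂ) (G (-y))
  -- The even power is the product of `m` copies of the integral and `m` copies of its conjugate;
  -- the latter is why `w` must also dominate the reflected kernel.
  let Gs : Fin (m + m) → EuclideanSpace ℝ (Fin d) → ℂ := Fin.addCases (fun _ ↦ G) (fun _ ↦ G')
  have hGs : ∀ {p : (EuclideanSpace ℝ (Fin d) → ℂ) → Prop}, p G → p G' → ∀ j, p (Gs j) := by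
    intro p h1 h2 j
    induction j using Fin.addCases with
    | left j => simpa [Gs] using h1
    | right j =>
      simp only [Gs, Fin.addCases_right]
      exact h2
  have hG'm : Measurable G' := (Complex.continuous_conj.measurable.comp hGm).comp measurable_neg
  have hG' : Integrable G' := by
    have := hG.comp_neg
    exact (Complex.conjCLE.toContinuousLinearMap.integrable_comp this)
  have key : ∀ ω, ∏ j, occupation X (Gs j) a h ω = ((‖occupation X G a h ω‖ ^ (m + m) : ℝ) : ℂ) := by
    intro ω
    rw [Fin.prod_univ_add]
    simp only [Gs, Fin.addCases_left, Fin.addCases_right, Finset.prod_const, Finset.card_univ,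
      Fintype.card_fin, G']
    rw [← conj_occupation, ← mul_pow, Complex.mul_conj, Complex.normSq_eq_norm_sq, ← two_mul,
      pow_mul]
    push_cast
    rfl
  have hint : Integrable (fun ω ↦ ‖occupation X G a h ω‖ ^ (m + m)) P := by
    refine Integrable.of_bound
      (((measurable_occupation hX hGm a h).norm.pow_const _).aestronglyMeasurable)
      ((∫ z, ‖G z.2‖ ∂stripMeasure d a h) ^ (m + m)) (ae_of_all _ fun ω ↦ ?_)
    rw [norm_pow, norm_norm]
    exact pow_le_pow_left₀ (norm_nonneg _) (norm_occupation_le X G a h ω) _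
  calc ∫⁻ ω, ‖occupation X G a h ω‖ₑ ^ (m + m) ∂P
      = ∫⁻ ω, ENNReal.ofReal (‖occupation X G a h ω‖ ^ (m + m)) ∂P :=
        lintegral_congr fun ω ↦ by
          rw [ENNReal.ofReal_pow (norm_nonneg _), ofReal_norm]
    _ = ENNReal.ofReal (∫ ω, ‖occupation X G a h ω‖ ^ (m + m) ∂P) :=
        (ofReal_integral_eq_lintegral_ofReal hint (ae_of_all _ fun ω ↦ by positivity)).symm
    _ = ‖∫ ω, ∏ j, occupation X (Gs j) a h ω ∂P‖ₑ := by
        simp_rw [key]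
        rw [integral_complex_ofReal, ← ofReal_norm, Complex.norm_real, Real.norm_of_nonneg]
        exact integral_nonneg fun ω ↦ by positivity
    _ ≤ momentBound hX (fun j y ↦ ‖Gs j y‖ₑ) a h :=
        enorm_integral_prod_occupation_le hX (hGs hGm hG'm) (hGs (p := fun g ↦ Integrable g) hG hG') a h
    _ ≤ _ := momentBound_mono hX (hGs (p := fun g ↦ ∀ y, ‖g y‖ₑ ≤ w y) hw fun y ↦ by
        simpa [G'] using hw' y) a h

lemma eLpNorm_occupation_pow_le [IsProbabilityMeasure P] (hX : IsSLNDGaussian P H X)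
    {G : EuclideanSpace ℝ (Fin d) → ℂ} (hGm : Measurable G) (hG : Integrable G)
    {w : EuclideanSpace ℝ (Fin d) → ℝ≥0∞} (hw : ∀ y, ‖G y‖ₑ ≤ w y) (hw' : ∀ y, ‖G (-y)‖ₑ ≤ w y)
    {m : ℕ} (hm : m ≠ 0) (a h : ℝ) :
    eLpNorm (occupation X G a h) (m + m : ℕ) P ^ (m + m) ≤
      momentBound hX (fun _ : Fin (m + m) ↦ w) a h := by
  refine le_trans (le_of_eq ?_) (lintegral_occupation_pow_le hX hGm hG hw hw' m a h)
  have := eLpNorm_nnreal_pow_eq_lintegral (f := occupation X G a h) (μ := P)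
    (p := ((m + m : ℕ) : ℝ≥0)) (by simpa using hm)
  simpa [ENNReal.rpow_natCast, ← Nat.cast_add] using this

/-- The working estimate: `C` is independent of the kernel, which enters only through `K`.
Finiteness of the moment bound is recorded for dominated convergence in the order of the derivative.
-/
theorem exists_eLpNorm_occupation_le [IsProbabilityMeasure P] (hX : IsSLNDGaussian P H X)
    (hH : 0 < H) {b R : ℝ} (hb : 0 < b) (hR : 0 < R) (hγ : H * (2 * b + d) < 1) {m : ℕ}
    (hm : m ≠ 0) :
    ∃ C : ℝ, 0 < C ∧ momentBound hX (fun _ : Fin (m + m) ↦ weight b) 0 R ≠ ∞ ∧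
      ∀ a h : ℝ, 0 ≤ a → 0 ≤ h → h ≤ R →
      ∀ G : EuclideanSpace ℝ (Fin d) → ℂ, Measurable G → Integrable G → ∀ K : ℝ, 0 ≤ K →
        (∀ y, ‖G y‖ ≤ K * (1 + ‖y‖ ^ b)) →
        eLpNorm (occupation X G a h) (m + m : ℕ) P ≤
          ENNReal.ofReal (K * (C * h ^ (1 - H * (b + d)))) := by
  obtain ⟨k, rfl⟩ := Nat.exists_eq_succ_of_ne_zero hm
  obtain ⟨κ, hκ, hv⟩ := hX.exists_locND hH
  obtain ⟨C, hC, h⟩ := exists_lintegral_weight_exp_gram_le hκ hH hb hR hγ hv (k.succ + k)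
    (hX.measurable_gram_curve _)
  refine ⟨C, hC, ?_, fun a r ha hr hrR G hGm hG K hK hGK ↦ ?_⟩
  · exact ne_top_of_le_ne_top (by finiteness) (h 0 R le_rfl hR.le le_rfl)
  · have hbd : ∀ y, ‖G y‖ₑ ≤ ENNReal.ofReal K * weight b y := fun y ↦ by
      rw [weight, ← ENNReal.ofReal_mul hK, ← ofReal_norm]
      exact ENNReal.ofReal_le_ofReal (hGK y)
    have h1 := eLpNorm_occupation_pow_le hX hGm hG hbd (fun y ↦ by
      have := hbd (-y); simpa [weight] using this) hm a r
    rw [← ENNReal.pow_le_pow_left_iff (show k.succ + k.succ ≠ 0 by omega)]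
    refine h1.trans ?_
    have e : momentBound hX (fun _ : Fin (k.succ + k.succ) ↦
        fun y ↦ ENNReal.ofReal K * weight b y) a r = ENNReal.ofReal K ^ (k.succ + k.succ) *
          momentBound hX (fun _ : Fin (k.succ + k.succ) ↦ weight b) a r := by
      unfold momentBound
      rw [← lintegral_const_mul' _ _ (by finiteness)]
      refine lintegral_congr fun z ↦ ?_
      rw [Finset.prod_mul_distrib, Finset.prod_const, Finset.card_univ, Fintype.card_fin,
        mul_assoc]
    rw [e, ENNReal.ofReal_mul hK, mul_pow]
    gcongr
    exact h a r ha hr hrR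

end FracLocalTime

/-! ### Dyadic chaining along a single path. -/

namespace FracLocalTime

/-- The point of the dyadic grid of mesh `2⁻ᵏ` with integer coordinates `g`. -/
noncomputable def dyadicPoint {m : ℕ} (k : ℕ) (g : Fin m → ℤ) : Fin m → ℝ :=
  fun i ↦ g i * (1 / 2) ^ k

/-- The integer coordinates of the dyadic approximation of `x` from below. -/
noncomputable def dyadicFloor {m : ℕ} (k : ℕ) (x : Fin m → ℝ) : Fin m → ℤ :=
  fun i ↦ ⌊2 ^ k * x i⌋

/-- `y` has increments at most `K * r ^ k` between neighbours of the dyadic grid of mesh `2⁻ᵏ`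
in the box of size `R`. -/
def DyadicBound {m : ℕ} (y : (Fin m → ℝ) → ℂ) (R : ℕ) (r K : ℝ) : Prop :=
  ∀ k : ℕ, 1 ≤ k → ∀ g e : Fin m → ℤ, (∀ i, |g i| ≤ R * 2 ^ k) → (∀ i, |e i| ≤ 1) →
    ‖y (dyadicPoint k (g + e)) - y (dyadicPoint k g)‖ ≤ K * r ^ k

lemma abs_dyadicFloor_le {m : ℕ} {R : ℕ} (k : ℕ) {x : Fin m → ℝ} (hx : ∀ i, |x i| ≤ R)
    (i : Fin m) : |dyadicFloor k x i| ≤ R * 2 ^ k := by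
  have h := abs_le.1 (hx i)
  have h2 : (0 : ℝ) < 2 ^ k := by positivity
  rw [abs_le, dyadicFloor]
  constructor
  · rw [Int.le_floor]
    push_cast
    nlinarith
  · rw [← Int.cast_le (R := ℝ)]
    refine (Int.floor_le _).trans ?_
    push_cast
    nlinarith

/-- Each coordinate of the floor at level `k + 1` is twice that at level `k`, or one more, so the
two approximations are neighbours on the finer grid. -/
lemma norm_sub_dyadic_succ_le {m : ℕ} {y : (Fin m → ℝ) → ℂ} {R : ℕ} {r K : ℝ}
    (h : DyadicBound y R r K) (k : ℕ) {x : Fin m → ℝ} (hx : ∀ i, |x i| ≤ R) :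
    dist (y (dyadicPoint k (dyadicFloor k x)))
      (y (dyadicPoint (k + 1) (dyadicFloor (k + 1) x))) ≤ K * r * r ^ k := by
  set e : Fin m → ℤ := fun i ↦ 2 * dyadicFloor k x i - dyadicFloor (k + 1) x i
  have hpt : dyadicPoint k (dyadicFloor k x) =
      dyadicPoint (k + 1) (dyadicFloor (k + 1) x + e) := by
    ext i
    simp only [dyadicPoint, e, Pi.add_apply, add_sub_cancel]
    push_cast
    ring
  have he : ∀ i, |e i| ≤ 1 := by
    intro i
    simp only [e, dyadicFloor]
    have h1 := Int.floor_le (2 ^ k * x i)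
    have h2 := Int.lt_floor_add_one (2 ^ k * x i)
    have h3 := Int.floor_le (2 ^ (k + 1) * x i)
    have h4 := Int.lt_floor_add_one (2 ^ (k + 1) * x i)
    have h5 : (2 : ℝ) ^ (k + 1) * x i = 2 * (2 ^ k * x i) := by ring
    have h6 : ((⌊(2 : ℝ) ^ (k + 1) * x i⌋ : ℤ) : ℝ) < ((2 * ⌊(2 : ℝ) ^ k * x i⌋ + 2 : ℤ) : ℝ) := by
      push_cast; linarith
    have h7 : ((2 * ⌊(2 : ℝ) ^ k * x i⌋ : ℤ) : ℝ) < ((⌊(2 : ℝ) ^ (k + 1) * x i⌋ + 1 : ℤ) : ℝ) := by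
      push_cast; linarith
    rw [Int.cast_lt] at h6 h7
    rw [abs_le]
    constructor <;> linarith
  rw [hpt, dist_eq_norm]
  refine (h (k + 1) (by omega) _ e (abs_dyadicFloor_le _ hx) he).trans_eq ?_
  ring

/-- At the level whose mesh is comparable to the distance, the two floors are neighbours. One jump
between them and two geometric tails up to the limits give the bound. -/
lemma dist_limit_le {m : ℕ} {y z : (Fin m → ℝ) → ℂ} {R : ℕ} {θ K : ℝ} (hθ : 0 < θ)
    (hK : 0 ≤ K) (h : DyadicBound y R ((1 / 2) ^ θ) K)
    (hz : ∀ x, Tendsto (fun k ↦ y (dyadicPoint k (dyadicFloor k x))) atTop (𝓝 (z x)))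
    {x x' : Fin m → ℝ} (hx : ∀ i, |x i| ≤ R) (hx' : ∀ i, |x' i| ≤ R) (hd : dist x x' ≤ 1 / 2) :
    dist (z x) (z x') ≤ 2 ^ θ * (2 * (K * (1 / 2) ^ θ / (1 - (1 / 2) ^ θ)) + K) *
      dist x x' ^ θ := by
  rcases eq_or_ne x x' with rfl | hne
  · simp [Real.zero_rpow hθ.ne']
  have hd0 : 0 < dist x x' := dist_pos.2 hne
  set r : ℝ := (1 / 2) ^ θ with hr
  have hr0 : 0 < r := by positivity
  have hr1 : r < 1 := Real.rpow_lt_one (by norm_num) (by norm_num) hθ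
  obtain ⟨k, hk1, hk2⟩ := exists_nat_pow_near_of_lt_one hd0 (by linarith)
    (show (0 : ℝ) < 1 / 2 by norm_num) (by norm_num)
  -- The grid bound starts at level `1`, which is why the distance is required to be at most `1 /
  -- 2`.
  have hk : 1 ≤ k := by
    rcases Nat.eq_zero_or_pos k with rfl | hk
    · rw [zero_add, pow_one] at hk1
      exact absurd hd (not_le.2 hk1)
    · exact hk
  have h1 := dist_le_of_le_geometric_of_tendsto r (K * r) hr1
    (fun k ↦ norm_sub_dyadic_succ_le h k hx) (hz x) k
  have h2 := dist_le_of_le_geometric_of_tendsto r (K * r) hr1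
    (fun k ↦ norm_sub_dyadic_succ_le h k hx') (hz x') k
  have h3 : dist (y (dyadicPoint k (dyadicFloor k x)))
      (y (dyadicPoint k (dyadicFloor k x'))) ≤ K * r ^ k := by
    rw [dist_eq_norm]
    have := h k hk (dyadicFloor k x') (dyadicFloor k x - dyadicFloor k x')
      (abs_dyadicFloor_le k hx') (fun i ↦ by
        have hi := (dist_le_pi_dist x x' i).trans hk2
        rw [Real.dist_eq] at hi
        have h2k : (2 : ℝ) ^ k * (1 / 2) ^ k = 1 := by rw [← mul_pow]; norm_num
        have h2k0 : (0 : ℝ) < 2 ^ k := by positivity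
        have hi' : |2 ^ k * x i - 2 ^ k * x' i| ≤ 1 := by
          rw [← mul_sub, abs_mul, abs_of_pos h2k0, ← h2k]
          gcongr
        have a1 := Int.floor_le (2 ^ k * x i)
        have a2 := Int.lt_floor_add_one (2 ^ k * x i)
        have a3 := Int.floor_le (2 ^ k * x' i)
        have a4 := Int.lt_floor_add_one (2 ^ k * x' i)
        have a5 := abs_le.1 hi'
        simp only [dyadicFloor, Pi.sub_apply]
        have b1 : ((⌊(2 : ℝ) ^ k * x i⌋ : ℤ) : ℝ) < ((⌊(2 : ℝ) ^ k * x' i⌋ + 2 : ℤ) : ℝ) := by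
          push_cast; linarith
        have b2 : ((⌊(2 : ℝ) ^ k * x' i⌋ : ℤ) : ℝ) < ((⌊(2 : ℝ) ^ k * x i⌋ + 2 : ℤ) : ℝ) := by
          push_cast; linarith
        rw [Int.cast_lt] at b1 b2
        rw [abs_le]
        constructor <;> linarith)
    rwa [add_sub_cancel] at this
  have hrk : r ^ k ≤ 2 ^ θ * dist x x' ^ θ := by
    have : (1 / 2 : ℝ) ^ k ≤ 2 * dist x x' := by rw [pow_succ] at hk1; linarith
    calc r ^ k = ((1 / 2 : ℝ) ^ k) ^ θ := by
          rw [hr, ← Real.rpow_natCast, ← Real.rpow_natCast, ← Real.rpow_mul (by norm_num),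
            ← Real.rpow_mul (by norm_num), mul_comm]
      _ ≤ (2 * dist x x') ^ θ := Real.rpow_le_rpow (by positivity) this hθ.le
      _ = _ := Real.mul_rpow (by norm_num) hd0.le
  have h1r : 0 < 1 - r := by linarith
  calc dist (z x) (z x') ≤ dist (z x) (y (dyadicPoint k (dyadicFloor k x))) +
        dist (y (dyadicPoint k (dyadicFloor k x))) (y (dyadicPoint k (dyadicFloor k x'))) +
        dist (y (dyadicPoint k (dyadicFloor k x'))) (z x') := dist_triangle4 _ _ _ _
    _ ≤ K * r * r ^ k / (1 - r) + K * r ^ k + K * r * r ^ k / (1 - r) := by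
        rw [dist_comm (z x)]; gcongr
    _ = (2 * (K * r / (1 - r)) + K) * r ^ k := by ring
    _ ≤ (2 * (K * r / (1 - r)) + K) * (2 ^ θ * dist x x' ^ θ) := by gcongr
    _ = _ := by ring

lemma locallyHolder_of_dyadicBound {m : ℕ} {y z : (Fin m → ℝ) → ℂ} {θ : ℝ≥0} (hθ : 0 < θ)
    (h : ∀ R : ℕ, ∃ K : ℝ, DyadicBound y R ((1 / 2) ^ (θ : ℝ)) K)
    (hz : ∀ x, Tendsto (fun k ↦ y (dyadicPoint k (dyadicFloor k x))) atTop (𝓝 (z x))) :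
    LocallyHolder θ z := by
  intro a
  obtain ⟨R, hR⟩ := exists_nat_ge (‖a‖ + 1)
  obtain ⟨K, hK⟩ := h R
  have hK0 : DyadicBound y R ((1 / 2) ^ (θ : ℝ)) |K| := fun k hk g e hg he ↦
    (hK k hk g e hg he).trans (mul_le_mul_of_nonneg_right (le_abs_self K) (by positivity))
  refine ⟨(2 ^ (θ : ℝ) * (2 * (|K| * (1 / 2) ^ (θ : ℝ) / (1 - (1 / 2) ^ (θ : ℝ))) + |K|)).toNNReal,
    Metric.ball a (1 / 4), Metric.ball_mem_nhds a (by norm_num), fun x hx x' hx' ↦ ?_⟩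
  have hbox : ∀ w ∈ Metric.ball a (1 / 4), ∀ i, |w i| ≤ R := by
    intro w hw i
    have h1 : ‖w‖ ≤ ‖a‖ + 1 := by
      have := norm_le_norm_add_norm_sub' w a
      rw [Metric.mem_ball, dist_eq_norm] at hw
      linarith
    exact (norm_le_pi_norm w i).trans (h1.trans hR)
  have hd : dist x x' ≤ 1 / 2 := by
    have := dist_triangle_right x x' a
    rw [Metric.mem_ball] at hx hx'
    linarith
  have hmain := dist_limit_le (by exact_mod_cast hθ) (abs_nonneg K) hK0 hz (hbox x hx)
    (hbox x' hx') hd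
  rw [edist_dist, edist_dist, ENNReal.ofReal_rpow_of_nonneg dist_nonneg θ.coe_nonneg,
    ← ENNReal.ofReal_coe_nnreal, ← ENNReal.ofReal_mul (by positivity)]
  exact ENNReal.ofReal_le_ofReal (hmain.trans
    (mul_le_mul_of_nonneg_right (Real.le_coe_toNNReal _) (by positivity)))

lemma LocallyHolder.continuous {E F : Type*} [PseudoEMetricSpace E] [PseudoEMetricSpace F]
    {θ : ℝ≥0} (hθ : 0 < θ) {f : E → F} (hf : LocallyHolder θ f) : Continuous f := by
  refine continuous_iff_continuousAt.2 fun a ↦ ?_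
  obtain ⟨C, u, hu, h⟩ := hf a
  exact (h.continuousOn hθ).continuousAt hu

lemma LocallyHolder.comp_lipschitz {E F G : Type*} [PseudoEMetricSpace E] [PseudoEMetricSpace F]
    [PseudoEMetricSpace G] {θ : ℝ≥0} {f : F → G} (hf : LocallyHolder θ f) {g : E → F} {K : ℝ≥0}
    (hg : LipschitzWith K g) : LocallyHolder θ (f ∘ g) := by
  intro a
  obtain ⟨C, u, hu, h⟩ := hf (g a)
  have := h.comp (hg.holderWith.holderOnWith (g ⁻¹' u)) (fun x hx ↦ hx)
  rw [mul_one] at this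
  exact ⟨_, _, hg.continuous.continuousAt hu, this⟩

end FracLocalTime

/-! ### Kolmogorov's continuity theorem. -/

namespace FracLocalTime

/-- The normalized `n`-th powers of all neighbour increments have a finite expected sum: level `k`
has of order $2^{mk}$ of them, each of mean at most a constant times $2^{-kn(\theta-\theta')}$, and
`hnθ` makes the series geometric of ratio at most $\frac12$. The hypothesis asks for the box of size
`R + 1` since a neighbour may leave the smaller one. -/
lemma ae_exists_dyadicBound {Ω : Type*} [MeasurableSpace Ω] {P : Measure Ω} {m : ℕ}
    {Y : (Fin m → ℝ) → Ω → ℂ} (hY : ∀ x, Measurable (Y x)) {θ θ' C : ℝ}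
    (hθ0 : 0 < θ) (hC : 0 ≤ C) {R n : ℕ} (hn : n ≠ 0) (hnθ : m + 1 ≤ n * (θ - θ'))
    (h : ∀ x y, (∀ i, |x i| ≤ (R + 1 : ℝ)) → (∀ i, |y i| ≤ (R + 1 : ℝ)) → dist x y ≤ 1 →
      ∫⁻ ω, ‖Y x ω - Y y ω‖ₑ ^ n ∂P ≤ ENNReal.ofReal (C * dist x y ^ θ) ^ n) :
    ∀ᵐ ω ∂P, ∃ K, DyadicBound (fun x ↦ Y x ω) R ((1 / 2) ^ θ') K := by
  set r : ℝ := (1 / 2) ^ θ' with hr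
  set q : ℝ := (1 / 2) ^ θ with hq
  have hr0 : 0 < r := by positivity
  have hq0 : 0 < q := by positivity
  let B : ℕ → Finset (Fin m → ℤ) := fun k ↦
    Fintype.piFinset fun _ ↦ Finset.Icc (-(R * 2 ^ k : ℤ)) (R * 2 ^ k)
  let N : Finset (Fin m → ℤ) := Fintype.piFinset fun _ ↦ Finset.Icc (-1 : ℤ) 1
  let D : ℕ → (Fin m → ℤ) → (Fin m → ℤ) → Ω → ℝ≥0∞ := fun k g e ω ↦
    ENNReal.ofReal ((r ^ k)⁻¹) ^ n *
      ‖Y (dyadicPoint k (g + e)) ω - Y (dyadicPoint k g) ω‖ₑ ^ n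
  let S : ℕ → Ω → ℝ≥0∞ := fun k ω ↦ ∑ g ∈ B (k + 1), ∑ e ∈ N, D (k + 1) g e ω
  have hDm : ∀ k g e, Measurable (D k g e) := fun k g e ↦
    (((hY _).sub (hY _)).enorm.pow_const n).const_mul _
  have hSm : ∀ k, Measurable (S k) := fun k ↦
    Finset.measurable_fun_sum _ fun g _ ↦ Finset.measurable_fun_sum _ fun e _ ↦ hDm _ _ _
  have hD : ∀ k, 1 ≤ k → ∀ g ∈ B k, ∀ e ∈ N,
      ∫⁻ ω, D k g e ω ∂P ≤ ENNReal.ofReal (C ^ n * ((q / r) ^ n) ^ k) := by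
    intro k hk g hg e he
    have hk2 : (0 : ℝ) < (1 / 2) ^ k := by positivity
    have h2k : (2 : ℝ) ^ k * (1 / 2) ^ k = 1 := by rw [← mul_pow]; norm_num
    have hk1 : (1 / 2 : ℝ) ^ k ≤ 1 := pow_le_one₀ (by norm_num) (by norm_num)
    have hgi : ∀ i, |dyadicPoint k g i| ≤ R := fun i ↦ by
      have := Finset.mem_Icc.1 (Fintype.mem_piFinset.1 hg i)
      have h1 : |((g i : ℤ) : ℝ)| ≤ R * 2 ^ k := by exact_mod_cast abs_le.2 this
      rw [dyadicPoint, abs_mul, abs_of_pos hk2]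
      calc _ ≤ (R * 2 ^ k : ℝ) * (1 / 2) ^ k := by gcongr
        _ = R := by rw [mul_assoc, h2k, mul_one]
    have hei : ∀ i, |dyadicPoint k (g + e) i - dyadicPoint k g i| ≤ (1 / 2) ^ k := fun i ↦ by
      have := Finset.mem_Icc.1 (Fintype.mem_piFinset.1 he i)
      have h1 : |((e i : ℤ) : ℝ)| ≤ 1 := by exact_mod_cast abs_le.2 this
      have h2 : dyadicPoint k (g + e) i - dyadicPoint k g i = e i * (1 / 2) ^ k := by
        simp only [dyadicPoint, Pi.add_apply]; push_cast; ring
      rw [h2, abs_mul, abs_of_pos hk2]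
      exact mul_le_of_le_one_left hk2.le h1
    have hd : dist (dyadicPoint k (g + e)) (dyadicPoint k g) ≤ (1 / 2) ^ k :=
      (dist_pi_le_iff hk2.le).2 hei
    have hh := h (dyadicPoint k (g + e)) (dyadicPoint k g) (fun i ↦ by
      have h1 := hei i
      have h2 := hgi i
      have := abs_add_le (dyadicPoint k (g + e) i - dyadicPoint k g i) (dyadicPoint k g i)
      rw [sub_add_cancel] at this
      linarith) (fun i ↦ (hgi i).trans (by linarith)) (hd.trans hk1)
    have hqk : dist (dyadicPoint k (g + e)) (dyadicPoint k g) ^ θ ≤ q ^ k := by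
      refine (Real.rpow_le_rpow dist_nonneg hd hθ0.le).trans_eq ?_
      rw [hq, ← Real.rpow_natCast, ← Real.rpow_natCast, ← Real.rpow_mul (by norm_num),
        ← Real.rpow_mul (by norm_num), mul_comm]
    refine (lintegral_const_mul _ (((hY _).sub (hY _)).enorm.pow_const n)).trans_le ?_
    calc _ ≤ ENNReal.ofReal ((r ^ k)⁻¹) ^ n * ENNReal.ofReal (C * q ^ k) ^ n := by
          refine mul_le_mul_right (hh.trans ?_) _
          gcongr
      _ = _ := by
          rw [← mul_pow, ← ENNReal.ofReal_mul (by positivity), ← ENNReal.ofReal_pow (by positivity)]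
          congr 1
          rw [← pow_mul, mul_comm n k, pow_mul, ← mul_pow, div_pow]
          congr 1
          field_simp
  have hqr : 2 ^ m * (q / r) ^ n ≤ 1 / 2 := by
    have : (q / r) ^ n = (1 / 2) ^ (n * (θ - θ')) := by
      rw [hq, hr, ← Real.rpow_sub (by norm_num), ← Real.rpow_natCast, ← Real.rpow_mul (by norm_num),
        mul_comm]
    rw [this]
    calc (2 : ℝ) ^ m * (1 / 2) ^ (n * (θ - θ')) ≤ 2 ^ m * (1 / 2) ^ (m + 1 : ℝ) := by
          gcongr 2 ^ m * ?_
          exact Real.rpow_le_rpow_of_exponent_ge (by norm_num) (by norm_num) hnθ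
      _ = 1 / 2 := by
          rw [← Nat.cast_succ, Real.rpow_natCast, pow_succ, ← mul_assoc, ← mul_pow]; norm_num
  set A : ℝ := (2 * R + 1) ^ m * 3 ^ m * C ^ n with hA
  have hcard : ∀ k, ((B k).card : ℝ) ≤ (2 * R + 1) ^ m * (2 ^ m) ^ k := by
    intro k
    have : ((B k).card : ℝ) = (2 * (R * 2 ^ k) + 1) ^ m := by
      simp only [B, Fintype.card_piFinset, Finset.prod_const, Finset.card_univ, Fintype.card_fin,
        Int.card_Icc]
      rw [show (R * 2 ^ k + 1 - -(R * 2 ^ k) : ℤ) = ((2 * (R * 2 ^ k) + 1 : ℕ) : ℤ) by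
        push_cast; ring, Int.toNat_natCast]
      push_cast; ring
    rw [this, ← pow_mul, mul_comm m k, pow_mul, ← mul_pow]
    gcongr
    have : (1 : ℝ) ≤ 2 ^ k := one_le_pow₀ (by norm_num)
    linarith
  have hNcard : (N.card : ℝ) = 3 ^ m := by
    simp [N, Fintype.card_piFinset]
  have hS : ∀ k, ∫⁻ ω, S k ω ∂P ≤ ENNReal.ofReal (A * (1 / 2) ^ (k + 1)) := by
    intro k
    simp only [S]
    rw [lintegral_finsetSum _ fun g _ ↦ Finset.measurable_fun_sum _ fun e _ ↦ hDm _ _ _]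
    simp_rw [lintegral_finsetSum _ fun e _ ↦ hDm _ _ e]
    calc _ ≤ ∑ g ∈ B (k + 1), ∑ e ∈ N, ENNReal.ofReal (C ^ n * ((q / r) ^ n) ^ (k + 1)) :=
          Finset.sum_le_sum fun g hg ↦ Finset.sum_le_sum fun e he ↦ hD _ (by omega) g hg e he
      _ = ENNReal.ofReal ((B (k + 1)).card * (3 ^ m * (C ^ n * ((q / r) ^ n) ^ (k + 1)))) := by
          rw [ENNReal.ofReal_mul (Nat.cast_nonneg _), ← hNcard,
            ENNReal.ofReal_mul (Nat.cast_nonneg _)]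
          simp
      _ ≤ _ := by
          refine ENNReal.ofReal_le_ofReal ?_
          calc _ ≤ ((2 * R + 1) ^ m * (2 ^ m) ^ (k + 1)) *
                (3 ^ m * (C ^ n * ((q / r) ^ n) ^ (k + 1))) := by
                gcongr; exact hcard _
            _ = A * (2 ^ m * (q / r) ^ n) ^ (k + 1) := by rw [mul_pow, hA]; ring
            _ ≤ _ := by gcongr
  have hfin : ∫⁻ ω, ∑' k, S k ω ∂P ≠ ∞ := by
    rw [lintegral_tsum fun k ↦ (hSm k).aemeasurable]
    refine ne_top_of_le_ne_top ?_ (ENNReal.tsum_le_tsum hS)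
    refine Summable.tsum_ofReal_ne_top ?_
    exact ((summable_nat_add_iff 1).2
      (summable_geometric_of_lt_one (by norm_num) (by norm_num))).mul_left A
  filter_upwards [ae_lt_top (Measurable.tsum hSm) hfin] with ω hω
  -- Adding `1` makes the base at least one, so that it bounds the sum after being raised to the
  -- power `n`, and `n`-th roots can be taken.
  refine ⟨1 + (∑' k, S k ω).toReal, fun k hk g e hg he ↦ ?_⟩
  have hT : D k g e ω ≤ ∑' k, S k ω := by
    obtain ⟨j, rfl⟩ := Nat.exists_eq_add_of_le' hk
    refine le_trans ?_ (ENNReal.le_tsum j)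
    have hg' : g ∈ B (j + 1) := Fintype.mem_piFinset.2 fun i ↦ Finset.mem_Icc.2 (abs_le.1 (hg i))
    have he' : e ∈ N := Fintype.mem_piFinset.2 fun i ↦ Finset.mem_Icc.2 (abs_le.1 (he i))
    exact (Finset.single_le_sum (f := fun e ↦ D (j + 1) g e ω) (fun _ _ ↦ zero_le) he').trans
      (Finset.single_le_sum (f := fun g ↦ ∑ e ∈ N, D (j + 1) g e ω) (fun _ _ ↦ zero_le) hg')
  have hT' : ((r ^ k)⁻¹ * ‖Y (dyadicPoint k (g + e)) ω - Y (dyadicPoint k g) ω‖) ^ n ≤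
      (1 + (∑' k, S k ω).toReal) ^ n := by
    have h1 := ENNReal.toReal_mono hω.ne hT
    simp only [D] at h1
    rw [← mul_pow, ENNReal.toReal_pow, ENNReal.toReal_mul, ENNReal.toReal_ofReal (by positivity),
      toReal_enorm] at h1
    refine h1.trans ?_
    have h0 : 0 ≤ (∑' k, S k ω).toReal := ENNReal.toReal_nonneg
    calc _ ≤ 1 + (∑' k, S k ω).toReal := by linarith
      _ ≤ _ := le_self_pow₀ (by linarith) hn
  have h2 := (pow_le_pow_iff_left₀ (by positivity) (by positivity) hn).1 hT'
  rwa [inv_mul_le_iff₀ (by positivity), mul_comm] at h2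

/-- **Kolmogorov's continuity theorem** for a complex random field on `ℝ^m`. -/
theorem exists_locallyHolder_modification {Ω : Type*} [MeasurableSpace Ω] {P : Measure Ω}
    {m : ℕ} {Y : (Fin m → ℝ) → Ω → ℂ} (hY : ∀ x, Measurable (Y x)) {θ₀ : ℝ} (hθ₀ : 0 < θ₀)
    (h : ∀ θ : ℝ, 0 < θ → θ < θ₀ → ∀ R N : ℕ, ∃ n : ℕ, N ≤ n ∧ ∃ C : ℝ, 0 ≤ C ∧
      ∀ x y, (∀ i, |x i| ≤ (R : ℝ)) → (∀ i, |y i| ≤ (R : ℝ)) → dist x y ≤ 1 →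
        ∫⁻ ω, ‖Y x ω - Y y ω‖ₑ ^ n ∂P ≤ ENNReal.ofReal (C * dist x y ^ θ) ^ n) :
    ∃ Z : (Fin m → ℝ) → Ω → ℂ, (∀ x, Measurable (Z x) ∧ Z x =ᵐ[P] Y x) ∧
      ∀ ω, ∀ θ : ℝ≥0, 0 < θ → (θ : ℝ) < θ₀ → LocallyHolder θ fun x ↦ Z x ω := by
  -- Rational exponents keep the exceptional set null; a bound for a larger exponent implies those
  -- for smaller ones. A single modification therefore serves all exponents below `θ₀`.
  have hgood : ∀ᵐ ω ∂P, ∀ R : ℕ, ∀ θ : ℚ, 0 < (θ : ℝ) → (θ : ℝ) < θ₀ →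
      ∃ K, DyadicBound (fun x ↦ Y x ω) R ((1 / 2) ^ (θ : ℝ)) K := by
    rw [ae_all_iff]; intro R
    rw [ae_all_iff]; intro θ
    by_cases hθ : 0 < (θ : ℝ) ∧ (θ : ℝ) < θ₀
    · obtain ⟨N, hN⟩ := exists_nat_ge ((m + 1) / ((θ₀ - θ) / 2))
      obtain ⟨n, hn, C, hC, hb⟩ := h ((θ + θ₀) / 2) (by linarith) (by linarith) (R + 1) (N + 1)
      have hδ : (0 : ℝ) < (θ₀ - θ) / 2 := by linarith
      filter_upwards [ae_exists_dyadicBound (R := R) hY (θ' := θ) (θ := (θ + θ₀) / 2)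
        (by linarith) hC (by omega : n ≠ 0) (by
          rw [div_le_iff₀ hδ] at hN
          have : (N : ℝ) ≤ n := by exact_mod_cast (by omega : N ≤ n)
          calc (m + 1 : ℝ) ≤ N * ((θ₀ - θ) / 2) := hN
            _ ≤ n * ((θ₀ - θ) / 2) := by gcongr
            _ = _ := by ring) (by exact_mod_cast hb)] with ω hω _ _
      exact hω
    · exact ae_of_all _ fun ω h1 h2 ↦ absurd ⟨h1, h2⟩ hθ
  obtain ⟨t, htsub, htm, htP⟩ := exists_measurable_superset_of_null hgood
  have hgood' : ∀ ω ∉ t, ∀ R : ℕ, ∀ θ : ℝ, 0 < θ → θ < θ₀ →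
      ∃ K, DyadicBound (fun x ↦ Y x ω) R ((1 / 2) ^ θ) K := by
    intro ω hω R θ hθ hθ'
    obtain ⟨θ', h1, h2⟩ := exists_rat_btwn hθ'
    have := not_not.1 fun hn ↦ hω (htsub hn)
    obtain ⟨K, hK⟩ := this R θ' (hθ.trans h1) h2
    refine ⟨|K|, fun k hk g e hg he ↦ (hK k hk g e hg he).trans ?_⟩
    refine mul_le_mul (le_abs_self K) ?_ (by positivity) (abs_nonneg K)
    exact pow_le_pow_left₀ (by positivity)
      (Real.rpow_le_rpow_of_exponent_ge (by norm_num) (by norm_num) h1.le) _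
  have hlim : ∀ ω ∉ t, ∀ x, ∃ z, Tendsto
      (fun k ↦ Y (dyadicPoint k (dyadicFloor k x)) ω) atTop (𝓝 z) := by
    intro ω hω x
    obtain ⟨R, hR⟩ := exists_nat_ge ‖x‖
    obtain ⟨K, hK⟩ := hgood' ω hω R (θ₀ / 2) (by linarith) (by linarith)
    have hx : ∀ i, |x i| ≤ R := fun i ↦ (norm_le_pi_norm x i).trans hR
    refine cauchySeq_tendsto_of_complete (cauchySeq_of_le_geometric _ _ ?_ fun k ↦
      norm_sub_dyadic_succ_le hK k hx)
    exact Real.rpow_lt_one (by norm_num) (by norm_num) (by linarith)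
  choose! z hz using hlim
  classical
  -- Zero on a measurable null set, so that measurability and the Hölder property hold for every
  -- `ω`.
  let Z : (Fin m → ℝ) → Ω → ℂ := fun x ω ↦ if ω ∈ t then 0 else z ω x
  have hZlim : ∀ x ω, Tendsto (fun k ↦ tᶜ.indicator (Y (dyadicPoint k (dyadicFloor k x))) ω) atTop
      (𝓝 (Z x ω)) := by
    intro x ω
    by_cases hω : ω ∈ t
    · simp [Z, hω]
    · simpa [Z, hω] using hz ω hω x
  refine ⟨Z, fun x ↦ ⟨?_, ?_⟩, fun ω θ hθ hθ' ↦ ?_⟩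
  · exact measurable_of_tendsto_metrizable (fun k ↦ (hY _).indicator htm.compl)
      (tendsto_pi_nhds.2 (hZlim x))
  · obtain ⟨R, hR⟩ := exists_nat_ge (‖x‖ + 1)
    obtain ⟨n, hn, C, hC, hb⟩ := h (θ₀ / 2) (by linarith) (by linarith) R 1
    have hdist : ∀ k, dist (dyadicPoint k (dyadicFloor k x)) x ≤ (1 / 2) ^ k := by
      intro k
      have h2 : (0 : ℝ) < (1 / 2) ^ k := by positivity
      have h2k : (2 : ℝ) ^ k * (1 / 2) ^ k = 1 := by rw [← mul_pow]; norm_num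
      refine (dist_pi_le_iff h2.le).2 fun i ↦ ?_
      have h3 := Int.floor_le (2 ^ k * x i)
      have h4 := Int.lt_floor_add_one (2 ^ k * x i)
      have h5 : x i = 2 ^ k * x i * (1 / 2) ^ k := by
        rw [mul_right_comm, h2k, one_mul]
      rw [Real.dist_eq]
      simp only [dyadicPoint, dyadicFloor]
      rw [h5, ← sub_mul, abs_mul, abs_of_pos h2, ← h5]
      refine mul_le_of_le_one_left h2.le ?_
      rw [abs_le]
      constructor <;> linarith
    have hxR : ∀ i, |x i| ≤ R := fun i ↦ (norm_le_pi_norm x i).trans (by linarith)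
    have hint : ∀ k, ∫⁻ ω, ‖Y (dyadicPoint k (dyadicFloor k x)) ω - Y x ω‖ₑ ^ n ∂P ≤
        ENNReal.ofReal (C * ((1 / 2 : ℝ) ^ k) ^ (θ₀ / 2)) ^ n := by
      intro k
      have hk1 : (1 / 2 : ℝ) ^ k ≤ 1 := pow_le_one₀ (by norm_num) (by norm_num)
      refine (hb _ _ (fun i ↦ ?_) hxR ((hdist k).trans hk1)).trans ?_
      · have h1 := norm_le_norm_add_norm_sub' (dyadicPoint k (dyadicFloor k x)) x
        rw [← dist_eq_norm] at h1
        have := hdist k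
        exact (norm_le_pi_norm (dyadicPoint k (dyadicFloor k x)) i).trans (by linarith)
      · gcongr
        exact hdist k
    have hZt : ∀ᵐ ω ∂P, Tendsto (fun k ↦ ‖Y (dyadicPoint k (dyadicFloor k x)) ω - Y x ω‖ₑ ^ n)
        atTop (𝓝 (‖Z x ω - Y x ω‖ₑ ^ n)) := by
      have : ∀ᵐ ω ∂P, ω ∉ t := measure_eq_zero_iff_ae_notMem.1 htP
      filter_upwards [this] with ω hω
      have h1 := hZlim x ω
      simp only [indicator_of_mem (show ω ∈ tᶜ from hω)] at h1
      have hc : Continuous fun w : ℂ ↦ ‖w - Y x ω‖ₑ ^ n := by fun_prop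
      exact (hc.tendsto _).comp h1
    -- `Z x` is the almost sure limit of `Y` along the grid and `Y x` is the limit in the `n`-th
    -- mean; Fatou identifies them.
    have hzero : ∫⁻ ω, ‖Z x ω - Y x ω‖ₑ ^ n ∂P = 0 := by
      have hfatou : ∫⁻ ω, ‖Z x ω - Y x ω‖ₑ ^ n ∂P ≤ liminf (fun k ↦
          ∫⁻ ω, ‖Y (dyadicPoint k (dyadicFloor k x)) ω - Y x ω‖ₑ ^ n ∂P) atTop := by
        refine le_trans (le_of_eq (lintegral_congr_ae ?_))
          (lintegral_liminf_le fun k ↦ ((hY _).sub (hY x)).enorm.pow_const n)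
        filter_upwards [hZt] with ω hω
        exact hω.liminf_eq.symm
      have hto : Tendsto (fun k : ℕ ↦ ENNReal.ofReal (C * ((1 / 2 : ℝ) ^ k) ^ (θ₀ / 2)) ^ n) atTop
          (𝓝 0) := by
        have h1 : Tendsto (fun k : ℕ ↦ (1 / 2 : ℝ) ^ k) atTop (𝓝 0) :=
          tendsto_pow_atTop_nhds_zero_of_lt_one (by norm_num) (by norm_num)
        have h2 := (h1.rpow_const (p := θ₀ / 2) (Or.inr (by linarith))).const_mul C
        rw [Real.zero_rpow (by linarith), mul_zero] at h2
        have h3 := ENNReal.Tendsto.pow (n := n) (ENNReal.tendsto_ofReal h2)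
        rwa [ENNReal.ofReal_zero, zero_pow (by omega)] at h3
      have := tendsto_of_tendsto_of_tendsto_of_le_of_le tendsto_const_nhds hto
        (fun k ↦ zero_le) hint
      exact le_antisymm (hfatou.trans_eq this.liminf_eq) (zero_le)
    have hZm : Measurable (Z x) :=
      measurable_of_tendsto_metrizable (fun k ↦ (hY _).indicator htm.compl)
        (tendsto_pi_nhds.2 (hZlim x))
    have hm : Measurable fun ω ↦ ‖Z x ω - Y x ω‖ₑ ^ n := (hZm.sub (hY x)).enorm.pow_const n
    filter_upwards [(lintegral_eq_zero_iff hm).1 hzero] with ω hω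
    have := pow_eq_zero_iff (by omega : n ≠ 0) |>.1 hω
    rwa [enorm_eq_zero, sub_eq_zero] at this
  · by_cases hω : ω ∈ t
    · simp only [Z, hω, if_true]
      exact fun a ↦ ⟨0, univ, univ_mem, fun x _ y _ ↦ by simp⟩
    · simp only [Z, hω, if_false]
      exact locallyHolder_of_dyadicBound hθ (fun R ↦ hgood' ω hω R θ (by exact_mod_cast hθ) hθ')
        (hz ω hω)

end FracLocalTime

/-! ### Fourier kernels and their increments. -/

namespace FracLocalTime

/-- The Fourier multiplier of the fractional derivative of order `α`. -/
noncomputable def symbol {d : ℕ} (s : ℝ) (α : Fin d → ℝ) (y : EuclideanSpace ℝ (Fin d)) : ℂ :=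
  ∏ l, ((|y l| ^ α l : ℝ) : ℂ) *
    Complex.exp (((s * (Real.pi * α l / 2 * Real.sign (y l)) : ℝ) : ℂ) * Complex.I)

/-- The Fourier transform of the fractional derivative of the heat kernel, shifted by `x`. -/
noncomputable def kernel {d : ℕ} (s : ℝ) (α : Fin d → ℝ) (ε : ℝ)
    (x y : EuclideanSpace ℝ (Fin d)) : ℂ :=
  (1 / (2 * Real.pi) ^ d : ℝ) * (symbol s α y * Complex.exp (((inner ℝ y x : ℝ) : ℂ) * Complex.I) *
    ((Real.exp (-(ε / 2) * ‖y‖ ^ 2) : ℝ) : ℂ))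

section symbol

variable {d : ℕ} {s : ℝ} {α : Fin d → ℝ}

lemma measurable_sign : Measurable Real.sign := by
  unfold Real.sign
  exact Measurable.ite measurableSet_Iio measurable_const
    (Measurable.ite measurableSet_Ioi measurable_const measurable_const)

lemma measurable_symbol (s : ℝ) (α : Fin d → ℝ) : Measurable (symbol s α) := by
  unfold symbol
  refine Finset.measurable_fun_prod _ fun l _ ↦ ?_
  have h1 : Measurable fun y : EuclideanSpace ℝ (Fin d) ↦ y l :=
    (EuclideanSpace.proj (𝕜 := ℝ) l).continuous.measurable
  have h2 := measurable_sign.comp h1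
  simp only [Function.comp_def] at h2
  fun_prop

lemma measurable_kernel (s : ℝ) (α : Fin d → ℝ) (ε : ℝ) (x : EuclideanSpace ℝ (Fin d)) :
    Measurable (kernel s α ε x) := by
  unfold kernel
  have := measurable_symbol s α
  fun_prop

lemma norm_symbol_le (hα : ∀ l, 0 ≤ α l) (y : EuclideanSpace ℝ (Fin d)) :
    ‖symbol s α y‖ ≤ ‖y‖ ^ ∑ l, α l := by
  unfold symbol
  rw [norm_prod, Real.rpow_sum_of_nonneg (norm_nonneg y) fun l _ ↦ hα l]
  refine Finset.prod_le_prod (fun l _ ↦ norm_nonneg _) fun l _ ↦ ?_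
  rw [norm_mul_phase, Complex.norm_real, Real.norm_of_nonneg (by positivity)]
  exact Real.rpow_le_rpow (abs_nonneg _) (PiLp.norm_apply_le y l) (hα l)

lemma rpow_le_one_add_rpow {r a b : ℝ} (hr : 0 ≤ r) (ha : 0 ≤ a) (hab : a ≤ b) :
    r ^ a ≤ 1 + r ^ b := by
  rcases le_total r 1 with h | h
  · exact (Real.rpow_le_one hr h ha).trans (by simp; positivity)
  · exact (Real.rpow_le_rpow_of_exponent_le h hab).trans (by linarith)

lemma norm_kernel_const_le (d : ℕ) : ‖((1 / (2 * Real.pi) ^ d : ℝ) : ℂ)‖ ≤ 1 := by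
  rw [Complex.norm_real, Real.norm_of_nonneg (by positivity), div_le_one (by positivity)]
  exact one_le_pow₀ (by linarith [Real.pi_gt_three])

lemma norm_kernel_le (hα : ∀ l, 0 ≤ α l) (ε : ℝ) (x y : EuclideanSpace ℝ (Fin d)) :
    ‖kernel s α ε x y‖ ≤ ‖y‖ ^ (∑ l, α l) * Real.exp (-(ε / 2) * ‖y‖ ^ 2) := by
  rw [kernel, norm_mul, norm_mul, norm_mul_phase, Complex.norm_real (Real.exp _),
    Real.norm_of_nonneg (Real.exp_pos _).le]
  refine (mul_le_of_le_one_left (by positivity) (norm_kernel_const_le d)).trans ?_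
  gcongr
  exact norm_symbol_le hα y

lemma norm_kernel_le_one_add {ε b : ℝ} (hα : ∀ l, 0 ≤ α l) (hε : 0 < ε) (hb : ∑ l, α l ≤ b)
    (x y : EuclideanSpace ℝ (Fin d)) : ‖kernel s α ε x y‖ ≤ 1 * (1 + ‖y‖ ^ b) := by
  rw [one_mul]
  refine (norm_kernel_le hα ε x y).trans ?_
  refine (mul_le_of_le_one_right (by positivity) ?_).trans
    (rpow_le_one_add_rpow (norm_nonneg y) (Finset.sum_nonneg fun l _ ↦ hα l) hb)
  rw [Real.exp_le_one_iff, neg_mul]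
  simp only [Left.neg_nonpos_iff]
  positivity

lemma integrable_exp_neg_mul_sq_norm {b : ℝ} (hb : 0 < b) :
    Integrable fun y : EuclideanSpace ℝ (Fin d) ↦ Real.exp (-b * ‖y‖ ^ 2) := by
  refine ⟨by fun_prop, ?_⟩
  rw [hasFiniteIntegral_iff_ofReal (ae_of_all _ fun _ ↦ (Real.exp_pos _).le),
    lintegral_exp_neg_mul_sq_norm hb]
  exact ENNReal.ofReal_lt_top

lemma integrable_kernel (hα : ∀ l, 0 ≤ α l) {ε : ℝ} (hε : 0 < ε)
    (x : EuclideanSpace ℝ (Fin d)) : Integrable (kernel s α ε x) := by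
  obtain ⟨M, hM1, hM⟩ := exists_rpow_le_exp (c := ε / 4) (b := ∑ l, α l) (by linarith)
    (Finset.sum_nonneg fun l _ ↦ hα l)
  refine ((integrable_exp_neg_mul_sq_norm (d := d) (b := ε / 4) (by linarith)).const_mul M).mono'
    (measurable_kernel s α ε x).aestronglyMeasurable (ae_of_all _ fun y ↦ ?_)
  refine (norm_kernel_le hα ε x y).trans ?_
  rw [show -(ε / 2) * ‖y‖ ^ 2 = -(ε / 4) * ‖y‖ ^ 2 + -(ε / 4) * ‖y‖ ^ 2 by ring, Real.exp_add,
    ← mul_assoc]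
  gcongr
  exact hM _ (norm_nonneg y)

/-- Interpolation: the difference is at most both $1$ and $w$, and $\min(1,w)\le w^\delta$ for
$0\le\delta\le1$. -/
lemma abs_exp_neg_sub_exp_neg_le {u v w δ : ℝ} (hu : 0 ≤ u) (hv : 0 ≤ v) (huw : u ≤ w)
    (hvw : v ≤ w) (hδ0 : 0 ≤ δ) (hδ : δ ≤ 1) : |Real.exp (-u) - Real.exp (-v)| ≤ w ^ δ := by
  have key : ∀ u v : ℝ, 0 ≤ u → u ≤ v → v ≤ w → |Real.exp (-u) - Real.exp (-v)| ≤ w ^ δ := by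
    intro u v hu huv hvw
    have h1 : Real.exp (-u) ≤ 1 := Real.exp_le_one_iff.2 (by linarith)
    have h2 : Real.exp (-v) ≤ Real.exp (-u) := Real.exp_le_exp.2 (by linarith)
    have h3 : 1 - v ≤ Real.exp (-v) := by linarith [Real.add_one_le_exp (-v)]
    have h4 := Real.exp_pos (-v)
    rw [abs_of_nonneg (by linarith)]
    rcases le_total w 1 with h | h
    · rcases (hu.trans (huv.trans hvw)).eq_or_lt with h0 | h0
      · have : u = v := by linarith
        rw [this, sub_self]
        positivity
      · have : w ^ (1 : ℝ) ≤ w ^ δ := Real.rpow_le_rpow_of_exponent_ge h0 h hδ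
        rw [Real.rpow_one] at this
        linarith
    · have := Real.one_le_rpow h hδ0
      linarith
  rcases le_total u v with h | h
  · exact key u v hu h hvw
  · rw [abs_sub_comm]; exact key v u hv h huw

/-- A factor $\eta^\delta$ is bought with $2\delta$ additional powers of the frequency, available
because the admissibility condition is strict. -/
lemma norm_kernel_sub_kernel_le {δ ε ε' η : ℝ} (hα : ∀ l, 0 ≤ α l) (hε : 0 < ε) (hε' : 0 < ε')
    (hεη : ε ≤ η) (hεη' : ε' ≤ η) (hδ0 : 0 ≤ δ) (hδ : δ ≤ 1) (x y : EuclideanSpace ℝ (Fin d)) :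
    ‖(kernel s α ε x - kernel s α ε' x) y‖ ≤ η ^ δ * (1 + ‖y‖ ^ (∑ l, α l + 2 * δ)) := by
  have hη : 0 < η := hε.trans_le hεη
  have ha : 0 ≤ ∑ l, α l := Finset.sum_nonneg fun l _ ↦ hα l
  have e : (kernel s α ε x - kernel s α ε' x) y = ((1 / (2 * Real.pi) ^ d : ℝ) : ℂ) *
      (symbol s α y * Complex.exp (((inner ℝ y x : ℝ) : ℂ) * Complex.I) *
      ((Real.exp (-(ε / 2 * ‖y‖ ^ 2)) - Real.exp (-(ε' / 2 * ‖y‖ ^ 2)) : ℝ) : ℂ)) := by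
    simp only [Pi.sub_apply, kernel]
    push_cast
    simp only [neg_mul]
    ring
  rw [e, norm_mul, norm_mul, norm_mul_phase, Complex.norm_real (_ - _), Real.norm_eq_abs]
  refine (mul_le_of_le_one_left (by positivity) (norm_kernel_const_le d)).trans ?_
  have hu : ∀ ε : ℝ, 0 < ε → ε ≤ η → ε / 2 * ‖y‖ ^ 2 ≤ η * ‖y‖ ^ 2 := fun ε h0 h ↦ by
    gcongr; linarith
  calc _ ≤ ‖y‖ ^ (∑ l, α l) * (η * ‖y‖ ^ 2) ^ δ := by
        gcongr
        · exact norm_symbol_le hα y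
        · exact abs_exp_neg_sub_exp_neg_le (by positivity) (by positivity) (hu ε hε hεη)
            (hu ε' hε' hεη') hδ0 hδ
    _ = η ^ δ * ‖y‖ ^ (∑ l, α l + 2 * δ) := by
        rw [Real.mul_rpow hη.le (by positivity), ← Real.rpow_natCast ‖y‖ 2,
          ← Real.rpow_mul (norm_nonneg y), Real.rpow_add_of_nonneg (norm_nonneg y) ha (by positivity)]
        push_cast
        ring
    _ ≤ _ := by gcongr; linarith

lemma norm_exp_sub_exp_le {u v θ : ℝ} (hθ0 : 0 ≤ θ) (hθ : θ ≤ 1) :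
    ‖Complex.exp ((u : ℂ) * Complex.I) - Complex.exp ((v : ℂ) * Complex.I)‖ ≤
      2 * |u - v| ^ θ := by
  have h1 : ‖Complex.exp ((u : ℂ) * Complex.I) - Complex.exp ((v : ℂ) * Complex.I)‖ ≤ 2 := by
    refine (norm_sub_le _ _).trans ?_
    rw [Complex.norm_exp_ofReal_mul_I, Complex.norm_exp_ofReal_mul_I]; norm_num
  have h2 : ‖Complex.exp ((u : ℂ) * Complex.I) - Complex.exp ((v : ℂ) * Complex.I)‖ ≤
      |u - v| := by
    have e : Complex.exp ((u : ℂ) * Complex.I) - Complex.exp ((v : ℂ) * Complex.I) =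
        Complex.exp ((v : ℂ) * Complex.I) * (Complex.exp (Complex.I * ((u - v : ℝ) : ℂ)) - 1) := by
      rw [mul_sub, ← Complex.exp_add, mul_one]
      congr 2
      push_cast; ring
    rw [e, norm_mul, Complex.norm_exp_ofReal_mul_I, one_mul]
    exact Real.norm_exp_I_mul_ofReal_sub_one_le
  rcases le_total |u - v| 1 with h | h
  · rcases (abs_nonneg (u - v)).eq_or_lt with h0 | h0
    · rw [← h0] at h2
      exact h2.trans (by positivity)
    · have : |u - v| ^ (1 : ℝ) ≤ |u - v| ^ θ := Real.rpow_le_rpow_of_exponent_ge h0 h hθ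
      rw [Real.rpow_one] at this
      linarith
  · have := Real.one_le_rpow h hθ0
    linarith

/-- Regularity `θ` in space costs `θ` powers of the frequency. With $b=|\alpha|+\theta$, the
condition $H(2b+d)<1$ reads $\theta<\frac12(\frac1H-2|\alpha|-d)$. -/
lemma norm_kernel_sub_shift_le {θ ε : ℝ} (hα : ∀ l, 0 ≤ α l) (hε : 0 < ε) (hθ0 : 0 ≤ θ)
    (hθ : θ ≤ 1) (x x' y : EuclideanSpace ℝ (Fin d)) :
    ‖(kernel s α ε x - kernel s α ε x') y‖ ≤
      2 * ‖x - x'‖ ^ θ * (1 + ‖y‖ ^ (∑ l, α l + θ)) := by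
  have ha : 0 ≤ ∑ l, α l := Finset.sum_nonneg fun l _ ↦ hα l
  have e : (kernel s α ε x - kernel s α ε x') y = ((1 / (2 * Real.pi) ^ d : ℝ) : ℂ) *
      (symbol s α y * (Complex.exp (((inner ℝ y x : ℝ) : ℂ) * Complex.I) -
        Complex.exp (((inner ℝ y x' : ℝ) : ℂ) * Complex.I)) *
      ((Real.exp (-(ε / 2) * ‖y‖ ^ 2) : ℝ) : ℂ)) := by
    simp only [Pi.sub_apply, kernel]
    ring
  rw [e, norm_mul, norm_mul, norm_mul, Complex.norm_real (Real.exp _),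
    Real.norm_of_nonneg (Real.exp_pos _).le]
  refine (mul_le_of_le_one_left (by positivity) (norm_kernel_const_le d)).trans ?_
  have h1 : Real.exp (-(ε / 2) * ‖y‖ ^ 2) ≤ 1 := by
    rw [Real.exp_le_one_iff, neg_mul]
    simp only [Left.neg_nonpos_iff]
    positivity
  refine (mul_le_of_le_one_right (by positivity) h1).trans ?_
  have h2 : |(inner ℝ y x : ℝ) - inner ℝ y x'| ≤ ‖y‖ * ‖x - x'‖ := by
    rw [← inner_sub_right]; exact abs_real_inner_le_norm _ _
  calc _ ≤ ‖y‖ ^ (∑ l, α l) * (2 * (‖y‖ * ‖x - x'‖) ^ θ) := by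
        gcongr
        · exact norm_symbol_le hα y
        · exact (norm_exp_sub_exp_le hθ0 hθ).trans (by gcongr)
    _ = 2 * ‖x - x'‖ ^ θ * ‖y‖ ^ (∑ l, α l + θ) := by
        rw [Real.mul_rpow (norm_nonneg _) (norm_nonneg _),
          Real.rpow_add_of_nonneg (norm_nonneg y) ha hθ0]
        ring
    _ ≤ _ := by gcongr; linarith

lemma norm_kernel_sub_order_le {β : Fin d → ℝ} {ε : ℝ} (hε : 0 < ε)
    (x y : EuclideanSpace ℝ (Fin d)) :
    ‖(kernel s β ε x - kernel s α ε x) y‖ ≤ ‖symbol s β y - symbol s α y‖ := by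
  have e : (kernel s β ε x - kernel s α ε x) y = ((1 / (2 * Real.pi) ^ d : ℝ) : ℂ) *
      ((symbol s β y - symbol s α y) * Complex.exp (((inner ℝ y x : ℝ) : ℂ) * Complex.I) *
      ((Real.exp (-(ε / 2) * ‖y‖ ^ 2) : ℝ) : ℂ)) := by
    simp only [Pi.sub_apply, kernel]
    ring
  rw [e, norm_mul, norm_mul, norm_mul_phase, Complex.norm_real (Real.exp _),
    Real.norm_of_nonneg (Real.exp_pos _).le]
  refine (mul_le_of_le_one_left (by positivity) (norm_kernel_const_le d)).trans ?_
  refine mul_le_of_le_one_right (by positivity) ?_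
  rw [Real.exp_le_one_iff, neg_mul]
  simp only [Left.neg_nonpos_iff]
  positivity

end symbol

section occupation

variable {Ω : Type*} [MeasurableSpace Ω] {P : Measure Ω} {H : ℝ} {d : ℕ}
  {X : ℝ≥0 → Ω → EuclideanSpace ℝ (Fin d)}

lemma integrable_mul_phase (hX : IsSLNDGaussian P H X) {G : EuclideanSpace ℝ (Fin d) → ℂ}
    (hGm : Measurable G) (hG : Integrable G) (a h : ℝ) (ω : Ω) :
    Integrable (fun z : ℝ × EuclideanSpace ℝ (Fin d) ↦ G z.2 *
      Complex.exp (((inner ℝ z.2 (X z.1.toNNReal ω) : ℝ) : ℂ) * Complex.I))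
      (stripMeasure d a h) := by
  refine (integrable_comp_snd_stripMeasure hG a h).mono ?_ (ae_of_all _ fun z ↦ ?_)
  · exact ((hGm.comp measurable_snd).mul
      ((measurable_phase hX).comp measurable_prodMk_left)).aestronglyMeasurable
  · rw [norm_mul_phase]

lemma occupation_sub (hX : IsSLNDGaussian P H X) {G G' : EuclideanSpace ℝ (Fin d) → ℂ}
    (hGm : Measurable G) (hG : Integrable G) (hGm' : Measurable G') (hG' : Integrable G')
    (a h : ℝ) : occupation X (G - G') a h = occupation X G a h - occupation X G' a h := by
  ext ω
  simp only [occupation, Pi.sub_apply, sub_mul]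
  exact integral_sub (integrable_mul_phase hX hGm hG a h ω) (integrable_mul_phase hX hGm' hG' a h ω)

lemma occupation_eq_intervalIntegral (hX : IsSLNDGaussian P H X)
    {G : EuclideanSpace ℝ (Fin d) → ℂ} (hGm : Measurable G) (hG : Integrable G) {a h : ℝ}
    (hh : 0 ≤ h) (ω : Ω) :
    occupation X G a h ω = ∫ t in a..a + h, ∫ y, G y *
      Complex.exp (((inner ℝ y (X t.toNNReal ω) : ℝ) : ℂ) * Complex.I) := by
  rw [occupation, intervalIntegral.integral_of_le (by linarith)]
  exact integral_prod _ (integrable_mul_phase hX hGm hG a h ω)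

lemma intervalIntegrable_integral_mul_phase (hX : IsSLNDGaussian P H X)
    {G : EuclideanSpace ℝ (Fin d) → ℂ} (hGm : Measurable G) (hG : Integrable G) {a h : ℝ}
    (hh : 0 ≤ h) (ω : Ω) :
    IntervalIntegrable (fun t : ℝ ↦ ∫ y, G y *
      Complex.exp (((inner ℝ y (X t.toNNReal ω) : ℝ) : ℂ) * Complex.I)) volume a (a + h) := by
  rw [intervalIntegrable_iff_integrableOn_Ioc_of_le (by linarith)]
  exact (integrable_mul_phase hX hGm hG a h ω).integral_prod_left

lemma occupation_sub_occupation (hX : IsSLNDGaussian P H X) {G : EuclideanSpace ℝ (Fin d) → ℂ}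
    (hGm : Measurable G) (hG : Integrable G) {a h : ℝ} (ha : 0 ≤ a) (hh : 0 ≤ h) :
    occupation X G 0 (a + h) - occupation X G 0 a = occupation X G a h := by
  ext ω
  rw [Pi.sub_apply, occupation_eq_intervalIntegral hX hGm hG (by linarith),
    occupation_eq_intervalIntegral hX hGm hG ha, occupation_eq_intervalIntegral hX hGm hG hh,
    zero_add, zero_add]
  have h1 := intervalIntegrable_integral_mul_phase hX hGm hG (a := 0) ha ω
  rw [zero_add] at h1
  rw [← intervalIntegral.integral_add_adjacent_intervals h1
    (intervalIntegrable_integral_mul_phase hX hGm hG hh ω), add_sub_cancel_left]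

lemma approxDeriv_eq_occupation (hX : IsSLNDGaussian P H X) {s : ℝ} {α : Fin d → ℝ}
    (hα : ∀ l, 0 ≤ α l) {ε : ℝ} (hε : 0 < ε) (T : ℝ≥0) (x : EuclideanSpace ℝ (Fin d)) :
    approxDeriv X s α ε T x = occupation X (kernel s α ε x) 0 T := by
  ext ω
  rw [occupation_eq_intervalIntegral hX (measurable_kernel s α ε x) (integrable_kernel hα hε x)
    T.coe_nonneg, zero_add, approxDeriv]
  congr 1
  ext t
  rw [heatKernelDeriv, ← integral_const_mul]
  refine integral_congr_ae (ae_of_all _ fun y ↦ ?_)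
  simp only [kernel, symbol, inner_add_right]
  push_cast
  rw [add_mul, Complex.exp_add]
  ring

lemma memLp_approxDeriv [IsProbabilityMeasure P] (hX : IsSLNDGaussian P H X) {s : ℝ}
    {α : Fin d → ℝ} (hα : ∀ l, 0 ≤ α l) {ε : ℝ} (hε : 0 < ε) (T : ℝ≥0)
    (x : EuclideanSpace ℝ (Fin d)) (p : ℝ≥0∞) : MemLp (approxDeriv X s α ε T x) p P := by
  rw [approxDeriv_eq_occupation hX hα hε]
  exact MemLp.of_bound (measurable_occupation hX (measurable_kernel s α ε x) 0 T).aestronglyMeasurable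
    _ (ae_of_all _ fun ω ↦ norm_occupation_le X _ 0 T ω)

end occupation

end FracLocalTime

/-! ### Existence of the derivatives and Hölder regularity. -/

namespace FracLocalTime

variable {Ω : Type*} [MeasurableSpace Ω] {P : Measure Ω} {H : ℝ} {d : ℕ}
  {X : ℝ≥0 → Ω → EuclideanSpace ℝ (Fin d)}

/-- The slack is `4 * δ` because $b=|\alpha|+2\delta$ enters the integrability condition doubled. -/
lemma exists_pos_exponent {H c : ℝ} (hH : 0 < H) (hc : H * c < 1) :
    ∃ δ : ℝ, 0 < δ ∧ δ ≤ 1 ∧ H * (c + 4 * δ) < 1 := by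
  refine ⟨min 1 ((1 - H * c) / (8 * H)), lt_min one_pos (by
    have : 0 < 1 - H * c := by linarith
    positivity), min_le_left _ _, ?_⟩
  have h1 : min 1 ((1 - H * c) / (8 * H)) * (8 * H) ≤ 1 - H * c := by
    rw [← le_div_iff₀ (by positivity)]; exact min_le_right _ _
  nlinarith

/-- `δ` is chosen before the moment order, so a single rate holds for all even moments. -/
lemma exists_eLpNorm_approxDeriv_sub_le [IsProbabilityMeasure P] (hX : IsSLNDGaussian P H X)
    (hH : 0 < H) (s : ℝ) {α : Fin d → ℝ} (hα : α ∈ admissible H d) (T : ℝ≥0)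
    (x : EuclideanSpace ℝ (Fin d)) :
    ∃ δ : ℝ, 0 < δ ∧ ∀ m : ℕ, m ≠ 0 → ∃ C : ℝ, 0 < C ∧ ∀ ε ε' η : ℝ, 0 < ε → 0 < ε' → ε ≤ η →
      ε' ≤ η → eLpNorm (approxDeriv X s α ε T x - approxDeriv X s α ε' T x) (m + m : ℕ) P ≤
        ENNReal.ofReal (C * η ^ δ) := by
  obtain ⟨hα0, hα1⟩ := hα
  obtain ⟨δ, hδ0, hδ1, hδ⟩ := exists_pos_exponent hH hα1
  have ha : 0 ≤ ∑ l, α l := Finset.sum_nonneg fun l _ ↦ hα0 l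
  refine ⟨δ, hδ0, fun m hm ↦ ?_⟩
  obtain ⟨C, hC, -, h⟩ := exists_eLpNorm_occupation_le hX hH (b := ∑ l, α l + 2 * δ)
    (R := T + 1) (by positivity) (by positivity) (by
      rw [show 2 * (∑ l, α l + 2 * δ) + d = 2 * (∑ l, α l) + d + 4 * δ by ring]; exact hδ) hm
  refine ⟨C * (T : ℝ) ^ (1 - H * (∑ l, α l + 2 * δ + d)) + 1, by positivity,
    fun ε ε' η hε hε' hεη hεη' ↦ ?_⟩
  have hη : 0 < η := hε.trans_le hεη
  rw [approxDeriv_eq_occupation hX hα0 hε, approxDeriv_eq_occupation hX hα0 hε',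
    ← occupation_sub hX (measurable_kernel ..) (integrable_kernel hα0 hε x)
      (measurable_kernel ..) (integrable_kernel hα0 hε' x)]
  refine (h 0 T le_rfl T.coe_nonneg (by linarith) _
    ((measurable_kernel ..).sub (measurable_kernel ..))
    ((integrable_kernel hα0 hε x).sub (integrable_kernel hα0 hε' x)) (η ^ δ) (by positivity)
    (norm_kernel_sub_kernel_le hα0 hε hε' hεη hεη' hδ0.le hδ1 x)).trans ?_
  refine ENNReal.ofReal_le_ofReal ?_
  rw [mul_comm]
  gcongr
  linarith

/-- An almost sure limit along one sequence of `ε` is constructed from the $L^2$ bound; Fatou then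
gives convergence to this same variable in every even moment, hence in every `p`. -/
theorem exists_isLocalTimeDeriv [IsProbabilityMeasure P] (hX : IsSLNDGaussian P H X)
    (hH : 0 < H) (s : ℝ) {α : Fin d → ℝ} (hα : α ∈ admissible H d) (T : ℝ≥0)
    (x : EuclideanSpace ℝ (Fin d)) :
    ∃ Z : Ω → ℂ, Measurable Z ∧ ∀ p : ℝ≥0∞, 1 ≤ p → p ≠ ∞ → IsLocalTimeDeriv P X p s α T x Z := by
  obtain ⟨δ, hδ0, hδ⟩ := exists_eLpNorm_approxDeriv_sub_le hX hH s hα T x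
  have hA : ∀ ε : ℝ, 0 < ε → ∀ p, MemLp (approxDeriv X s α ε T x) p P :=
    fun ε hε p ↦ memLp_approxDeriv hX hα.1 hε T x p
  -- Chosen so that `e k ^ δ` is $2^{-k}$ and the increments are summable.
  let e : ℕ → ℝ := fun k ↦ ((1 / 2 : ℝ) ^ k) ^ (1 / δ)
  have he0 : ∀ k, 0 < e k := fun k ↦ by positivity
  have heδ : ∀ k, e k ^ δ = (1 / 2) ^ k := fun k ↦ by
    rw [← Real.rpow_mul (by positivity), one_div_mul_cancel hδ0.ne', Real.rpow_one]
  have hanti : ∀ N k, N ≤ k → e k ≤ e N := fun N k h ↦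
    Real.rpow_le_rpow (by positivity) (pow_le_pow_of_le_one (by norm_num) (by norm_num) h)
      (by positivity)
  have he_lim : Tendsto e atTop (𝓝 0) := by
    have h1 : Tendsto (fun k : ℕ ↦ (1 / 2 : ℝ) ^ k) atTop (𝓝 0) :=
      tendsto_pow_atTop_nhds_zero_of_lt_one (by norm_num) (by norm_num)
    have := h1.rpow_const (p := 1 / δ) (Or.inr (by positivity))
    rwa [Real.zero_rpow (by positivity)] at this
  obtain ⟨C, hC, h2⟩ := hδ 1 one_ne_zero
  have hcauchy := Lp.ae_tendsto_of_cauchy_eLpNorm (μ := P) (p := 2)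
    (f := fun k ↦ approxDeriv X s α (e k) T x) (fun k ↦ (hA _ (he0 k) 2).1) (by norm_num)
    (B := fun k ↦ ENNReal.ofReal ((C + 1) * (1 / 2) ^ k))
    (Summable.tsum_ofReal_ne_top ((summable_geometric_of_lt_one (by norm_num)
      (by norm_num)).mul_left _)) (fun N k j hk hj ↦ by
        have := h2 (e k) (e j) (e N) (he0 k) (he0 j) (hanti N k hk) (hanti N j hj)
        rw [heδ] at this
        refine lt_of_le_of_lt (by exact_mod_cast this) ?_
        rw [ENNReal.ofReal_lt_ofReal_iff (by positivity)]
        have : (0 : ℝ) < (1 / 2) ^ N := by positivity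
        linarith)
  obtain ⟨Z, hZm, hZ⟩ := exists_stronglyMeasurable_limit_of_tendsto_ae
    (fun k ↦ (hA _ (he0 k) 2).1) hcauchy
  refine ⟨Z, hZm.measurable, fun p hp hp' ↦ ?_⟩
  have hkey : ∀ m : ℕ, m ≠ 0 → ∃ C : ℝ, ∀ ε : ℝ, 0 < ε →
      eLpNorm (approxDeriv X s α ε T x - Z) (m + m : ℕ) P ≤ ENNReal.ofReal (C * ε ^ δ) := by
    intro m hm
    obtain ⟨C, hC, h⟩ := hδ m hm
    refine ⟨C, fun ε hε ↦ ?_⟩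
    have hlim : ∀ᵐ ω ∂P, Tendsto (fun k ↦
        (approxDeriv X s α ε T x - approxDeriv X s α (e k) T x) ω) atTop
        (𝓝 ((approxDeriv X s α ε T x - Z) ω)) := by
      filter_upwards [hZ] with ω hω
      exact tendsto_const_nhds.sub hω
    refine (Lp.eLpNorm_lim_le_liminf_eLpNorm (fun k ↦ ((hA ε hε 2).1.sub (hA _ (he0 k) 2).1)) _
      hlim).trans ?_
    refine liminf_le_of_le (by isBoundedDefault) fun c hc ↦ ?_
    obtain ⟨k, hk1, hk2⟩ := (hc.and (he_lim.eventually_le_const hε)).exists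
    exact hk1.trans (h ε (e k) ε hε (he0 k) le_rfl hk2)
  obtain ⟨N, hN⟩ := ENNReal.exists_nat_gt hp'
  have hpN : p ≤ ((N + 1 + (N + 1) : ℕ) : ℝ≥0∞) :=
    hN.le.trans (by exact_mod_cast (by omega : N ≤ N + 1 + (N + 1)))
  obtain ⟨C', h'⟩ := hkey (N + 1) (by omega)
  have hbd : ∀ ε : ℝ, 0 < ε → eLpNorm (approxDeriv X s α ε T x - Z) p P ≤
      ENNReal.ofReal (C' * ε ^ δ) := fun ε hε ↦
    (eLpNorm_le_eLpNorm_of_exponent_le hpN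
      ((hA ε hε 2).1.sub hZm.aestronglyMeasurable)).trans (h' ε hε)
  refine ⟨fun ε hε ↦ hA ε hε p, ?_, ?_⟩
  · have h1 : MemLp (approxDeriv X s α 1 T x - Z) p P :=
      ⟨(hA 1 one_pos 2).1.sub hZm.aestronglyMeasurable,
        (hbd 1 one_pos).trans_lt ENNReal.ofReal_lt_top⟩
    have := (hA 1 one_pos p).sub h1
    rwa [sub_sub_cancel] at this
  · have hto : Tendsto (fun ε : ℝ ↦ ENNReal.ofReal (C' * ε ^ δ)) (𝓝[>] 0) (𝓝 0) := by
      have h1 : Tendsto (fun ε : ℝ ↦ ε) (𝓝[>] 0) (𝓝 0) := nhdsWithin_le_nhds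
      have h2 := (h1.rpow_const (p := δ) (Or.inr hδ0.le)).const_mul C'
      rw [Real.zero_rpow hδ0.ne', mul_zero] at h2
      simpa using ENNReal.tendsto_ofReal h2
    refine tendsto_of_tendsto_of_tendsto_of_le_of_le' tendsto_const_nhds hto
      (Eventually.of_forall fun _ ↦ zero_le) ?_
    filter_upwards [self_mem_nhdsWithin] with ε hε using hbd ε hε

lemma eLpNorm_sub_le_of_tendsto {F G : ℝ → Ω → ℂ} {Z W : Ω → ℂ} {p B : ℝ≥0∞} (hp : 1 ≤ p)
    (hF : ∀ ε : ℝ, 0 < ε → MemLp (F ε) p P) (hG : ∀ ε : ℝ, 0 < ε → MemLp (G ε) p P)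
    (hZ : MemLp Z p P) (hW : MemLp W p P)
    (hFZ : Tendsto (fun ε ↦ eLpNorm (F ε - Z) p P) (𝓝[>] 0) (𝓝 0))
    (hGW : Tendsto (fun ε ↦ eLpNorm (G ε - W) p P) (𝓝[>] 0) (𝓝 0))
    (hB : ∀ ε : ℝ, 0 < ε → eLpNorm (F ε - G ε) p P ≤ B) : eLpNorm (Z - W) p P ≤ B := by
  have h := (hFZ.add hGW).add_const B
  rw [zero_add, zero_add] at h
  refine ge_of_tendsto h ?_
  filter_upwards [self_mem_nhdsWithin] with ε hε
  have e : Z - W = (-(F ε - Z) + (G ε - W)) + (F ε - G ε) := by abel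
  have m1 := ((hF ε hε).sub hZ).1
  have m2 := ((hG ε hε).sub hW).1
  have m3 := ((hF ε hε).sub (hG ε hε)).1
  rw [e]
  refine (eLpNorm_add_le (m1.neg.add m2) m3 hp).trans ?_
  refine add_le_add ((eLpNorm_add_le m1.neg m2 hp).trans ?_) (hB ε hε)
  rw [eLpNorm_neg]

/-- Transfers bounds uniform in `ε` from the approximations to the derivatives; regularity in time,
space and order, and uniqueness, all pass through it. -/
lemma IsLocalTimeDeriv.eLpNorm_sub_le {p B : ℝ≥0∞} {s : ℝ} {α β : Fin d → ℝ} {S T : ℝ≥0}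
    {x y : EuclideanSpace ℝ (Fin d)} {Z W : Ω → ℂ} (hp : 1 ≤ p)
    (hZ : IsLocalTimeDeriv P X p s α S x Z) (hW : IsLocalTimeDeriv P X p s β T y W)
    (hB : ∀ ε : ℝ, 0 < ε →
      eLpNorm (approxDeriv X s α ε S x - approxDeriv X s β ε T y) p P ≤ B) :
    eLpNorm (Z - W) p P ≤ B :=
  eLpNorm_sub_le_of_tendsto hp hZ.1 hW.1 hZ.2.1 hW.2.1 hZ.2.2 hW.2.2 hB

lemma IsLocalTimeDeriv.ae_eq {p : ℝ≥0∞} {s : ℝ} {α : Fin d → ℝ} {T : ℝ≥0}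
    {x : EuclideanSpace ℝ (Fin d)} {Z W : Ω → ℂ} (hp : 1 ≤ p)
    (hZ : IsLocalTimeDeriv P X p s α T x Z) (hW : IsLocalTimeDeriv P X p s α T x W) :
    Z =ᵐ[P] W := by
  have h := hZ.eLpNorm_sub_le hp hW (B := 0) fun ε _ ↦ by simp
  have := (eLpNorm_eq_zero_iff (hZ.2.1.sub hW.2.1).1 (by positivity)).1 (le_antisymm h zero_le)
  filter_upwards [this] with ω hω
  exact sub_eq_zero.1 hω

lemma lintegral_enorm_pow_le_of_eLpNorm_le {f : Ω → ℂ} {n : ℕ} (hn : n ≠ 0) {B : ℝ≥0∞}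
    (h : eLpNorm f n P ≤ B) : ∫⁻ ω, ‖f ω‖ₑ ^ n ∂P ≤ B ^ n := by
  have := eLpNorm_nnreal_pow_eq_lintegral (f := f) (μ := P) (p := (n : ℝ≥0)) (by simpa using hn)
  simp only [NNReal.coe_natCast, ENNReal.rpow_natCast, ENNReal.coe_natCast] at this
  rw [← this]
  gcongr

theorem exists_holder_time [IsProbabilityMeasure P] (hX : IsSLNDGaussian P H X)
    (hH : 0 < H) (s : ℝ) {α : Fin d → ℝ} (hα : α ∈ admissible H d)
    (x : EuclideanSpace ℝ (Fin d)) {L : ℝ≥0 → Ω → ℂ} (hLm : ∀ T, Measurable (L T))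
    (hL : ∀ T p, 1 ≤ p → p ≠ ∞ → IsLocalTimeDeriv P X p s α T x (L T)) :
    ∃ Z : ℝ≥0 → Ω → ℂ, (∀ T, Measurable (Z T) ∧ Z T =ᵐ[P] L T) ∧
      ∀ ω, ∀ θ : ℝ≥0, 0 < θ → (θ : ℝ) < 1 - H * ((∑ l, α l) + d) →
        LocallyHolder θ fun T ↦ Z T ω := by
  obtain ⟨hα0, hα1⟩ := hα
  have ha : 0 ≤ ∑ l, α l := Finset.sum_nonneg fun l _ ↦ hα0 l
  have hθ₀ : 0 < 1 - H * ((∑ l, α l) + d) := by nlinarith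
  obtain ⟨Z, hZ, hZθ⟩ := exists_locallyHolder_modification (P := P) (m := 1)
    (Y := fun v ↦ L (v 0).toNNReal) (fun v ↦ hLm _) hθ₀ (fun θ hθ hθ' R N ↦ by
      obtain ⟨δ, hδ0, -, hδ⟩ := exists_pos_exponent hH hα1
      obtain ⟨δ', hδ'0, -, hδ'⟩ := exists_pos_exponent (c := ((∑ l, α l) + d) + θ / H) hH (by
        rw [mul_add, mul_div_cancel₀ _ hH.ne']; linarith)
      -- The weight needs `b > 0` even for `α = 0`. The slack `δ` preserves integrability of the gap
      -- kernel, and `δ'` keeps `θ` below the exponent `1 - H * (b + d)`.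
      set b := ∑ l, α l + min δ δ' with hb
      have hbpos : 0 < min δ δ' := lt_min hδ0 hδ'0
      have h1 : H * (2 * b + d) < 1 := by
        refine lt_of_le_of_lt ?_ hδ
        have := min_le_left δ δ'
        exact mul_le_mul_of_nonneg_left (by linarith) hH.le
      have h2 : θ ≤ 1 - H * (b + d) := by
        have e : H * (∑ l, α l + d + θ / H + 4 * δ') = H * (∑ l, α l + d + 4 * δ') + θ := by
          field_simp
          ring
        have : H * (b + d) ≤ H * (∑ l, α l + d + 4 * δ') := by
          have := min_le_right δ δ'
          exact mul_le_mul_of_nonneg_left (by linarith) hH.le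
        linarith
      obtain ⟨C, hC, -, hbd⟩ := exists_eLpNorm_occupation_le hX hH (b := b) (R := R + 1)
        (by positivity) (by positivity) h1 (m := N + 1) (by omega)
      have main : ∀ S h : ℝ≥0, h ≤ R + 1 → (h : ℝ) ≤ 1 →
          eLpNorm (L (S + h) - L S) (N + 1 + (N + 1) : ℕ) P ≤
            ENNReal.ofReal (C * (h : ℝ) ^ θ) := by
        intro S h hhR hh1
        have hn : (1 : ℝ≥0∞) ≤ ((N + 1 + (N + 1) : ℕ) : ℝ≥0∞) := by
          exact_mod_cast (by omega : 1 ≤ N + 1 + (N + 1))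
        refine (hL (S + h) _ hn (by finiteness)).eLpNorm_sub_le hn (hL S _ hn (by finiteness))
          fun ε hε ↦ ?_
        rw [approxDeriv_eq_occupation hX hα0 hε, approxDeriv_eq_occupation hX hα0 hε, NNReal.coe_add,
          occupation_sub_occupation hX (measurable_kernel ..) (integrable_kernel hα0 hε x)
            S.coe_nonneg h.coe_nonneg]
        refine (hbd S h S.coe_nonneg h.coe_nonneg (by exact_mod_cast hhR) _
          (measurable_kernel ..) (integrable_kernel hα0 hε x) 1 zero_le_one
          (norm_kernel_le_one_add hα0 hε (by linarith) x)).trans ?_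
        refine ENNReal.ofReal_le_ofReal ?_
        rw [one_mul]
        gcongr 1
        rcases h.coe_nonneg.eq_or_lt with h0 | h0
        · rw [← h0, Real.zero_rpow hθ.ne', Real.zero_rpow (by linarith)]
        · exact Real.rpow_le_rpow_of_exponent_ge h0 hh1 h2
      have main' : ∀ S T : ℝ≥0, S ≤ T → (T : ℝ) - S ≤ 1 →
          ∫⁻ ω, ‖L T ω - L S ω‖ₑ ^ (N + 1 + (N + 1)) ∂P ≤
            ENNReal.ofReal (C * |(T : ℝ) - S| ^ θ) ^ (N + 1 + (N + 1)) := by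
        intro S T hST h1
        refine lintegral_enorm_pow_le_of_eLpNorm_le (f := L T - L S) (by omega) ?_
        have hle : ((T - S : ℝ≥0) : ℝ) ≤ 1 := by rwa [NNReal.coe_sub hST]
        have := main S (T - S) (by
          rw [← NNReal.coe_le_coe]; push_cast
          have : (0 : ℝ) ≤ R := Nat.cast_nonneg R
          linarith) hle
        rw [add_tsub_cancel_of_le hST, NNReal.coe_sub hST] at this
        rwa [abs_of_nonneg (sub_nonneg.2 (by exact_mod_cast hST))]
      refine ⟨N + 1 + (N + 1), by omega, C, hC.le, fun u v _ _ huv ↦ ?_⟩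
      have hTd : |((u 0).toNNReal : ℝ) - (v 0).toNNReal| ≤ dist u v := by
        refine le_trans ?_ (dist_le_pi_dist u v 0)
        rw [Real.dist_eq, Real.coe_toNNReal', Real.coe_toNNReal']
        exact abs_max_sub_max_le_abs _ _ _
      have hgoal : ∫⁻ ω, ‖L (u 0).toNNReal ω - L (v 0).toNNReal ω‖ₑ ^ (N + 1 + (N + 1)) ∂P ≤
          ENNReal.ofReal (C * |((u 0).toNNReal : ℝ) - (v 0).toNNReal| ^ θ) ^
            (N + 1 + (N + 1)) := by
        rcases le_total (u 0).toNNReal (v 0).toNNReal with h | h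
        · have := main' _ _ h ((le_abs_self _).trans ((abs_sub_comm _ _).trans_le
            (hTd.trans huv)))
          rw [abs_sub_comm]
          simpa only [enorm_sub_rev] using this
        · exact main' _ _ h ((le_abs_self _).trans (hTd.trans huv))
      refine hgoal.trans ?_
      gcongr)
  refine ⟨fun T ↦ Z fun _ ↦ T, fun T ↦ ⟨(hZ _).1, ?_⟩, fun ω θ hθ hθ' ↦ ?_⟩
  · have := (hZ fun _ ↦ (T : ℝ)).2
    simpa using this
  · have hlip : LipschitzWith 1 fun (T : ℝ≥0) (_ : Fin 1) ↦ (T : ℝ) :=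
      LipschitzWith.of_dist_le_mul fun S T ↦ by
        rw [NNReal.coe_one, one_mul]
        exact (dist_pi_le_iff dist_nonneg).2 fun _ ↦ le_rfl
    exact (hZθ ω θ hθ hθ').comp_lipschitz hlip

theorem exists_holder_space [IsProbabilityMeasure P] (hX : IsSLNDGaussian P H X)
    (hH : 0 < H) (s : ℝ) {α : Fin d → ℝ} (hα : α ∈ admissible H d) (T : ℝ≥0)
    {L : EuclideanSpace ℝ (Fin d) → Ω → ℂ} (hLm : ∀ x, Measurable (L x))
    (hL : ∀ x p, 1 ≤ p → p ≠ ∞ → IsLocalTimeDeriv P X p s α T x (L x)) :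
    ∃ Z : EuclideanSpace ℝ (Fin d) → Ω → ℂ, (∀ x, Measurable (Z x) ∧ Z x =ᵐ[P] L x) ∧
      ∀ ω, ∀ θ : ℝ≥0, 0 < θ → (θ : ℝ) < min 1 (1 / 2 * (1 / H - 2 * (∑ l, α l) - d)) →
        LocallyHolder θ fun x ↦ Z x ω := by
  obtain ⟨hα0, hα1⟩ := hα
  have ha : 0 ≤ ∑ l, α l := Finset.sum_nonneg fun l _ ↦ hα0 l
  have hθ₀ : 0 < min 1 (1 / 2 * (1 / H - 2 * (∑ l, α l) - d)) := by
    refine lt_min one_pos ?_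
    have : 2 * (∑ l, α l) + d < 1 / H := by rwa [lt_div_iff₀ hH, mul_comm]
    linarith
  -- Kolmogorov's theorem is stated for the sup norm; `K` compares it with the Euclidean norm.
  obtain ⟨K, hK⟩ : ∃ K : ℝ≥0, LipschitzWith K fun v : Fin d → ℝ ↦
      (WithLp.toLp 2 v : EuclideanSpace ℝ (Fin d)) :=
    ⟨_, (EuclideanSpace.equiv (Fin d) ℝ).symm.lipschitz⟩
  obtain ⟨Z, hZ, hZθ⟩ := exists_locallyHolder_modification (P := P) (m := d)
    (Y := fun v ↦ L (WithLp.toLp 2 v)) (fun v ↦ hLm _) hθ₀ (fun θ hθ hθ' R N ↦ by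
      have hθ1 : θ ≤ 1 := (hθ'.trans_le (min_le_left _ _)).le
      have h1 : H * (2 * (∑ l, α l + θ) + d) < 1 := by
        have := hθ'.trans_le (min_le_right _ _)
        rw [mul_comm, ← lt_div_iff₀ hH]
        linarith
      obtain ⟨C, hC, -, hbd⟩ := exists_eLpNorm_occupation_le hX hH (b := ∑ l, α l + θ)
        (R := T + 1) (by positivity) (by positivity) h1 (m := N + 1) (by omega)
      refine ⟨N + 1 + (N + 1), by omega,
        2 * (K : ℝ) ^ θ * (C * (T : ℝ) ^ (1 - H * (∑ l, α l + θ + d))), by positivity,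
        fun u v _ _ _ ↦ ?_⟩
      refine lintegral_enorm_pow_le_of_eLpNorm_le
        (f := L (WithLp.toLp 2 u) - L (WithLp.toLp 2 v)) (by omega) ?_
      have hn : (1 : ℝ≥0∞) ≤ ((N + 1 + (N + 1) : ℕ) : ℝ≥0∞) := by
        exact_mod_cast (by omega : 1 ≤ N + 1 + (N + 1))
      refine (hL _ _ hn (by finiteness)).eLpNorm_sub_le hn (hL _ _ hn (by finiteness))
        fun ε hε ↦ ?_
      rw [approxDeriv_eq_occupation hX hα0 hε, approxDeriv_eq_occupation hX hα0 hε,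
        ← occupation_sub hX (measurable_kernel ..) (integrable_kernel hα0 hε _)
          (measurable_kernel ..) (integrable_kernel hα0 hε _)]
      refine (hbd 0 T le_rfl T.coe_nonneg (by linarith) _
        ((measurable_kernel ..).sub (measurable_kernel ..))
        ((integrable_kernel hα0 hε _).sub (integrable_kernel hα0 hε _)) _ (by positivity)
        (norm_kernel_sub_shift_le hα0 hε hθ.le hθ1 _ _)).trans ?_
      refine ENNReal.ofReal_le_ofReal ?_
      have hd := hK.dist_le_mul u v
      rw [dist_eq_norm] at hd
      calc _ ≤ 2 * (K * dist u v) ^ θ * (C * (T : ℝ) ^ (1 - H * (∑ l, α l + θ + d))) := by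
            gcongr
        _ = _ := by rw [Real.mul_rpow K.coe_nonneg dist_nonneg]; ring)
  refine ⟨fun x ↦ Z (WithLp.ofLp x), fun x ↦ ⟨(hZ _).1, (hZ _).2⟩, fun ω θ hθ hθ' ↦ ?_⟩
  exact (hZθ ω θ hθ hθ').comp_lipschitz
    (EuclideanSpace.equiv (Fin d) ℝ).lipschitz

end FracLocalTime

/-! ### Continuity in the order of the derivative. -/

namespace FracLocalTime

/-- Vanishing coordinates are excluded since $a\mapsto0^a$ jumps at $a=0$; they form a null set of
frequencies. -/
lemma continuous_symbol_order {d : ℕ} (s : ℝ) {y : EuclideanSpace ℝ (Fin d)} (hy : ∀ l, y l ≠ 0) :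
    Continuous fun α : Fin d → ℝ ↦ symbol s α y := by
  unfold symbol
  refine continuous_finsetProd _ fun l _ ↦ ?_
  have h : Continuous fun α : Fin d → ℝ ↦ |y l| ^ α l :=
    (Real.continuous_const_rpow (abs_pos.2 (hy l)).ne').comp (continuous_apply l)
  fun_prop

lemma ae_forall_coord_ne_zero (d : ℕ) :
    ∀ᵐ y : EuclideanSpace ℝ (Fin d), ∀ l, y l ≠ 0 := by
  rw [ae_all_iff]
  intro l
  have h : ∀ᵐ v : Fin d → ℝ, v l ≠ 0 :=
    (Measure.tendsto_eval_ae_ae (μ := fun _ : Fin d ↦ (volume : Measure ℝ))).eventually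
      (compl_mem_ae_iff.2 (measure_singleton 0))
  exact (PiLp.volume_preserving_ofLp (Fin d)).quasiMeasurePreserving.ae h

lemma ae_forall_coord_ne_zero_pi (d n : ℕ) (a h : ℝ) :
    ∀ᵐ z ∂Measure.pi fun _ : Fin n ↦ stripMeasure d a h, ∀ j l, (z j).2 l ≠ 0 := by
  rw [ae_all_iff]
  intro j
  have h1 : ∀ᵐ z ∂stripMeasure d a h, ∀ l, z.2 l ≠ 0 :=
    Measure.quasiMeasurePreserving_snd.ae (ae_forall_coord_ne_zero d)
  exact (Measure.tendsto_eval_ae_ae (μ := fun _ : Fin n ↦ stripMeasure d a h)).eventually h1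

/-- An even bound for the change of the symbol with the order. -/
noncomputable def symbolGap {d : ℕ} (s : ℝ) (α β : Fin d → ℝ) (y : EuclideanSpace ℝ (Fin d)) : ℝ :=
  ‖symbol s β y - symbol s α y‖ + ‖symbol s β (-y) - symbol s α (-y)‖

section symbolGap

variable {d : ℕ} {s : ℝ} {α : Fin d → ℝ}

lemma symbolGap_nonneg (β : Fin d → ℝ) (y : EuclideanSpace ℝ (Fin d)) : 0 ≤ symbolGap s α β y := by
  unfold symbolGap; positivity

lemma measurable_symbolGap (s : ℝ) (α β : Fin d → ℝ) : Measurable (symbolGap s α β) := by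
  unfold symbolGap
  have h1 := measurable_symbol s α
  have h2 := measurable_symbol s β
  fun_prop

lemma tendsto_symbolGap {y : EuclideanSpace ℝ (Fin d)} (hy : ∀ l, y l ≠ 0) :
    Tendsto (fun β ↦ symbolGap s α β y) (𝓝 α) (𝓝 0) := by
  have h1 := continuous_symbol_order s hy
  have h2 := continuous_symbol_order s (y := -y) fun l ↦ by simpa using hy l
  have : Continuous fun β ↦ symbolGap s α β y := by unfold symbolGap; fun_prop
  convert this.tendsto α using 2
  simp [symbolGap]

lemma symbolGap_le {β : Fin d → ℝ} {b : ℝ} (hα : ∀ l, 0 ≤ α l) (hβ : ∀ l, 0 ≤ β l)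
    (hαb : ∑ l, α l ≤ b) (hβb : ∑ l, β l ≤ b) (y : EuclideanSpace ℝ (Fin d)) :
    symbolGap s α β y ≤ 4 * (1 + ‖y‖ ^ b) := by
  have key : ∀ γ : Fin d → ℝ, (∀ l, 0 ≤ γ l) → ∑ l, γ l ≤ b → ∀ y : EuclideanSpace ℝ (Fin d),
      ‖symbol s γ y‖ ≤ 1 + ‖y‖ ^ b := fun γ hγ hγb y ↦
    (norm_symbol_le hγ y).trans
      (rpow_le_one_add_rpow (norm_nonneg y) (Finset.sum_nonneg fun l _ ↦ hγ l) hγb)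
  have h1 := norm_sub_le (symbol s β y) (symbol s α y)
  have h2 := norm_sub_le (symbol s β (-y)) (symbol s α (-y))
  have h3 := key α hα hαb (-y)
  have h4 := key β hβ hβb (-y)
  rw [norm_neg] at h3 h4
  unfold symbolGap
  linarith [key α hα hαb y, key β hβ hβb y]

end symbolGap

variable {Ω : Type*} [MeasurableSpace Ω] {P : Measure Ω} {H : ℝ} {d : ℕ}
  {X : ℝ≥0 → Ω → EuclideanSpace ℝ (Fin d)}

/-- Dominated convergence. Orders near `α` have total at most some $b>|\alpha|$ still satisfying
$H(2b+d)<1$, so the weight with exponent `b` is a common majorant. -/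
lemma tendsto_momentBound_symbolGap [IsProbabilityMeasure P] (hX : IsSLNDGaussian P H X)
    (hH : 0 < H) (s : ℝ) {α : Fin d → ℝ} (hα : α ∈ admissible H d) {R : ℝ} (hR : 0 < R)
    {m : ℕ} (hm : m ≠ 0) :
    Tendsto (fun β ↦ momentBound hX (fun (_ : Fin (m + m)) y ↦ ENNReal.ofReal (symbolGap s α β y))
      0 R) (𝓝[admissible H d] α) (𝓝 0) := by
  have ha : 0 ≤ ∑ l, α l := Finset.sum_nonneg fun l _ ↦ hα.1 l
  obtain ⟨δ, hδ0, -, hδ⟩ := exists_pos_exponent hH hα.2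
  obtain ⟨-, -, hfin, -⟩ := exists_eLpNorm_occupation_le hX hH (b := ∑ l, α l + 2 * δ) (R := R)
    (by positivity) hR (by
      rw [show 2 * (∑ l, α l + 2 * δ) + d = 2 * (∑ l, α l) + d + 4 * δ by ring]; exact hδ) hm
  set b := ∑ l, α l + 2 * δ with hb
  have hmeas := fun β ↦ measurable_symbolGap s α β
  have hgram : Measurable fun z : Fin (m + m) → ℝ × EuclideanSpace ℝ (Fin d) ↦
      gram hX.curve (fun j ↦ (z j).1) fun j ↦ (z j).2 :=
    (hX.measurable_gram_curve (m + m)).comp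
      (f := fun z : Fin (m + m) → ℝ × EuclideanSpace ℝ (Fin d) ↦
        (fun j ↦ (z j).1, fun j ↦ (z j).2)) (by fun_prop)
  have hev : ∀ᶠ β in 𝓝[admissible H d] α, ∑ l, β l ≤ b := by
    have : Continuous fun β : Fin d → ℝ ↦ ∑ l, β l := by fun_prop
    exact nhdsWithin_le_nhds ((this.tendsto α).eventually_le_const (by linarith))
  have key := tendsto_lintegral_filter_of_dominated_convergence
    (μ := Measure.pi fun _ : Fin (m + m) ↦ stripMeasure d 0 R)
    (l := 𝓝[admissible H d] α)
    (F := fun β z ↦ (∏ j, ENNReal.ofReal (symbolGap s α β (z j).2)) *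
      ENNReal.ofReal (Real.exp (-(1 / 2) * gram hX.curve (fun j ↦ (z j).1) fun j ↦ (z j).2)))
    (f := fun _ ↦ 0)
    (fun z ↦ 4 ^ (m + m) * ((∏ j, weight b (z j).2) *
      ENNReal.ofReal (Real.exp (-(1 / 2) * gram hX.curve (fun j ↦ (z j).1) fun j ↦ (z j).2))))
    (Eventually.of_forall fun β ↦ by
      have := hmeas β
      fun_prop) ?_ ?_ ?_
  · simpa [momentBound] using key
  · filter_upwards [hev, self_mem_nhdsWithin] with β hβ hβ'
    refine ae_of_all _ fun z ↦ ?_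
    rw [← mul_assoc]
    gcongr
    calc _ ≤ ∏ j, (4 * weight b (z j).2) := Finset.prod_le_prod' fun j _ ↦ by
          refine (ENNReal.ofReal_le_ofReal
            (symbolGap_le hα.1 hβ'.1 (by linarith) hβ (z j).2)).trans_eq ?_
          rw [ENNReal.ofReal_mul (by norm_num), weight]
          norm_num
      _ = _ := by
          rw [Finset.prod_mul_distrib, Finset.prod_const, Finset.card_univ, Fintype.card_fin]
  · rw [lintegral_const_mul' _ _ (by finiteness)]
    exact ENNReal.mul_ne_top (by finiteness) hfin
  · filter_upwards [ae_forall_coord_ne_zero_pi d (m + m) 0 R] with z hz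
    have h1 : Tendsto (fun β ↦ (∏ j, symbolGap s α β (z j).2) *
        Real.exp (-(1 / 2) * gram hX.curve (fun j ↦ (z j).1) fun j ↦ (z j).2))
        (𝓝[admissible H d] α) (𝓝 0) := by
      have := (tendsto_finsetProd (Finset.univ : Finset (Fin (m + m))) fun j _ ↦
        tendsto_symbolGap (s := s) (α := α) (hz j)).mul_const
          (Real.exp (-(1 / 2) * gram hX.curve (fun j ↦ (z j).1) fun j ↦ (z j).2))
      rw [Finset.prod_const, Finset.card_univ, Fintype.card_fin, zero_pow (by omega),
        zero_mul] at this
      exact this.mono_left nhdsWithin_le_nhds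
    have h2 := ENNReal.tendsto_ofReal h1
    rw [ENNReal.ofReal_zero] at h2
    refine h2.congr fun β ↦ ?_
    rw [ENNReal.ofReal_mul (Finset.prod_nonneg fun j _ ↦ symbolGap_nonneg _ _),
      ENNReal.ofReal_prod_of_nonneg fun j _ ↦ symbolGap_nonneg _ _]

theorem tendsto_eLpNorm_sub_order [IsProbabilityMeasure P] (hX : IsSLNDGaussian P H X)
    (hH : 0 < H) (s : ℝ) {α : Fin d → ℝ} (hα : α ∈ admissible H d) (T : ℝ≥0)
    (x : EuclideanSpace ℝ (Fin d)) {L : (Fin d → ℝ) → Ω → ℂ}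
    (hL : ∀ β ∈ admissible H d, ∀ p, 1 ≤ p → p ≠ ∞ → IsLocalTimeDeriv P X p s β T x (L β))
    {p : ℝ≥0∞} (hp : p ≠ ∞) :
    Tendsto (fun β ↦ eLpNorm (L β - L α) p P) (𝓝[admissible H d] α) (𝓝 0) := by
  obtain ⟨N, hN⟩ := ENNReal.exists_nat_gt hp
  set n := N + 1 + (N + 1) with hn
  have hpn : p ≤ (n : ℝ≥0∞) := hN.le.trans (by exact_mod_cast (by omega : N ≤ n))
  have h1n : (1 : ℝ≥0∞) ≤ (n : ℝ≥0∞) := by exact_mod_cast (by omega : 1 ≤ n)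
  have hn0 : n ≠ 0 := by omega
  obtain ⟨B, hB, hLB⟩ : ∃ B : (Fin d → ℝ) → ℝ≥0∞, Tendsto B (𝓝[admissible H d] α) (𝓝 0) ∧
      ∀ β ∈ admissible H d, ∀ ε : ℝ, 0 < ε →
        eLpNorm (approxDeriv X s β ε T x - approxDeriv X s α ε T x) n P ^ n ≤ B β := by
    -- The moment bound asks for a window of positive length; at `T = 0` all approximations vanish.
    rcases eq_zero_or_pos T with rfl | hT
    · refine ⟨0, tendsto_const_nhds, fun β _ ε _ ↦ ?_⟩
      have h0 : ∀ γ, approxDeriv X s γ ε 0 x = 0 := fun γ ↦ by ext ω; simp [approxDeriv]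
      simp [h0, hn0]
    · refine ⟨_, tendsto_momentBound_symbolGap hX hH s hα (R := T) hT (m := N + 1) (by omega),
        fun β hβ ε hε ↦ ?_⟩
      rw [approxDeriv_eq_occupation hX hα.1 hε, approxDeriv_eq_occupation hX hβ.1 hε,
        ← occupation_sub hX (measurable_kernel ..) (integrable_kernel hβ.1 hε x)
          (measurable_kernel ..) (integrable_kernel hα.1 hε x)]
      refine eLpNorm_occupation_pow_le hX ((measurable_kernel ..).sub (measurable_kernel ..))
        ((integrable_kernel hβ.1 hε x).sub (integrable_kernel hα.1 hε x)) (fun y ↦ ?_)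
        (fun y ↦ ?_) (by omega) 0 T
      · rw [← ofReal_norm]
        refine ENNReal.ofReal_le_ofReal ((norm_kernel_sub_order_le hε x y).trans ?_)
        exact le_add_of_nonneg_right (norm_nonneg _)
      · rw [← ofReal_norm]
        refine ENNReal.ofReal_le_ofReal ((norm_kernel_sub_order_le hε x (-y)).trans ?_)
        exact le_add_of_nonneg_left (norm_nonneg _)
  have hBn : Tendsto (fun β ↦ B β ^ (n : ℝ)⁻¹) (𝓝[admissible H d] α) (𝓝 0) := by
    have := hB.ennrpow_const (n : ℝ)⁻¹
    rwa [ENNReal.zero_rpow_of_pos (by positivity)] at this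
  refine tendsto_of_tendsto_of_tendsto_of_le_of_le' tendsto_const_nhds hBn
    (Eventually.of_forall fun _ ↦ zero_le) ?_
  filter_upwards [self_mem_nhdsWithin] with β hβ
  have hβL := hL β hβ n h1n (by finiteness)
  have hαL := hL α hα n h1n (by finiteness)
  refine (eLpNorm_le_eLpNorm_of_exponent_le hpn (hβL.2.1.sub hαL.2.1).1).trans
    (hβL.eLpNorm_sub_le h1n hαL fun ε hε ↦ ?_)
  rw [ENNReal.le_rpow_inv_iff (by positivity), ENNReal.rpow_natCast]
  exact hLB β hβ ε hε

end FracLocalTime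

/-! ### The theorem for arbitrary versions of the derivatives. -/

theorem theorem1p1 {Ω : Type*} [MeasurableSpace Ω] (P : Measure Ω) [IsProbabilityMeasure P]
    (d : ℕ) (H : ℝ) (hH0 : 0 < H) (hH1 : H < 1)
    (X : ℝ≥0 → Ω → EuclideanSpace ℝ (Fin d)) (hX : FracLocalTime.IsSLNDGaussian P H X)
    (s : ℝ) (hs : s = 1 ∨ s = -1) :
    -- existence in every `L^p`, with one and the same limit for all `p`
    (∀ α ∈ FracLocalTime.admissible H d, ∀ (T : ℝ≥0) (x : EuclideanSpace ℝ (Fin d)),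
      ∃ Z : Ω → ℂ, ∀ p : ℝ≥0∞, 1 ≤ p → p ≠ ∞ →
        FracLocalTime.IsLocalTimeDeriv P X p s α T x Z) ∧
    -- whatever versions `L` of the derivatives in `L^p` are taken:
    ∀ p : ℝ≥0∞, 1 ≤ p → p ≠ ∞ →
      ∀ L : (Fin d → ℝ) → ℝ≥0 → EuclideanSpace ℝ (Fin d) → Ω → ℂ,
        (∀ α ∈ FracLocalTime.admissible H d, ∀ T x,
          FracLocalTime.IsLocalTimeDeriv P X p s α T x (L α T x)) →
        ∀ α ∈ FracLocalTime.admissible H d,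
          -- (1) Hölder continuity in time
          (∀ x, ∃ Z : ℝ≥0 → Ω → ℂ,
            (∀ T, Measurable (Z T) ∧ Z T =ᵐ[P] L α T x) ∧
            ∀ ω, Continuous (fun T ↦ Z T ω) ∧
              ∀ θ : ℝ≥0, 0 < θ → (θ : ℝ) < 1 - H * ((∑ l, α l) + d) →
                FracLocalTime.LocallyHolder θ (fun T ↦ Z T ω)) ∧
          -- (2) Hölder continuity in space
          (∀ T, ∃ Z : EuclideanSpace ℝ (Fin d) → Ω → ℂ,
            (∀ x, Measurable (Z x) ∧ Z x =ᵐ[P] L α T x) ∧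
            ∀ ω, Continuous (fun x ↦ Z x ω) ∧
              ∀ θ : ℝ≥0, 0 < θ → (θ : ℝ) < min 1 (1 / 2 * (1 / H - 2 * (∑ l, α l) - d)) →
                FracLocalTime.LocallyHolder θ (fun x ↦ Z x ω)) ∧
          -- (3) continuity in the order of the derivative
          (∀ T x, Tendsto (fun β ↦ eLpNorm (L β T x - L α T x) p P)
            (𝓝[FracLocalTime.admissible H d] α) (𝓝 0)) := by
  refine ⟨fun α hα T x ↦ ?_, fun p hp hp' L hL α hα ↦ ?_⟩
  · obtain ⟨Z, -, hZ⟩ := FracLocalTime.exists_isLocalTimeDeriv hX hH0 s hα T x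
    exact ⟨Z, hZ⟩
  -- The given `L` is controlled for one `p` only and need not be measurable. The estimates are
  -- applied to measurable limits valid for all finite `p`, which agree with `L` almost surely by
  -- uniqueness of limits.
  choose! Z hZm hZ using fun α (hα : α ∈ FracLocalTime.admissible H d) (T : ℝ≥0)
    (x : EuclideanSpace ℝ (Fin d)) ↦ FracLocalTime.exists_isLocalTimeDeriv hX hH0 s hα T x
  have hZL : ∀ α ∈ FracLocalTime.admissible H d, ∀ T x, Z α T x =ᵐ[P] L α T x :=
    fun α hα T x ↦ (hZ α hα T x p hp hp').ae_eq hp (hL α hα T x)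
  have ha : 0 ≤ ∑ l, α l := Finset.sum_nonneg fun l _ ↦ hα.1 l
  refine ⟨fun x ↦ ?_, fun T ↦ ?_, fun T x ↦ ?_⟩
  · obtain ⟨Y, hY, hYθ⟩ := FracLocalTime.exists_holder_time hX hH0 s hα x
      (fun T ↦ hZm α hα T x) (fun T ↦ hZ α hα T x)
    have hpos : 0 < 1 - H * ((∑ l, α l) + d) := by nlinarith [hα.2]
    obtain ⟨θ, hθ0, hθ⟩ := exists_between hpos
    exact ⟨Y, fun T ↦ ⟨(hY T).1, (hY T).2.trans (hZL α hα T x)⟩, fun ω ↦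
      ⟨(hYθ ω ⟨θ, hθ0.le⟩ hθ0 hθ).continuous hθ0, hYθ ω⟩⟩
  · obtain ⟨Y, hY, hYθ⟩ := FracLocalTime.exists_holder_space hX hH0 s hα T
      (fun x ↦ hZm α hα T x) (fun x ↦ hZ α hα T x)
    have hpos : 0 < min 1 (1 / 2 * (1 / H - 2 * (∑ l, α l) - d)) := by
      have : 2 * (∑ l, α l) + d < 1 / H := by rw [lt_div_iff₀ hH0, mul_comm]; exact hα.2
      exact lt_min one_pos (by linarith)
    obtain ⟨θ, hθ0, hθ⟩ := exists_between hpos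
    exact ⟨Y, fun x ↦ ⟨(hY x).1, (hY x).2.trans (hZL α hα T x)⟩, fun ω ↦
      ⟨(hYθ ω ⟨θ, hθ0.le⟩ hθ0 hθ).continuous hθ0, hYθ ω⟩⟩
  · refine (FracLocalTime.tendsto_eLpNorm_sub_order hX hH0 s hα T x (L := fun β ↦ Z β T x)
      (fun β hβ ↦ hZ β hβ T x) hp').congr' ?_
    filter_upwards [self_mem_nhdsWithin] with β hβ
    exact eLpNorm_congr_ae ((hZL β hβ T x).sub (hZL α hα T x))
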